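/- Let $G$ be a discrete group with a generating set $\mathfrak g$ such that $\mathfrak g=\mathfrak g^{-1}$ and $e\in\mathfrak g$, let $\mathcal S$ be an (abstract, Choi–Effros) operator system, and let $\alpha$ be an action of $G$ on $\mathcal S$ by unital complete order isomorphisms. A $C^*$-cover of an operator system $\mathcal T$ is a pair $(\mathcal C,\rho)$ of a unital $C^*$-algebra $\mathcal C$ and a unital complete order embedding $\rho:\mathcal T\to\mathcal C$ with $C^*(\rho(\mathcal T))=\mathcal C$; the $C^*$-envelope $(C^*_{\mathrm{env}}(\mathcal T),\iota)$ is a $C^*$-cover such that for each $C^*$-cover $(\mathcal C,\rho)$ there is a unique $*$-epimorphism $\pi:\mathcal C\to C^*_{\mathrm{env}}(\mathcal T)$ with $\pi\circ\rho=\iota$. Then $\mathcal S$ has a $C^*$-envelope $(C^*_{\mathrm{env}}(\mathcal S),\iota)$ (and one that is faithfully represented on a Hilbert space), and for every $C^*$-envelope of $\mathcal S$ the action $\alpha$ extends uniquely to an action, again denoted $\alpha$, of $G$ on $C^*_{\mathrm{env}}(\mathcal S)$ by $*$-automorphisms with $\alpha_g\circ\iota=\iota\circ\alpha_g$ for all $g\in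 G$. For a faithful unital representation $\pi$ of $C^*_{\mathrm{env}}(\mathcal S)$ on a Hilbert space $\mathcal H$, let $C^*_{\mathrm{env}}(\mathcal S)\rtimes_{\alpha,\lambda}G\subseteq B(\ell^2(G,\mathcal H))$ be the reduced crossed product, i.e. the $C^*$-algebra generated by the operators $a\lambda_g:=\overline\pi(a)\lambda_g$, where $(\overline\pi(a)\xi)(h)=\pi(\alpha_{h^{-1}}(a))\xi(h)$ and $(\lambda_g\xi)(h)=\xi(g^{-1}h)$, and let $$\mathcal S\rtimes_{\alpha,\lambda}\mathfrak g:=\operatorname{span}\{\iota(s)\lambda_g : s\in\mathcal S,\ g\in\mathfrak g\}\subseteq C^*_{\mathrm{env}}(\mathcal S)\rtimes_{\alpha,\lambda}G$$ with the inherited operator system structure. Then $C^*_{\mathrm{env}}(\mathcal S)\rtimes_{\alpha,\lambda}G$ together with the inclusion of $\mathcal S\rtimes_{\alpha,\lambda}\mathfrak g$ is a $C^*$-envelope of $\mathcal S\rtimes_{\alpha,\lambda}\mathfrak g$. Consequently, for every $C^*$-envelope $(C^*_{\mathrm{env}}(\mathcal S\rtimes_{\alpha,\lambda}\mathfrak g),j)$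 there is a unique $*$-isomorphism $$\Phi: C^*_{\mathrm{env}}(\mathcal S\rtimes_{\alpha,\lambda}\mathfrak g)\ \cong\ C^*_{\mathrm{env}}(\mathcal S)\rtimes_{\alpha,\lambda}G$$ with $\Phi(j(x))=x$ for all $x\in\mathcal S\rtimes_{\alpha,\lambda}\mathfrak g$. -/

import Mathlib

universe u

open scoped Matrix ENNReal

noncomputable section

/-! ### Abstract operator systems -/

/-- The scalar compression `A* M A` of a matrix `M` with entries in a complex vector space
by a rectangular complex matrix `A`. -/
def matCompress {V : Type u} [AddCommGroup V] [Module ℂ V] {m n : ℕ}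
    (A : Matrix (Fin m) (Fin n) ℂ) (M : Matrix (Fin m) (Fin m) V) :
    Matrix (Fin n) (Fin n) V :=
  Matrix.of fun i j => ∑ k, ∑ l, (star (A k i) * A l j) • M k l

/-- The diagonal matrix `1 ⊗ I_n`. -/
def unitMat (V : Type u) [AddCommGroup V] [One V] (n : ℕ) : Matrix (Fin n) (Fin n) V :=
  Matrix.diagonal fun _ => 1

/-- An abstract (Choi–Effros) operator system: a complex `*`-vector space with a compatible
family of proper cones in the hermitian matrices and an Archimedean matrix order unit `1`. -/
class OperatorSystem (V : Type u) [AddCommGroup V] [Module ℂ V] [StarAddMonoid V]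
    [StarModule ℂ V] [One V] where
  /-- `matCone n` is the cone of positive elements of `M_n(V)`. -/
  matCone : (n : ℕ) → Set (Matrix (Fin n) (Fin n) V)
  star_one : star (1 : V) = 1
  isHermitian_of_mem : ∀ {n : ℕ} {M : Matrix (Fin n) (Fin n) V}, M ∈ matCone n → M.IsHermitian
  add_mem : ∀ {n : ℕ} {M N : Matrix (Fin n) (Fin n) V},
    M ∈ matCone n → N ∈ matCone n → M + N ∈ matCone n
  compress_mem : ∀ {m n : ℕ} (A : Matrix (Fin m) (Fin n) ℂ) {M : Matrix (Fin m) (Fin m) V},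
    M ∈ matCone m → matCompress A M ∈ matCone n
  proper : ∀ {n : ℕ} {M : Matrix (Fin n) (Fin n) V},
    M ∈ matCone n → -M ∈ matCone n → M = 0
  order_unit : ∀ {n : ℕ} {M : Matrix (Fin n) (Fin n) V}, M.IsHermitian →
    ∃ r : ℝ, 0 < r ∧ (r : ℂ) • unitMat V n + M ∈ matCone n
  archimedean : ∀ {n : ℕ} {M : Matrix (Fin n) (Fin n) V},
    (∀ r : ℝ, 0 < r → (r : ℂ) • unitMat V n + M ∈ matCone n) → M ∈ matCone n

/-- The group `Aut(S)` of unital complete order isomorphisms of an operator system. -/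
def opSysAut (S : Type u) [AddCommGroup S] [Module ℂ S] [StarAddMonoid S]
    [StarModule ℂ S] [One S] [OperatorSystem S] : Subgroup (S ≃ₗ[ℂ] S) where
  carrier := {φ | φ 1 = 1 ∧ ∀ (n : ℕ) (M : Matrix (Fin n) (Fin n) S),
    M.map φ ∈ OperatorSystem.matCone n ↔ M ∈ OperatorSystem.matCone n}
  one_mem' := ⟨rfl, fun _ _ => Iff.rfl⟩
  mul_mem' := by
    rintro φ ψ ⟨h1, h2⟩ ⟨h3, h4⟩
    refine ⟨by simp [h1, h3], fun n M => ?_⟩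
    rw [← h4 n M, ← h2 n (M.map ψ)]
    rfl
  inv_mem' := by
    rintro φ ⟨h1, h2⟩
    refine ⟨?_, fun n M => ?_⟩
    · change φ.symm 1 = 1
      rw [LinearEquiv.symm_apply_eq, h1]
    · rw [← h2]
      have : (M.map (φ⁻¹ : S ≃ₗ[ℂ] S)).map φ = M := by
        ext i j
        exact φ.apply_symm_apply (M i j)
      rw [this]

/-- An operator system dynamical system `(S, G, 𝔤, α)` with `G` discrete: `𝔤` is a generating
set of `G` which is closed under inverses and contains the identity, and `α` is an action of `G`
on `S` by unital complete order isomorphisms. -/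
structure OpSysDynSystem (S : Type u) [AddCommGroup S] [Module ℂ S] [StarAddMonoid S]
    [StarModule ℂ S] [One S] [OperatorSystem S] (G : Type u) [Group G] where
  gens : Set G
  closure_gens : Subgroup.closure gens = ⊤
  inv_mem_gens : ∀ {g : G}, g ∈ gens → g⁻¹ ∈ gens
  one_mem_gens : (1 : G) ∈ gens
  act : G →* opSysAut S

/-! ### Positive matrices over C*-algebras, C*-covers and C*-envelopes -/

/-- Positivity in `M_n(A)`, for a C*-algebra `A`: being of the form `N* N`. -/
def MatPos {A : Type u} [CStarAlgebra A] {n : ℕ} (M : Matrix (Fin n) (Fin n) A) : Prop :=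
  ∃ N : Matrix (Fin n) (Fin n) A, M = Nᴴ * N

section Cover

variable {S : Type u} [AddCommGroup S] [Module ℂ S] [StarAddMonoid S]
  [StarModule ℂ S] [One S] [OperatorSystem S]

/-- `(C, ρ)` is a C*-cover of `S`: `ρ` is a unital complete order embedding whose range generates
`C` as a C*-algebra. -/
structure IsCStarCover {C : Type u} [CStarAlgebra C] (ρ : S →ₗ[ℂ] C) : Prop where
  map_one : ρ 1 = 1
  matPos_iff : ∀ (n : ℕ) (M : Matrix (Fin n) (Fin n) S),
    MatPos (M.map ρ) ↔ M ∈ OperatorSystem.matCone n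
  generates : (StarAlgebra.adjoin ℂ (Set.range ρ)).topologicalClosure = ⊤

/-- `(E, ι)` is the C*-envelope of `S`: it is a C*-cover, and every C*-cover `(C, ρ)` has a unique
`*`-epimorphism `π : C → E` with `π ∘ ρ = ι`. -/
structure IsCStarEnvelope {E : Type u} [CStarAlgebra E] (ι : S →ₗ[ℂ] E) : Prop where
  isCStarCover : IsCStarCover ι
  universal : ∀ (C : Type u) [CStarAlgebra C] (ρ : S →ₗ[ℂ] C), IsCStarCover ρ →
    ∃! π : C →⋆ₐ[ℂ] E, Function.Surjective π ∧ ∀ s, π (ρ s) = ι s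

/-- A unital complete order embedding into a C*-algebra preserves the involution. -/
theorem IsCStarCover.map_star {C : Type u} [CStarAlgebra C] {ρ : S →ₗ[ℂ] C}
    (h : IsCStarCover ρ) (s : S) : ρ (star s) = star (ρ s) := by
  have key : ∀ x : S, star x = x → star (ρ x) = ρ x := by
    intro x hx
    obtain ⟨r, -, hr⟩ := OperatorSystem.order_unit (n := 1) (M := Matrix.of fun _ _ => x)
      (by ext i j; simpa using hx)
    obtain ⟨N, hN⟩ := (h.matPos_iff 1 _).2 hr
    have h2 : star (ρ ((r : ℂ) • 1 + x)) = ρ ((r : ℂ) • 1 + x) := by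
      have e := congrFun (congrFun hN 0) 0
      have e' : ρ ((r : ℂ) • 1 + x) = (Nᴴ * N) 0 0 := by
        rw [← e]; simp [unitMat]
      rw [e']
      exact congrFun (congrFun (Matrix.isHermitian_conjTranspose_mul_self N) 0) 0
    simpa [h.map_one, Complex.conj_ofReal] using h2
  have h1 := key (s + star s) (by simp [add_comm])
  have h2 := key (Complex.I • (s - star s)) (by simp [sub_eq_add_neg, add_comm])
  simp only [map_add, star_add, map_smul, map_sub, star_smul, star_sub, Complex.star_def,
    Complex.conj_I] at h1 h2
  have h3 : star (ρ (star s)) - star (ρ s) = ρ s - ρ (star s) := by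
    have := congrArg (fun y => Complex.I • y) h2
    simp only [smul_smul] at this
    simp only [mul_neg, Complex.I_mul_I, neg_neg, one_smul, neg_smul] at this
    rw [← neg_sub, this, neg_sub, neg_sub]
  have h4 : (2 : ℂ) • star (ρ s) = (2 : ℂ) • ρ (star s) := by
    rw [two_smul, two_smul]
    calc star (ρ s) + star (ρ s) = (star (ρ s) + star (ρ (star s)))
          - (star (ρ (star s)) - star (ρ s)) := by abel
      _ = _ := by rw [h1, h3]; abel
  exact (smul_right_injective C (two_ne_zero (α := ℂ)) h4).symm

end Cover

/-! ### Operator subsystems of C*-algebras -/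

/-- A unital selfadjoint linear subspace of a unital C*-algebra. -/
structure OperatorSubsystem (A : Type u) [CStarAlgebra A] extends Submodule ℂ A where
  one_mem' : (1 : A) ∈ carrier
  star_mem' : ∀ {a : A}, a ∈ carrier → star a ∈ carrier

namespace OperatorSubsystem

variable {A : Type u} [CStarAlgebra A]

instance : SetLike (OperatorSubsystem A) A where
  coe X := X.carrier
  coe_injective := by
    rintro ⟨X, _, _⟩ ⟨Y, _, _⟩ h
    congr
    exact SetLike.coe_injective h

instance : AddSubgroupClass (OperatorSubsystem A) A where
  add_mem {X} := X.toSubmodule.add_mem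
  zero_mem X := X.toSubmodule.zero_mem
  neg_mem {X} := X.toSubmodule.neg_mem

instance : SMulMemClass (OperatorSubsystem A) ℂ A where
  smul_mem {X} r _ h := X.toSubmodule.smul_mem r h

instance : OneMemClass (OperatorSubsystem A) A where
  one_mem X := X.one_mem'

instance : StarMemClass (OperatorSubsystem A) A where
  star_mem {X} _ h := X.star_mem' h

variable (X : OperatorSubsystem A)

instance : StarAddMonoid X where
  star_involutive x := Subtype.ext (star_star (x : A))
  star_add x y := Subtype.ext (star_add (x : A) y)

instance : StarModule ℂ X where
  star_smul r x := Subtype.ext (star_smul r (x : A))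

/-- The inclusion of an operator subsystem. -/
def incl : X →ₗ[ℂ] A where
  toFun x := x
  map_add' _ _ := rfl
  map_smul' _ _ := rfl

end OperatorSubsystem

section MatPos

variable {A : Type u} [CStarAlgebra A] {n : ℕ}

theorem nonneg_iff_exists_star_mul_self {B : Type u} [CStarAlgebra B] [PartialOrder B]
    [StarOrderedRing B] (b : B) : 0 ≤ b ↔ ∃ c, b = star c * c :=
  CStarAlgebra.nonneg_iff_eq_star_mul_self

theorem matPos_iff_nonneg [PartialOrder A] [StarOrderedRing A] (M : Matrix (Fin n) (Fin n) A) :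
    MatPos M ↔ 0 ≤ CStarMatrix.ofMatrix M :=
  (nonneg_iff_exists_star_mul_self (CStarMatrix.ofMatrix M)).symm

theorem MatPos.add {M N : Matrix (Fin n) (Fin n) A} (hM : MatPos M) (hN : MatPos N) :
    MatPos (M + N) := by
  let _ := CStarAlgebra.spectralOrder A
  let _ := CStarAlgebra.spectralOrderedRing A
  rw [matPos_iff_nonneg] at *
  exact add_nonneg hM hN

theorem MatPos.sum {κ : Type*} (s : Finset κ) {M : κ → Matrix (Fin n) (Fin n) A}
    (h : ∀ k, MatPos (M k)) : MatPos (∑ k ∈ s, M k) :=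
  Finset.sum_induction _ _ (fun _ _ => MatPos.add) ⟨0, by simp⟩ fun k _ => h k

theorem matPos_conjTranspose_mul_self {m : ℕ} (P : Matrix (Fin m) (Fin n) A) :
    MatPos (Pᴴ * P) := by
  rcases n with _ | n
  · exact ⟨0, Subsingleton.elim _ _⟩
  have : Pᴴ * P = ∑ k, Matrix.of fun i j => star (P k i) * P k j := by
    ext i j
    simp [Matrix.mul_apply, Matrix.sum_apply]
  rw [this]
  refine MatPos.sum _ fun k => ⟨Matrix.of fun i j => if i = 0 then P k j else 0, ?_⟩
  ext i j
  simp [Matrix.mul_apply, Matrix.conjTranspose_apply]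

theorem MatPos.compress {m : ℕ} (B : Matrix (Fin m) (Fin n) ℂ) {M : Matrix (Fin m) (Fin m) A}
    (h : MatPos M) : MatPos (matCompress B M) := by
  have key : matCompress B M =
      (B.map (algebraMap ℂ A))ᴴ * M * B.map (algebraMap ℂ A) := by
    ext i j
    simp only [matCompress, Matrix.of_apply, Matrix.mul_apply, Matrix.conjTranspose_apply,
      Matrix.map_apply, Finset.sum_mul]
    rw [Finset.sum_comm]
    refine Finset.sum_congr rfl fun l _ => Finset.sum_congr rfl fun k _ => ?_
    rw [← algebraMap_star_comm, ← Algebra.commutes, ← mul_assoc, ← map_mul, ← Algebra.smul_def,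
      mul_comm]
  obtain ⟨N, rfl⟩ := h
  convert matPos_conjTranspose_mul_self (N * B.map (algebraMap ℂ A)) using 1
  rw [key, Matrix.conjTranspose_mul]
  simp only [Matrix.mul_assoc]

theorem MatPos.isHermitian {M : Matrix (Fin n) (Fin n) A} (h : MatPos M) : M.IsHermitian := by
  obtain ⟨N, rfl⟩ := h
  exact Matrix.isHermitian_conjTranspose_mul_self N

theorem MatPos.proper {M : Matrix (Fin n) (Fin n) A} (h : MatPos M) (h' : MatPos (-M)) :
    M = 0 := by
  let _ := CStarAlgebra.spectralOrder A
  let _ := CStarAlgebra.spectralOrderedRing A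
  rw [matPos_iff_nonneg] at *
  have h2 : 0 ≤ -CStarMatrix.ofMatrix M := h'
  exact (le_antisymm (neg_nonneg.1 h2) h : CStarMatrix.ofMatrix M = 0)

theorem ofMatrix_unitMat_add (r : ℝ) (M : Matrix (Fin n) (Fin n) A) :
    CStarMatrix.ofMatrix ((r : ℂ) • unitMat A n + M) =
      (r : ℂ) • (1 : CStarMatrix (Fin n) (Fin n) A) + CStarMatrix.ofMatrix M := rfl

theorem MatPos.order_unit {M : Matrix (Fin n) (Fin n) A} (h : M.IsHermitian) :
    ∃ r : ℝ, 0 < r ∧ MatPos ((r : ℂ) • unitMat A n + M) := by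
  let _ := CStarAlgebra.spectralOrder A
  let _ := CStarAlgebra.spectralOrderedRing A
  have hs : IsSelfAdjoint (CStarMatrix.ofMatrix M) := h
  refine ⟨‖CStarMatrix.ofMatrix M‖ + 1, by positivity, ?_⟩
  rw [matPos_iff_nonneg, ofMatrix_unitMat_add]
  have h1 := hs.neg_algebraMap_norm_le_self
  have h2 : (0 : CStarMatrix (Fin n) (Fin n) A) ≤ 1 := zero_le_one
  have h3 : ((‖CStarMatrix.ofMatrix M‖ + 1 : ℝ) : ℂ) • (1 : CStarMatrix (Fin n) (Fin n) A) =
      algebraMap ℝ _ ‖CStarMatrix.ofMatrix M‖ + 1 := by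
    rw [Complex.ofReal_add, Complex.ofReal_one, add_smul (M := CStarMatrix (Fin n) (Fin n) A),
      one_smul, Algebra.algebraMap_eq_smul_one]
    rfl
  rw [h3, add_right_comm]
  exact add_nonneg (neg_le_iff_add_nonneg'.1 h1) h2

theorem MatPos.archimedean {M : Matrix (Fin n) (Fin n) A}
    (h : ∀ r : ℝ, 0 < r → MatPos ((r : ℂ) • unitMat A n + M)) : MatPos M := by
  let _ := CStarAlgebra.spectralOrder A
  let _ := CStarAlgebra.spectralOrderedRing A
  simp only [matPos_iff_nonneg, ofMatrix_unitMat_add] at *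
  have hc : Continuous fun r : ℝ => (r : ℂ) • (1 : CStarMatrix (Fin n) (Fin n) A) +
      CStarMatrix.ofMatrix M := by fun_prop
  have ht := (hc.tendsto 0).mono_left (nhdsWithin_le_nhds (s := Set.Ioi 0))
  simp only [Complex.ofReal_zero, zero_smul, zero_add] at ht
  refine ge_of_tendsto ht ?_
  filter_upwards [self_mem_nhdsWithin] with r hr using h r hr

end MatPos

theorem OperatorSubsystem.map_unitMat_add {A : Type u} [CStarAlgebra A] {n : ℕ}
    (X : OperatorSubsystem A) (r : ℝ) (M : Matrix (Fin n) (Fin n) X) :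
    ((r : ℂ) • unitMat X n + M).map X.incl = (r : ℂ) • unitMat A n + M.map X.incl := by
  have h1 : X.incl 1 = 1 := rfl
  ext i j
  simp only [Matrix.map_apply, Matrix.add_apply, Matrix.smul_apply, unitMat,
    Matrix.diagonal_apply, map_add, map_smul]
  split_ifs <;> simp [h1]

/-- An operator subsystem of a C*-algebra `A`, with the matrix order inherited from `A`. -/
instance OperatorSubsystem.instOperatorSystem {A : Type u} [CStarAlgebra A]
    (X : OperatorSubsystem A) : OperatorSystem X where
  matCone n := {M | MatPos (M.map X.incl)}
  star_one := Subtype.ext (_root_.star_one A)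
  isHermitian_of_mem {n M} h := by
    ext i j
    exact congrFun (congrFun (MatPos.isHermitian h) i) j
  add_mem {n M N} hM hN := by
    have := MatPos.add hM hN
    rwa [← Matrix.map_add _ (map_add X.incl)] at this
  compress_mem {m n} B M h := by
    have := MatPos.compress B h
    have e : (matCompress B M).map X.incl = matCompress B (M.map X.incl) := by
      ext i j
      simp [matCompress]
    rwa [← e] at this
  proper {n M} h h' := by
    have e : (-M).map X.incl = -(M.map X.incl) := by ext i j; simp
    have := MatPos.proper h (by rw [← e]; exact h')
    ext i j
    exact congrFun (congrFun this i) j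
  order_unit {n M} h := by
    have h' : (M.map X.incl).IsHermitian := by
      ext i j
      exact congrArg Subtype.val (congrFun (congrFun h i) j)
    obtain ⟨r, hr, hp⟩ := MatPos.order_unit h'
    exact ⟨r, hr, by rwa [← X.map_unitMat_add] at hp⟩
  archimedean {n M} h := by
    refine MatPos.archimedean fun r hr => ?_
    rw [← X.map_unitMat_add]
    exact h r hr

/-! ### The reduced crossed product -/

section CrossedProduct

variable {E : Type u} [CStarAlgebra E] {G : Type u} [Group G]
  {H : Type u} [NormedAddCommGroup H] [InnerProductSpace ℂ H] [CompleteSpace H]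

/-- The Hilbert space `ℓ²(G, H) = H ⊗ ℓ²(G)`. -/
abbrev L2 (G H : Type u) [NormedAddCommGroup H] : Type u := lp (fun _ : G => H) 2

theorem L2.norm_sq {G H : Type u} [NormedAddCommGroup H] (ξ : L2 G H) : ‖ξ‖ ^ 2 = ∑' h, ‖ξ h‖ ^ 2 := by
  have := lp.norm_rpow_eq_tsum (p := 2) (by simp) ξ
  simpa using this

/-- A bounded family of operators acts diagonally on `ℓ²(G, H)`. -/
def diagOp (T : G → H →L[ℂ] H) (c : ℝ) (hc : 0 ≤ c) (hT : ∀ h, ‖T h‖ ≤ c) :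
    L2 G H →L[ℂ] L2 G H :=
  have hle : ∀ (ξ : L2 G H) (h : G), ‖T h (ξ h)‖ ≤ ‖(c • ξ : L2 G H) h‖ := fun ξ h => by
    have e : (c • ξ : L2 G H) h = c • ξ h := rfl
    rw [e, norm_smul, Real.norm_of_nonneg hc]
    exact (T h).le_of_opNorm_le (hT h) _
  LinearMap.mkContinuous
    { toFun := fun ξ => ⟨fun h => T h (ξ h), Memℓp.mono' (lp.memℓp (c • ξ)) (hle ξ)⟩
      map_add' := fun ξ η => lp.ext <| funext fun h => map_add (T h) (ξ h) (η h)
      map_smul' := fun z ξ => lp.ext <| funext fun h => map_smul (T h) z (ξ h) } c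
    fun ξ => by
      refine (lp.norm_mono (p := 2) (by simp) (hle ξ)).trans ?_
      rw [norm_smul, Real.norm_of_nonneg hc]

/-- The operator `π̄(a)` on `ℓ²(G, H)`, given by `(π̄(a) ξ)(h) = π(β_{h⁻¹}(a)) ξ(h)`. -/
def regRep (β : G →* (E ≃⋆ₐ[ℂ] E)) (π : E →⋆ₐ[ℂ] (H →L[ℂ] H)) (a : E) : L2 G H →L[ℂ] L2 G H :=
  diagOp (fun h => π (β h⁻¹ a)) ‖a‖ (norm_nonneg a) fun h =>
    (NonUnitalStarAlgHom.norm_apply_le π _).trans (NonUnitalStarAlgHom.norm_apply_le (β h⁻¹) a)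

/-- The translation `λ_g` on `ℓ²(G, H)`, given by `(λ_g ξ)(h) = ξ(g⁻¹ h)`. -/
def regShift (H : Type u) [NormedAddCommGroup H] [InnerProductSpace ℂ H] (g : G) :
    L2 G H →L[ℂ] L2 G H :=
  LinearMap.mkContinuous
    { toFun := fun ξ => ⟨fun h => ξ (g⁻¹ * h), by
        refine (memℓp_gen_iff (by simp)).2 ?_
        exact ((lp.memℓp ξ).summable (by simp)).comp_injective (mul_right_injective g⁻¹)⟩
      map_add' := fun _ _ => rfl
      map_smul' := fun _ _ => rfl } 1
    fun ξ => by
      rw [one_mul]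
      refine le_of_eq ((sq_eq_sq₀ (norm_nonneg _) (norm_nonneg _)).1 ?_)
      rw [L2.norm_sq, L2.norm_sq]
      exact (Equiv.mulLeft g⁻¹).tsum_eq fun h => ‖ξ h‖ ^ 2

theorem regRep_apply (β : G →* (E ≃⋆ₐ[ℂ] E)) (π : E →⋆ₐ[ℂ] (H →L[ℂ] H)) (a : E) (ξ : L2 G H)
    (h : G) : regRep β π a ξ h = π (β h⁻¹ a) (ξ h) := rfl

theorem regShift_apply {H : Type u} [NormedAddCommGroup H] [InnerProductSpace ℂ H] (g : G) (ξ : L2 G H) (h : G) : regShift H g ξ h = ξ (g⁻¹ * h) := rfl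

theorem L2.inner_eq {G H : Type u} [NormedAddCommGroup H] [InnerProductSpace ℂ H]
    (ξ η : L2 G H) : inner ℂ ξ η = ∑' h, inner ℂ (ξ h) (η h) := rfl

theorem star_regRep (β : G →* (E ≃⋆ₐ[ℂ] E)) (π : E →⋆ₐ[ℂ] (H →L[ℂ] H)) (a : E) :
    star (regRep β π a) = regRep β π (star a) := by
  rw [ContinuousLinearMap.star_eq_adjoint]
  refine ((ContinuousLinearMap.eq_adjoint_iff _ _).2 fun ξ η => ?_).symm
  rw [L2.inner_eq, L2.inner_eq]
  refine tsum_congr fun h => ?_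
  rw [regRep_apply, regRep_apply, map_star, map_star, ContinuousLinearMap.star_eq_adjoint,
    ContinuousLinearMap.adjoint_inner_left]

theorem star_regShift (g : G) : star (regShift H g) = regShift H g⁻¹ := by
  rw [ContinuousLinearMap.star_eq_adjoint]
  refine ((ContinuousLinearMap.eq_adjoint_iff _ _).2 fun ξ η => ?_).symm
  rw [L2.inner_eq, L2.inner_eq, ← (Equiv.mulLeft g⁻¹).tsum_eq]
  refine tsum_congr fun h => ?_
  simp [regShift_apply]

theorem regShift_mul_regRep (β : G →* (E ≃⋆ₐ[ℂ] E)) (π : E →⋆ₐ[ℂ] (H →L[ℂ] H)) (g : G) (a : E) :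
    regShift H g * regRep β π a = regRep β π (β g a) * regShift H g := by
  refine ContinuousLinearMap.ext fun ξ => lp.ext (funext fun h => ?_)
  change regShift H g (regRep β π a ξ) h = regRep β π (β g a) (regShift H g ξ) h
  have e : β h⁻¹ (β g a) = β (g⁻¹ * h)⁻¹ a := by
    rw [mul_inv_rev, inv_inv, map_mul]
    rfl
  rw [regShift_apply, regRep_apply, regRep_apply, regShift_apply, e]

theorem regRep_one_mul_regShift_one (β : G →* (E ≃⋆ₐ[ℂ] E)) (π : E →⋆ₐ[ℂ] (H →L[ℂ] H)) :
    regRep β π 1 * regShift H (1 : G) = 1 := by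
  refine ContinuousLinearMap.ext fun ξ => lp.ext (funext fun h => ?_)
  change regRep β π 1 (regShift H 1 ξ) h = ξ h
  rw [regRep_apply, regShift_apply]
  simp

/-- The reduced crossed product `E ⋊_{β,λ} G`, realized from a faithful representation `π` of `E`
on `H`: the C*-subalgebra of `B(ℓ²(G, H))` generated by the operators `π̄(a) λ_g`. -/
def reducedCrossedProduct (β : G →* (E ≃⋆ₐ[ℂ] E)) (π : E →⋆ₐ[ℂ] (H →L[ℂ] H)) :
    StarSubalgebra ℂ (L2 G H →L[ℂ] L2 G H) :=
  (StarAlgebra.adjoin ℂ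
    {x | ∃ (a : E) (g : G), x = regRep β π a * regShift H g}).topologicalClosure

instance (β : G →* (E ≃⋆ₐ[ℂ] E)) (π : E →⋆ₐ[ℂ] (H →L[ℂ] H)) :
    IsClosed (reducedCrossedProduct β π : Set (L2 G H →L[ℂ] L2 G H)) :=
  StarSubalgebra.isClosed_topologicalClosure _

/-- The element `a λ_g` of the reduced crossed product. -/
def crossedMonomial (β : G →* (E ≃⋆ₐ[ℂ] E)) (π : E →⋆ₐ[ℂ] (H →L[ℂ] H)) (a : E) (g : G) :
    reducedCrossedProduct β π :=
  ⟨regRep β π a * regShift H g,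
    StarSubalgebra.le_topologicalClosure _ (StarAlgebra.subset_adjoin ℂ _ ⟨a, g, rfl⟩)⟩

theorem crossedMonomial_one (β : G →* (E ≃⋆ₐ[ℂ] E)) (π : E →⋆ₐ[ℂ] (H →L[ℂ] H)) :
    crossedMonomial β π 1 1 = 1 :=
  Subtype.ext (regRep_one_mul_regShift_one β π)

theorem star_crossedMonomial (β : G →* (E ≃⋆ₐ[ℂ] E)) (π : E →⋆ₐ[ℂ] (H →L[ℂ] H)) (a : E) (g : G) :
    star (crossedMonomial β π a g) = crossedMonomial β π (β g⁻¹ (star a)) g⁻¹ := by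
  refine Subtype.ext ?_
  change star (regRep β π a * regShift H g) = _
  rw [star_mul, star_regRep, star_regShift, regShift_mul_regRep]
  rfl

end CrossedProduct

section OpSysCrossedProduct

variable {S : Type u} [AddCommGroup S] [Module ℂ S] [StarAddMonoid S]
  [StarModule ℂ S] [One S] [OperatorSystem S] {G : Type u} [Group G]
  {E : Type u} [CStarAlgebra E]
  {H : Type u} [NormedAddCommGroup H] [InnerProductSpace ℂ H] [CompleteSpace H]

/-- The triple `(E, ι, β)` is an admissible C*-cover of the dynamical system `D`. -/
structure IsAdmissible (D : OpSysDynSystem S G) (ι : S →ₗ[ℂ] E) (β : G →* (E ≃⋆ₐ[ℂ] E)) :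
    Prop where
  isCStarCover : IsCStarCover ι
  equivariant : ∀ (g : G) (s : S), β g (ι s) = ι ((D.act g : S ≃ₗ[ℂ] S) s)

/-- The reduced crossed product of an operator system, relative to an admissible C*-cover
`(E, ι, β)`: the operator subsystem `span {ι(s) λ_g : s ∈ S, g ∈ 𝔤}` of `E ⋊_{β,λ} G`. -/
def opSysReducedCrossedProduct (D : OpSysDynSystem S G) {ι : S →ₗ[ℂ] E}
    {β : G →* (E ≃⋆ₐ[ℂ] E)} (hβ : IsAdmissible D ι β) (π : E →⋆ₐ[ℂ] (H →L[ℂ] H)) :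
    OperatorSubsystem (reducedCrossedProduct β π) where
  toSubmodule := Submodule.span ℂ
    {x | ∃ (s : S) (g : G), g ∈ D.gens ∧ x = crossedMonomial β π (ι s) g}
  one_mem' := Submodule.subset_span
    ⟨1, 1, D.one_mem_gens, by rw [hβ.isCStarCover.map_one, crossedMonomial_one]⟩
  star_mem' {a} ha := by
    change a ∈ Submodule.span ℂ _ at ha
    change star a ∈ Submodule.span ℂ _
    induction ha using Submodule.span_induction with
    | mem x hx =>
      obtain ⟨s, g, hg, rfl⟩ := hx
      refine Submodule.subset_span
        ⟨(D.act g⁻¹ : S ≃ₗ[ℂ] S) (star s), g⁻¹, D.inv_mem_gens hg, ?_⟩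
      rw [star_crossedMonomial, ← hβ.equivariant, hβ.isCStarCover.map_star]
    | zero => simp
    | add x y _ _ hx hy => rw [star_add]; exact add_mem hx hy
    | smul z x _ hx => rw [star_smul]; exact Submodule.smul_mem _ _ hx

end OpSysCrossedProduct

end

/-! Call a unital completely positive map maximal when all its dilations are trivial. A C*-cover (E,
ι) with a faithful representation σ such that σ ∘ ι is maximal is the C*-envelope
(`IsMaximalUCP.isCStarEnvelope`): given another cover (C, ρ), Arveson extension and Stinespring
dilation dilate σ ∘ ι to a representation of C; as the dilation is trivial, the original space is
reducing, so compression to it is a *-homomorphism on C that carries ρ to σ ∘ ι and therefore C onto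
σ(E).

Existence of the envelope thus needs a maximal map that determines the matrix order. Hermitian
matrices outside the cones are separated from them by completely positive kernels
(`OperatorSystem.exists_isCPKernel_of_notMem`), whose direct sum is again such a kernel, and every
kernel is given by a maximal map (`IsCPKernel.exists_isMaximalUCP`). The last point works with
moments ⟨s₁⋯sₖ eᵢ, t₁⋯tₗ eⱼ⟩: for n = 0, 1, 2, …, keep the moments of order at most 2n + 1 and make
the norms of the words of length n + 1 maximal, by compactness. The kernel itself consists of
moments of order one and is never changed. In a dilation of the limit the norms of words can only
grow, so maximality keeps the words inside the original space.

For the crossed product, let κ be a faithful representation of E on K with κ ∘ ι maximal. The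
reduced crossed product does not depend on the faithful representation
(`exists_starAlgHom_reducedCrossedProduct`), so it acts on ℓ²(G, K). There S acts on the fibre over
g through κ ∘ ι ∘ α_{g⁻¹}, which is maximal since automorphisms preserve maximality. Enlarge a
dilation of S ⋊ 𝔤 to a representation of E ⋊ G: the elements of S leave ℓ²(G, K) invariant by
maximality on the fibres, and the λ_g do so because a contraction whose compression is isometric
leaves the subspace invariant. Hence the regular representation is maximal on S ⋊ 𝔤
(`isMaximalUCP_opSysReducedCrossedProduct`), and the criterion applies. -/

section Development

open scoped ComplexOrder ComplexConjugate

/-! ### Hilbert spaces and operators from sesquilinear forms -/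

section HilbertSpaceOfForm

/-- Every positive semidefinite sesquilinear form is realized on a dense subspace of a
Hilbert space. -/
theorem exists_hilbert_of_core {D : Type u} [AddCommGroup D] [Module ℂ D]
    (c : PreInnerProductSpace.Core ℂ D) :
    ∃ (H : Type u) (_ : NormedAddCommGroup H) (_ : InnerProductSpace ℂ H) (_ : CompleteSpace H)
      (e : D →ₗ[ℂ] H), DenseRange e ∧ ∀ x y, inner ℂ (e x) (e y) = c.inner x y := by
  let _ : SeminormedAddCommGroup D := InnerProductSpace.Core.toSeminormedAddCommGroup (c := c)
  let _ : InnerProductSpace ℂ D := InnerProductSpace.ofCore c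
  refine ⟨UniformSpace.Completion D, inferInstance, inferInstance, inferInstance,
    (UniformSpace.Completion.toComplL (𝕜 := ℂ) (E := D)).toLinearMap, ?_, fun x y => ?_⟩
  · exact UniformSpace.Completion.denseRange_coe
  · exact UniformSpace.Completion.inner_coe x y

variable {D : Type*} [AddCommGroup D] [Module ℂ D]
  {H : Type*} [NormedAddCommGroup H] [InnerProductSpace ℂ H]

/-- A vector is determined by its inner products with a dense set. -/
theorem DenseRange.ext_inner {ι : Type*} {e : ι → H} (he : DenseRange e) {v w : H}
    (h : ∀ x, inner ℂ (e x) v = inner ℂ (e x) w) : v = w := by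
  refine ext_inner_left ℂ fun z => ?_
  refine he.induction_on (p := fun z => inner ℂ z v = inner ℂ z w) z ?_ h
  exact isClosed_eq (by fun_prop) (by fun_prop)

/-- A bounded sesquilinear form on a dense subspace is given by a bounded operator. -/
theorem exists_operator_of_form [CompleteSpace H] {e : D →ₗ[ℂ] H} (he : DenseRange e)
    (T : D →ₗ⋆[ℂ] D →ₗ[ℂ] ℂ) {r : ℝ} (hT : ∀ x y, ‖T x y‖ ≤ r * ‖e x‖ * ‖e y‖) :
    ∃ A : H →L[ℂ] H, ∀ x y, inner ℂ (e x) (A (e y)) = T x y := by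
  -- Riesz representation of the conjugate of T(·, y), extended from the dense range of e. The
  -- absolute value gives a nonnegative bound without a sign condition on r.
  have key : ∀ y, ∃ v : H, (∀ x, inner ℂ (e x) v = T x y) ∧ ‖v‖ ≤ |r| * ‖e y‖ := by
    intro y
    let f : D →ₗ[ℂ] ℂ :=
      { toFun := fun x => conj (T x y)
        map_add' := fun a b => by simp
        map_smul' := fun a b => by simp }
    have hb : ∀ x, ‖f x‖ ≤ (|r| * ‖e y‖) * ‖e x‖ := fun x => by
      have h1 := hT x y
      have h2 : r * ‖e x‖ * ‖e y‖ ≤ |r| * ‖e x‖ * ‖e y‖ := by gcongr; exact le_abs_self r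
      simp only [f, LinearMap.coe_mk, AddHom.coe_mk, RCLike.norm_conj]
      linarith
    refine ⟨(InnerProductSpace.toDual ℂ H).symm (f.extendOfNorm e), fun x => ?_, ?_⟩
    · rw [← inner_conj_symm, InnerProductSpace.toDual_symm_apply,
        LinearMap.extendOfNorm_eq he ⟨_, hb⟩]
      simp [f]
    · rw [LinearIsometryEquiv.norm_map]
      exact LinearMap.opNorm_extendOfNorm_le he (by positivity) hb
  choose v hv hv' using key
  let g : D →ₗ[ℂ] H :=
    { toFun := v
      map_add' := fun a b => he.ext_inner fun x => by simp [hv]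
      map_smul' := fun a b => he.ext_inner fun x => by simp [hv] }
  refine ⟨g.extendOfNorm e, fun x y => ?_⟩
  rw [LinearMap.extendOfNorm_eq he ⟨|r|, hv'⟩]
  exact hv y x

end HilbertSpaceOfForm

/-! ### Cones and order bounds in an operator system -/

section OperatorSystemBasics

variable {S : Type u} [AddCommGroup S] [Module ℂ S] [StarAddMonoid S]
  [StarModule ℂ S] [One S] [OperatorSystem S]

/-- Scaling by r is compression by the scalar diagonal matrix with entries √r. -/
theorem OperatorSystem.smul_mem {n : ℕ} {M : Matrix (Fin n) (Fin n) S}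
    (hM : M ∈ OperatorSystem.matCone n) {r : ℝ} (hr : 0 ≤ r) :
    (r : ℂ) • M ∈ OperatorSystem.matCone n := by
  have h := OperatorSystem.compress_mem (Matrix.diagonal fun _ : Fin n => ((√r : ℝ) : ℂ)) hM
  convert h using 1
  ext i j
  simp only [matCompress, Matrix.smul_apply, Matrix.of_apply, Matrix.diagonal_apply]
  rw [Finset.sum_eq_single i, Finset.sum_eq_single j]
  · simp only [if_true, Complex.star_def, Complex.conj_ofReal, ← Complex.ofReal_mul,
      Real.mul_self_sqrt hr]
  · intro b _ hb; simp [hb]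
  · simp
  · intro b _ hb; simp [hb]
  · simp

theorem OperatorSystem.unitMat_mem (n : ℕ) : unitMat S n ∈ OperatorSystem.matCone n := by
  obtain ⟨r, hr, h⟩ := OperatorSystem.order_unit (M := (0 : Matrix (Fin n) (Fin n) S))
    (Matrix.isHermitian_zero)
  rw [add_zero] at h
  have := OperatorSystem.smul_mem h (inv_nonneg.2 hr.le)
  rwa [smul_smul, ← Complex.ofReal_mul, inv_mul_cancel₀ hr.ne', Complex.ofReal_one,
    one_smul] at this

theorem OperatorSystem.zero_mem (n : ℕ) :
    (0 : Matrix (Fin n) (Fin n) S) ∈ OperatorSystem.matCone n := by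
  simpa using OperatorSystem.smul_mem (OperatorSystem.unitMat_mem (S := S) n) le_rfl

/-- The matrix `[[r, s], [s*, r]]` is positive for large `r`. -/
theorem OperatorSystem.exists_two_by_two_mem (s : S) :
    ∃ r : ℝ, 0 < r ∧
      !![(r : ℂ) • (1 : S), s; star s, (r : ℂ) • 1] ∈ OperatorSystem.matCone 2 := by
  obtain ⟨r, hr, h⟩ := OperatorSystem.order_unit (M := !![0, s; star s, 0]) (by
    ext i j
    fin_cases i <;> fin_cases j <;> simp)
  refine ⟨r, hr, ?_⟩
  convert h using 1
  ext i j
  fin_cases i <;> fin_cases j <;> simp [unitMat]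

/-- A bound for the norm of `s` under all unital completely positive maps. -/
noncomputable def OperatorSystem.bound (s : S) : ℝ :=
  (OperatorSystem.exists_two_by_two_mem s).choose

theorem OperatorSystem.bound_pos (s : S) : 0 < OperatorSystem.bound s :=
  (OperatorSystem.exists_two_by_two_mem s).choose_spec.1

theorem OperatorSystem.bound_mem (s : S) :
    !![(OperatorSystem.bound s : ℂ) • (1 : S), s; star s, (OperatorSystem.bound s : ℂ) • 1] ∈
      OperatorSystem.matCone 2 :=
  (OperatorSystem.exists_two_by_two_mem s).choose_spec.2

end OperatorSystemBasics

/-! ### Completely positive kernels and their Cauchy–Schwarz inequality -/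

section KernelForm

variable {S : Type*} [AddCommGroup S] [Module ℂ S] {J : Type*}

/-- The sesquilinear form on finitely supported functions defined by a kernel. -/
noncomputable def kernelForm (Φ : J → J → S →ₗ[ℂ] ℂ) (s : S) :
    (J →₀ ℂ) →ₗ⋆[ℂ] (J →₀ ℂ) →ₗ[ℂ] ℂ :=
  LinearMap.mk₂'ₛₗ _ _ (fun x y => x.sum fun j a => conj a *
      Finsupp.linearCombination ℂ (fun j' => Φ j j' s) y)
    (fun x x' y => by
      refine Finsupp.sum_add_index' ?_ ?_
      · simp
      · intros; simp [add_mul])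
    (fun c x y => by
      rw [Finsupp.sum_smul_index (by simp), smul_eq_mul, Finsupp.mul_sum]
      simp [mul_assoc])
    (fun x y y' => by simp [mul_add, Finsupp.sum_add])
    (fun c x y => by
      simp only [map_smul, smul_eq_mul, RingHom.id_apply, Finsupp.mul_sum]
      refine Finsupp.sum_congr fun j _ => ?_
      ring)

theorem kernelForm_apply_of_subset (Φ : J → J → S →ₗ[ℂ] ℂ) (s : S) {F : Finset J}
    {x y : J →₀ ℂ} (hx : x.support ⊆ F) (hy : y.support ⊆ F) :
    kernelForm Φ s x y = ∑ j ∈ F, ∑ j' ∈ F, conj (x j) * y j' * Φ j j' s := by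
  change (x.sum fun j a => conj a * Finsupp.linearCombination ℂ (fun j' => Φ j j' s) y) = _
  rw [Finsupp.sum_of_support_subset _ hx _ (by simp)]
  refine Finset.sum_congr rfl fun j _ => ?_
  rw [Finsupp.linearCombination_apply, Finsupp.sum_of_support_subset _ hy _ (by simp),
    Finset.mul_sum]
  simp [mul_assoc]

theorem kernelForm_single (Φ : J → J → S →ₗ[ℂ] ℂ) (s : S) (j j' : J) :
    kernelForm Φ s (Finsupp.single j 1) (Finsupp.single j' 1) = Φ j j' s := by
  change ((Finsupp.single j 1).sum fun j a => conj a *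
    Finsupp.linearCombination ℂ (fun j' => Φ j j' s) _) = _
  simp

theorem kernelForm_add (Φ : J → J → S →ₗ[ℂ] ℂ) (s t : S) (x y : J →₀ ℂ) :
    kernelForm Φ (s + t) x y = kernelForm Φ s x y + kernelForm Φ t x y := by
  classical
  have hx := Finset.subset_union_left (s₁ := x.support) (s₂ := y.support)
  have hy := Finset.subset_union_right (s₁ := x.support) (s₂ := y.support)
  simp only [kernelForm_apply_of_subset Φ _ hx hy, map_add, mul_add, Finset.sum_add_distrib]

theorem kernelForm_smul (Φ : J → J → S →ₗ[ℂ] ℂ) (c : ℂ) (s : S) (x y : J →₀ ℂ) :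
    kernelForm Φ (c • s) x y = c * kernelForm Φ s x y := by
  classical
  have hx := Finset.subset_union_left (s₁ := x.support) (s₂ := y.support)
  have hy := Finset.subset_union_right (s₁ := x.support) (s₂ := y.support)
  simp only [kernelForm_apply_of_subset Φ _ hx hy, map_smul, Finset.mul_sum, smul_eq_mul]
  refine Finset.sum_congr rfl fun j _ => Finset.sum_congr rfl fun j' _ => ?_
  ring

end KernelForm

section Kernels

variable {S : Type u} [AddCommGroup S] [Module ℂ S] [StarAddMonoid S]
  [StarModule ℂ S] [One S] [OperatorSystem S] {J : Type*}

/-- A completely positive kernel on an operator system, indexed by a set `J`. -/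
def IsCPKernel (Φ : J → J → S →ₗ[ℂ] ℂ) : Prop :=
  ∀ (n : ℕ) (j : Fin n → J) (M : Matrix (Fin n) (Fin n) S), M ∈ OperatorSystem.matCone n →
    0 ≤ ∑ k, ∑ l, Φ (j k) (j l) (M k l)

/-- The coefficients of the vectors x k, over a finite set containing their supports, form a scalar
matrix. Compressing M by it reduces the claim to the defining inequality at basis vectors. -/
theorem IsCPKernel.kernelForm_nonneg {Φ : J → J → S →ₗ[ℂ] ℂ} (hΦ : IsCPKernel Φ) {n : ℕ}
    (x : Fin n → J →₀ ℂ) {M : Matrix (Fin n) (Fin n) S} (hM : M ∈ OperatorSystem.matCone n) :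
    0 ≤ ∑ k, ∑ l, kernelForm Φ (M k l) (x k) (x l) := by
  classical
  let F : Finset J := Finset.univ.biUnion fun k => (x k).support
  have hF : ∀ k, (x k).support ⊆ F := fun k =>
    Finset.subset_biUnion_of_mem (fun k => (x k).support) (Finset.mem_univ k)
  let ε := F.equivFin.symm
  have h := hΦ F.card (fun i => (ε i : J)) _ (OperatorSystem.compress_mem
    (Matrix.of fun k i => x k (ε i)) hM)
  convert h using 1
  have hsum : ∀ f : J → ℂ, ∑ j ∈ F, f j = ∑ i, f (ε i) := fun f => by
    rw [← Finset.sum_coe_sort F f]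
    exact (Equiv.sum_comp ε fun j : F => f j).symm
  simp only [kernelForm_apply_of_subset Φ _ (hF _) (hF _), hsum, matCompress, Matrix.of_apply,
    map_sum, map_smul, smul_eq_mul]
  calc ∑ k, ∑ l, ∑ i, ∑ i', conj (x k (ε i)) * x l (ε i') * Φ (ε i) (ε i') (M k l)
      = ∑ k, ∑ i, ∑ l, ∑ i', conj (x k (ε i)) * x l (ε i') * Φ (ε i) (ε i') (M k l) :=
        Finset.sum_congr rfl fun k _ => Finset.sum_comm
    _ = ∑ i, ∑ k, ∑ l, ∑ i', conj (x k (ε i)) * x l (ε i') * Φ (ε i) (ε i') (M k l) :=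
        Finset.sum_comm
    _ = ∑ i, ∑ k, ∑ i', ∑ l, conj (x k (ε i)) * x l (ε i') * Φ (ε i) (ε i') (M k l) :=
        Finset.sum_congr rfl fun i _ => Finset.sum_congr rfl fun k _ => Finset.sum_comm
    _ = ∑ i, ∑ i', ∑ k, ∑ l, conj (x k (ε i)) * x l (ε i') * Φ (ε i) (ε i') (M k l) :=
        Finset.sum_congr rfl fun i _ => Finset.sum_comm
    _ = _ := rfl

theorem IsCPKernel.kernelForm_one_nonneg {Φ : J → J → S →ₗ[ℂ] ℂ} (hΦ : IsCPKernel Φ)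
    (x : J →₀ ℂ) : 0 ≤ kernelForm Φ 1 x x := by
  have := hΦ.kernelForm_nonneg (fun _ : Fin 1 => x) (OperatorSystem.unitMat_mem (S := S) 1)
  simpa [unitMat] using this

/-- Positivity of [[r, s], [s*, r]] evaluated at (x, y). Both the symmetry and the boundedness of
the forms come from this inequality. -/
theorem IsCPKernel.two_by_two_nonneg {Φ : J → J → S →ₗ[ℂ] ℂ} (hΦ : IsCPKernel Φ) (s : S)
    (x y : J →₀ ℂ) :
    0 ≤ OperatorSystem.bound s * kernelForm Φ 1 x x + kernelForm Φ s x y +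
      (kernelForm Φ (star s) y x + OperatorSystem.bound s * kernelForm Φ 1 y y) := by
  have := hΦ.kernelForm_nonneg ![x, y] (OperatorSystem.bound_mem s)
  simpa [Fin.sum_univ_two, kernelForm_smul, -Complex.coe_smul] using this

/-- The expression in `IsCPKernel.two_by_two_nonneg` is real. For (x, y) this compares imaginary
parts, for (x, iy) real parts. -/
theorem IsCPKernel.kernelForm_star {Φ : J → J → S →ₗ[ℂ] ℂ} (hΦ : IsCPKernel Φ) (s : S)
    (x y : J →₀ ℂ) : kernelForm Φ (star s) y x = conj (kernelForm Φ s x y) := by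
  have him : ∀ x, (kernelForm Φ 1 x x).im = 0 := fun x =>
    (Complex.nonneg_iff.1 (hΦ.kernelForm_one_nonneg x)).2.symm
  have h1 := (Complex.nonneg_iff.1 (hΦ.two_by_two_nonneg s x y)).2
  have h2 := (Complex.nonneg_iff.1 (hΦ.two_by_two_nonneg s x (Complex.I • y))).2
  simp only [Complex.add_im, Complex.im_ofReal_mul, him] at h1 h2
  simp only [map_smulₛₗ, LinearMap.smul_apply, smul_eq_mul, Complex.conj_I, RingHom.id_apply] at h2
  simp at h2
  apply Complex.ext
  · rw [Complex.conj_re]; linarith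
  · rw [Complex.conj_im]; linarith

theorem exists_conj_mul_self_eq_one_mul_eq_norm (z : ℂ) :
    ∃ c : ℂ, conj c * c = 1 ∧ c * z = ‖z‖ := by
  rcases eq_or_ne z 0 with h0 | h0
  · exact ⟨1, by simp, by simp [h0]⟩
  · have hn : (‖z‖ : ℂ) ≠ 0 := by simpa using h0
    refine ⟨conj z / ‖z‖, ?_, ?_⟩
    · rw [map_div₀, Complex.conj_conj, Complex.conj_ofReal, div_mul_div_comm, Complex.mul_conj']
      field_simp
    · rw [div_mul_eq_mul_div, Complex.conj_mul']
      field_simp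

/-- The Cauchy–Schwarz argument: evaluate the two-by-two inequality at (tx, cy), with the phase c
turning the mixed term into 2t‖z‖. The resulting quadratic polynomial in t is nonnegative, so its
discriminant is not positive. -/
theorem IsCPKernel.norm_kernelForm_sq_le {Φ : J → J → S →ₗ[ℂ] ℂ} (hΦ : IsCPKernel Φ) (s : S)
    (x y : J →₀ ℂ) : ‖kernelForm Φ s x y‖ ^ 2 ≤ OperatorSystem.bound s ^ 2 *
      (kernelForm Φ 1 x x).re * (kernelForm Φ 1 y y).re := by
  set r := OperatorSystem.bound s
  set z := kernelForm Φ s x y with hz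
  have key : ∀ t : ℝ, 0 ≤ (r * (kernelForm Φ 1 x x).re) * (t * t) + (2 * ‖z‖) * t +
      r * (kernelForm Φ 1 y y).re := by
    intro t
    obtain ⟨c, hc, hcz⟩ := exists_conj_mul_self_eq_one_mul_eq_norm z
    have h3 := (Complex.nonneg_iff.1 (hΦ.two_by_two_nonneg s ((t : ℂ) • x) (c • y))).1
    rw [hΦ.kernelForm_star] at h3
    simp only [map_smulₛₗ, LinearMap.smul_apply, smul_eq_mul, RingHom.id_apply] at h3
    rw [← hz] at h3
    have e1 : c * (conj (t : ℂ) * z) = (t * ‖z‖ : ℝ) := by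
      rw [Complex.conj_ofReal, mul_left_comm, hcz]; simp
    have e2 : c * (conj c * kernelForm Φ 1 y y) = kernelForm Φ 1 y y := by
      rw [← mul_assoc, mul_comm c, hc, one_mul]
    rw [e1, e2, Complex.conj_ofReal, Complex.conj_ofReal] at h3
    simp only [Complex.add_re, Complex.re_ofReal_mul, Complex.ofReal_re] at h3
    linarith
  have := discrim_le_zero key
  rw [discrim] at this
  nlinarith

end Kernels

/-! ### Unital completely positive maps and the GNS construction -/

section UCP

variable {S : Type u} [AddCommGroup S] [Module ℂ S] [StarAddMonoid S]
  [StarModule ℂ S] [One S] [OperatorSystem S] {J : Type u}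
  {H : Type u} [NormedAddCommGroup H] [InnerProductSpace ℂ H]

/-- A unital completely positive map from an operator system to `B(H)`. -/
structure IsUCP (φ : S →ₗ[ℂ] (H →L[ℂ] H)) : Prop where
  map_one : φ 1 = 1
  nonneg : ∀ (n : ℕ) (M : Matrix (Fin n) (Fin n) S), M ∈ OperatorSystem.matCone n →
    ∀ ξ : Fin n → H, 0 ≤ ∑ k, ∑ l, inner ℂ (ξ k) (φ (M k l) (ξ l))

/-- The kernel `s ↦ ⟪e i, φ s (e j)⟫`. -/
noncomputable def vectorKernel (φ : S →ₗ[ℂ] (H →L[ℂ] H)) (e : J → H) (i j : J) : S →ₗ[ℂ] ℂ where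
  toFun s := inner ℂ (e i) (φ s (e j))
  map_add' s t := by simp
  map_smul' c s := by simp

theorem IsUCP.isCPKernel {φ : S →ₗ[ℂ] (H →L[ℂ] H)} (hφ : IsUCP φ) (e : J → H) :
    IsCPKernel (vectorKernel φ e) :=
  fun n j M hM => hφ.nonneg n M hM fun k => e (j k)

theorem IsUCP.inner_map_star {φ : S →ₗ[ℂ] (H →L[ℂ] H)} (hφ : IsUCP φ) (s : S) (x y : H) :
    inner ℂ x (φ (star s) y) = inner ℂ (φ s x) y := by
  have := (hφ.isCPKernel (id : H → H)).kernelForm_star s (Finsupp.single y 1) (Finsupp.single x 1)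
  rw [kernelForm_single, kernelForm_single] at this
  rw [← inner_conj_symm (φ s x) y]
  exact this

theorem IsUCP.map_star [CompleteSpace H] {φ : S →ₗ[ℂ] (H →L[ℂ] H)} (hφ : IsUCP φ) (s : S) :
    φ (star s) = star (φ s) := by
  rw [ContinuousLinearMap.star_eq_adjoint, ContinuousLinearMap.eq_adjoint_iff]
  intro x y
  rw [← hφ.inner_map_star, star_star]

/-- Cauchy–Schwarz at the vectors φ s x and x, after cancelling ‖φ s x‖. The bound depends on s
alone, neither on φ nor on H; this uniformity later makes sets of moments compact. -/
theorem IsUCP.norm_apply_le {φ : S →ₗ[ℂ] (H →L[ℂ] H)} (hφ : IsUCP φ) (s : S) (x : H) :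
    ‖φ s x‖ ≤ OperatorSystem.bound s * ‖x‖ := by
  have h := (hφ.isCPKernel (id : H → H)).norm_kernelForm_sq_le s
    (Finsupp.single (φ s x) 1) (Finsupp.single x 1)
  have hself : ∀ y : H, (vectorKernel φ id y y 1).re = ‖y‖ ^ 2 := fun y => by
    simp only [vectorKernel, LinearMap.coe_mk, AddHom.coe_mk, id, hφ.map_one]
    exact (norm_sq_eq_re_inner (𝕜 := ℂ) y).symm
  have hs : ‖vectorKernel φ id (φ s x) x s‖ = ‖φ s x‖ ^ 2 := by
    simp [vectorKernel, inner_self_eq_norm_sq_to_K]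
  rw [kernelForm_single, kernelForm_single, kernelForm_single, hself, hself, hs, ← mul_pow,
    ← mul_pow] at h
  have hb := OperatorSystem.bound_pos s
  have h2 := le_of_sq_le_sq h (by positivity)
  rcases eq_or_ne (φ s x) 0 with h0 | h0
  · rw [h0, norm_zero]; positivity
  · have hpos : 0 < ‖φ s x‖ := norm_pos_iff.2 h0
    refine le_of_mul_le_mul_right ?_ hpos
    linarith

/-- The GNS construction for completely positive kernels. -/
theorem IsCPKernel.exists_isUCP {Φ : J → J → S →ₗ[ℂ] ℂ} (hΦ : IsCPKernel Φ) :
    ∃ (H : Type u) (_ : NormedAddCommGroup H) (_ : InnerProductSpace ℂ H) (_ : CompleteSpace H)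
      (e : J → H) (φ : S →ₗ[ℂ] (H →L[ℂ] H)), Dense (Submodule.span ℂ (Set.range e) : Set H) ∧
      IsUCP φ ∧ ∀ j j' s, inner ℂ (e j) (φ s (e j')) = Φ j j' s := by
  -- The pre-inner product is the form at the unit of S; the form at s is bounded relative to it and
  -- so becomes the operator φ s.
  obtain ⟨H, _, _, _, e, he, hinner⟩ := exists_hilbert_of_core (D := J →₀ ℂ)
    { inner := fun x y => kernelForm Φ 1 x y
      conj_inner_symm := fun x y => by
        rw [← hΦ.kernelForm_star, OperatorSystem.star_one]
      re_inner_nonneg := fun x => (Complex.nonneg_iff.1 (hΦ.kernelForm_one_nonneg x)).1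
      add_left := fun x y z => by simp
      smul_left := fun x y r => by simp }
  change ∀ x y, inner ℂ (e x) (e y) = kernelForm Φ 1 x y at hinner
  have hnorm : ∀ x, (kernelForm Φ 1 x x).re = ‖e x‖ ^ 2 := fun x => by
    rw [← hinner, inner_self_eq_norm_sq_to_K]
    norm_cast
  have hop : ∀ s, ∃ A : H →L[ℂ] H, ∀ x y, inner ℂ (e x) (A (e y)) = kernelForm Φ s x y := by
    intro s
    refine exists_operator_of_form he (kernelForm Φ s) (r := OperatorSystem.bound s) fun x y => ?_
    have := hΦ.norm_kernelForm_sq_le s x y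
    rw [hnorm, hnorm, ← mul_pow, ← mul_pow] at this
    have hb := OperatorSystem.bound_pos s
    exact le_of_sq_le_sq this (by positivity)
  choose A hA using hop
  have hext : ∀ B C : H →L[ℂ] H, (∀ x y, inner ℂ (e x) (B (e y)) = inner ℂ (e x) (C (e y))) →
      B = C := fun B C h => ContinuousLinearMap.ext fun z =>
    he.induction_on (p := fun z => B z = C z) z (isClosed_eq (by fun_prop) (by fun_prop))
      fun y => he.ext_inner fun x => h x y
  let φ : S →ₗ[ℂ] (H →L[ℂ] H) :=
    { toFun := A
      map_add' := fun s t => hext _ _ fun x y => by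
        simp [hA, kernelForm_add]
      map_smul' := fun c s => hext _ _ fun x y => by
        simp [hA, kernelForm_smul] }
  refine ⟨H, inferInstance, inferInstance, inferInstance, fun j => e (Finsupp.single j 1), φ,
    ?_, ⟨?_, fun n M hM => ?_⟩, fun j j' s => ?_⟩
  · refine he.mono ?_
    rintro _ ⟨x, rfl⟩
    induction x using Finsupp.induction_linear with
    | zero => simp
    | add f g hf hg => rw [map_add]; exact Submodule.add_mem _ hf hg
    | single j c =>
      rw [← mul_one c, ← smul_eq_mul, ← Finsupp.smul_single, map_smul]
      exact Submodule.smul_mem _ _ (Submodule.subset_span ⟨j, rfl⟩)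
  · exact hext _ _ fun x y => by simp [φ, hA, hinner]
  -- Complete positivity is a closed condition on tuples of vectors, so tuples from the dense range
  -- suffice.
  · have hd : DenseRange (Pi.map fun _ : Fin n => (e : (J →₀ ℂ) → H)) :=
      DenseRange.piMap fun _ => he
    intro ξ
    refine hd.induction_on (p := fun ξ : Fin n → H =>
      0 ≤ ∑ k, ∑ l, inner ℂ (ξ k) (φ (M k l) (ξ l))) ξ ?_ fun x => ?_
    · exact isClosed_le (by fun_prop) (by fun_prop)
    · simp only [Pi.map_apply, φ, LinearMap.coe_mk, AddHom.coe_mk, hA]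
      exact hΦ.kernelForm_nonneg x hM
  · simp [φ, hA, kernelForm_single]

end UCP

/-! ### Extension of positive functionals -/

section PositiveExtension

/-- Extension of positive functionals on a complex vector space with conjugation `σ`, relative
to a cone `P`, from a subspace which contains enough positive elements. -/
theorem exists_positive_extension {V W : Type*} [AddCommGroup V] [Module ℂ V]
    [AddCommGroup W] [Module ℂ W] (σ : V →ₗ⋆[ℂ] V) (P : Set V) (hP0 : (0 : V) ∈ P)
    (hPadd : ∀ {v w}, v ∈ P → w ∈ P → v + w ∈ P)
    (hPsmul : ∀ {v} {r : ℝ}, 0 ≤ r → v ∈ P → (r : ℂ) • v ∈ P)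
    (T : W →ₗ[ℂ] V) (hT : Function.Injective T) (f : W →ₗ[ℂ] ℂ)
    (hf : ∀ w, T w + σ (T w) ∈ P → 0 ≤ (f w).re)
    (hd : ∀ v, ∃ w, T w + σ (T w) + (v + σ v) ∈ P) :
    ∃ g : V →ₗ[ℂ] ℂ, (∀ w, g (T w) = f w) ∧ ∀ v ∈ P, σ v = v → 0 ≤ g v := by
  have hσ : ∀ (r : ℝ) v, σ (r • v) = r • σ v := fun r v => by
    rw [← Complex.coe_smul, map_smulₛₗ, Complex.conj_ofReal, Complex.coe_smul]
  -- Testing positivity on v + σ v lets the real Riesz extension theorem run on all of V instead of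
  -- its selfadjoint part.
  let s : PointedCone ℝ V :=
    { carrier := {v | v + σ v ∈ P}
      zero_mem' := by simpa using hP0
      add_mem' := fun {a b} ha hb => by
        change a + b + σ (a + b) ∈ P
        rw [map_add, add_add_add_comm]
        exact hPadd ha hb
      smul_mem' := fun c v hv => by
        change (c : ℝ) • v + σ ((c : ℝ) • v) ∈ P
        rw [hσ, ← smul_add, ← Complex.coe_smul]
        exact hPsmul c.2 hv }
  have hs : ∀ v, v ∈ s ↔ v + σ v ∈ P := fun v => Iff.rfl
  let eT := LinearEquiv.ofInjective T hT
  let F : V →ₗ.[ℝ] ℝ :=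
    { domain := (LinearMap.range T).restrictScalars ℝ
      toFun := Complex.reLm.comp ((f.comp eT.symm.toLinearMap).restrictScalars ℝ) }
  have hF : ∀ (x : F.domain) (w : W), T w = x → F x = (f w).re := fun x w h => by
    have : eT.symm ⟨x, x.2⟩ = w := by
      rw [LinearEquiv.symm_apply_eq]
      exact Subtype.ext h.symm
    change (f (eT.symm ⟨x, x.2⟩)).re = _
    rw [this]
  obtain ⟨g, hgF, hgs⟩ := riesz_extension s F (fun x hx => by
      obtain ⟨w, hw⟩ := x.2
      rw [hF x w hw]
      apply hf
      rw [hw]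
      exact hx) (fun y => by
      obtain ⟨w, hw⟩ := hd y
      refine ⟨⟨T w, w, rfl⟩, ?_⟩
      change T w + y + σ (T w + y) ∈ P
      rwa [map_add, add_add_add_comm])
  refine ⟨Module.Dual.extendRCLike (𝕜 := ℂ) g, fun w => ?_, fun v hv hσv => ?_⟩
  · have h1 : ∀ w, g (T w) = (f w).re := fun w => by
      have := hgF ⟨T w, w, rfl⟩
      rw [hF _ w rfl] at this
      exact this
    rw [Module.Dual.extendRCLike_apply, h1]
    change ((f w).re : ℂ) - Complex.I * ((g (Complex.I • T w) : ℝ) : ℂ) = f w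
    rw [← map_smul, h1, map_smul]
    apply Complex.ext <;> simp
  · have h1 : 0 ≤ g v := hgs v ((hs v).2 (by rw [hσv]; exact hPadd hv hv))
    -- An imaginary multiple of a selfadjoint v has symmetrization 0 and so lies in s. Using both
    -- signs, g vanishes at iv, which makes the complexified functional real at v.
    have h2 : ∀ c : ℂ, conj c = -c → 0 ≤ g (c • v) := fun c hc =>
      hgs _ ((hs _).2 (by rw [map_smulₛₗ, hσv, hc, neg_smul, add_neg_cancel]; exact hP0))
    have h3 : g (Complex.I • v) = 0 := by
      have a := h2 Complex.I (by simp)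
      have b := h2 (-Complex.I) (by simp)
      rw [neg_smul, map_neg] at b
      linarith
    rw [Module.Dual.extendRCLike_apply]
    change 0 ≤ ((g v : ℝ) : ℂ) - Complex.I * ((g (Complex.I • v) : ℝ) : ℂ)
    rw [h3]
    simpa using h1

end PositiveExtension

section CStarOperatorSystem

/-- A unital C*-algebra is an operator system. -/
instance CStarAlgebra.instOperatorSystem (C : Type u) [CStarAlgebra C] : OperatorSystem C where
  matCone _ := {M | MatPos M}
  star_one := star_one C
  isHermitian_of_mem := MatPos.isHermitian
  add_mem := MatPos.add
  compress_mem := MatPos.compress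
  proper := MatPos.proper
  order_unit := MatPos.order_unit
  archimedean := MatPos.archimedean

end CStarOperatorSystem

/-! ### Arveson extension for completely positive kernels -/

section KernelExtension

variable {I : Type u} {C : Type u} [CStarAlgebra C]

/-- The adjoint of a finitely supported matrix over a C*-algebra. -/
noncomputable def finsuppAdjoint : (I × I →₀ C) →ₗ⋆[ℂ] (I × I →₀ C) where
  toFun M := (M.mapRange star (star_zero C)).equivMapDomain (Equiv.prodComm I I)
  map_add' M N := by ext; simp
  map_smul' c M := by ext; simp

theorem finsuppAdjoint_apply (M : I × I →₀ C) (i j : I) :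
    finsuppAdjoint M (i, j) = star (M (j, i)) := rfl

theorem finsuppAdjoint_single (i j : I) (c : C) :
    finsuppAdjoint (Finsupp.single (i, j) c) = Finsupp.single (j, i) (star c) := by
  classical
  ext ⟨p, q⟩
  rw [finsuppAdjoint_apply, Finsupp.single_apply, Finsupp.single_apply]
  by_cases h1 : j = p <;> by_cases h2 : i = q <;> simp [h1, h2]

/-- Finitely supported matrices all of whose finite submatrices are positive. -/
def finsuppCone (I C : Type u) [CStarAlgebra C] : Set (I × I →₀ C) :=
  {M | ∀ (n : ℕ) (j : Fin n → I), MatPos (Matrix.of fun k l => M (j k, j l))}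

theorem zero_mem_finsuppCone : (0 : I × I →₀ C) ∈ finsuppCone I C :=
  fun _ _ => ⟨0, by ext; simp⟩

theorem add_mem_finsuppCone {v w : I × I →₀ C} (hv : v ∈ finsuppCone I C)
    (hw : w ∈ finsuppCone I C) : v + w ∈ finsuppCone I C := fun n j => by
  convert (hv n j).add (hw n j) using 1
  ext; simp

theorem smul_mem_finsuppCone {v : I × I →₀ C} {r : ℝ} (hr : 0 ≤ r) (hv : v ∈ finsuppCone I C) :
    (r : ℂ) • v ∈ finsuppCone I C := fun n j => by
  have h : MatPos ((r : ℂ) • Matrix.of fun k l => v (j k, j l)) :=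
    OperatorSystem.smul_mem (S := C) (hv n j) hr
  convert h using 1
  ext; simp

/-- Every submatrix of the sum is the compression of N by the 0-1 matrix recording the coincidences
i k = j a. This also covers repeated indices. -/
theorem sum_single_mem_finsuppCone {m : ℕ} (i : Fin m → I) {N : Matrix (Fin m) (Fin m) C}
    (hN : MatPos N) : ∑ k, ∑ l, Finsupp.single (i k, i l) (N k l) ∈ finsuppCone I C := by
  classical
  intro n j
  convert MatPos.compress (Matrix.of fun k a => if i k = j a then (1 : ℂ) else 0) hN using 1
  ext a b
  simp only [Matrix.of_apply, Finsupp.finsetSum_apply, matCompress]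
  refine Finset.sum_congr rfl fun k _ => Finset.sum_congr rfl fun l _ => ?_
  rw [Finsupp.single_apply]
  by_cases h1 : i k = j a <;> by_cases h2 : i l = j b <;> simp [h1, h2]

theorem exists_finset_forall_notMem {V : Type*} [AddCommMonoid V] (w : I × I →₀ V) :
    ∃ F : Finset I, ∀ i j, i ∉ F ∨ j ∉ F → w (i, j) = 0 := by
  classical
  refine ⟨w.support.image Prod.fst ∪ w.support.image Prod.snd, fun i j h => ?_⟩
  by_contra hne
  have hmem : (i, j) ∈ w.support := Finsupp.mem_support_iff.2 hne
  rcases h with h | h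
  · exact h (Finset.mem_union_left _ (Finset.mem_image.2 ⟨_, hmem, rfl⟩))
  · exact h (Finset.mem_union_right _ (Finset.mem_image.2 ⟨_, hmem, rfl⟩))

theorem eq_sum_single_of_forall_notMem {V : Type*} [AddCommMonoid V] {F : Finset I}
    {z : I × I →₀ V} (hz : ∀ i j, i ∉ F ∨ j ∉ F → z (i, j) = 0) :
    z = ∑ k : Fin F.card, ∑ l : Fin F.card, Finsupp.single
      ((F.equivFin.symm k : I), (F.equivFin.symm l : I))
      (z (F.equivFin.symm k, F.equivFin.symm l)) := by
  classical
  have hsum : ∀ f : I → I × I →₀ V, ∑ j ∈ F, f j = ∑ i, f (F.equivFin.symm i) := fun f => by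
    rw [← Finset.sum_coe_sort F f]
    exact (Equiv.sum_comp F.equivFin.symm fun j : F => f j).symm
  have hsub : z.support ⊆ F ×ˢ F := by
    rintro ⟨i, j⟩ h
    rw [Finsupp.mem_support_iff] at h
    rw [Finset.mem_product]
    by_contra hc
    rw [not_and_or] at hc
    exact h (hz i j hc)
  calc z = ∑ p ∈ F ×ˢ F, Finsupp.single p (z p) := by
        conv_lhs => rw [← Finsupp.sum_single z]
        exact Finsupp.sum_of_support_subset _ hsub _ (by simp)
    _ = ∑ i ∈ F, ∑ j ∈ F, Finsupp.single (i, j) (z (i, j)) := Finset.sum_product _ _ _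
    _ = _ := by
      rw [hsum fun i => ∑ j ∈ F, Finsupp.single (i, j) (z (i, j))]
      exact Finset.sum_congr rfl fun k _ => hsum fun j => Finsupp.single (_, j) (z (_, j))

/-- The hermitian element v + v* lives on a finite block, where a multiple of the order unit
dominates it. This supplies the domination condition of the extension theorem. -/
theorem exists_sum_single_add_mem_finsuppCone (v : I × I →₀ C) :
    ∃ (m : ℕ) (i : Fin m → I) (r : ℝ), (∑ k, Finsupp.single (i k, i k) ((r : ℂ) • (1 : C))) +
      (v + finsuppAdjoint v) ∈ finsuppCone I C := by
  obtain ⟨F, hF⟩ := exists_finset_forall_notMem v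
  let z := v + finsuppAdjoint v
  have hz : ∀ i j, i ∉ F ∨ j ∉ F → z (i, j) = 0 := fun i j h => by
    simp [z, finsuppAdjoint_apply, hF i j h, hF j i h.symm]
  let ε : Fin F.card → I := fun k => F.equivFin.symm k
  let N : Matrix (Fin F.card) (Fin F.card) C := Matrix.of fun k l => z (ε k, ε l)
  obtain ⟨r, -, hr⟩ := MatPos.order_unit (M := N) (by
    ext k l
    simp [N, z, finsuppAdjoint_apply, add_comm])
  refine ⟨F.card, ε, r, ?_⟩
  change _ + z ∈ _
  convert sum_single_mem_finsuppCone ε hr using 1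
  rw [eq_sum_single_of_forall_notMem hz]
  simp only [Matrix.add_apply, Finsupp.single_add, Finset.sum_add_distrib]
  congr 1
  refine Finset.sum_congr rfl fun k _ => ?_
  rw [Finset.sum_eq_single k]
  · simp only [Matrix.smul_apply, unitMat, Matrix.diagonal_apply_eq]
  · intro l _ hl
    rw [Matrix.smul_apply, unitMat, Matrix.diagonal_apply_ne _ hl.symm, smul_zero,
      Finsupp.single_zero]
  · simp

/-- The functional on finitely supported matrices defined by a kernel. -/
noncomputable def kernelFunctional {V : Type*} [AddCommGroup V] [Module ℂ V]
    (Φ : I → I → V →ₗ[ℂ] ℂ) : (I × I →₀ V) →ₗ[ℂ] ℂ :=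
  Finsupp.lsum ℂ fun p => Φ p.1 p.2

theorem kernelFunctional_single {V : Type*} [AddCommGroup V] [Module ℂ V]
    (Φ : I → I → V →ₗ[ℂ] ℂ) (i j : I) (s : V) :
    kernelFunctional Φ (Finsupp.single (i, j) s) = Φ i j s := by
  simp [kernelFunctional]

variable {S : Type u} [AddCommGroup S] [Module ℂ S] [StarAddMonoid S]
  [StarModule ℂ S] [One S] [OperatorSystem S]

theorem IsCPKernel.map_star {Φ : I → I → S →ₗ[ℂ] ℂ} (hΦ : IsCPKernel Φ) (i j : I) (s : S) :
    Φ j i (star s) = conj (Φ i j s) := by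
  have := hΦ.kernelForm_star s (Finsupp.single i 1) (Finsupp.single j 1)
  rwa [kernelForm_single, kernelForm_single] at this

/-- If ρ s = 0, then s and -s both have positive image, and the cone of S is proper. -/
theorem IsCStarCover.injective {ρ : S →ₗ[ℂ] C} (hρ : IsCStarCover ρ) : Function.Injective ρ := by
  rw [injective_iff_map_eq_zero]
  intro s hs
  have key : ∀ t : S, ρ t = 0 → (Matrix.of fun _ _ : Fin 1 => t) ∈ OperatorSystem.matCone 1 := by
    intro t ht
    rw [← hρ.matPos_iff]
    exact ⟨0, by ext; simp [ht]⟩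
  have h := OperatorSystem.proper (key s hs) (by
    convert key (-s) (by simp [hs]) using 1
    ext; rfl)
  exact congrFun (congrFun h 0) 0

/-- A complete order embedding pulls positivity of w + w* back from C to S. There the kernel gives
twice the real part of the functional. -/
theorem IsCPKernel.re_kernelFunctional_nonneg {Φ : I → I → S →ₗ[ℂ] ℂ} (hΦ : IsCPKernel Φ)
    {ρ : S →ₗ[ℂ] C} (hρ : IsCStarCover ρ) {w : I × I →₀ S}
    (hw : Finsupp.mapRange.linearMap ρ w + finsuppAdjoint (Finsupp.mapRange.linearMap ρ w) ∈
      finsuppCone I C) : 0 ≤ (kernelFunctional Φ w).re := by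
  obtain ⟨F, hF⟩ := exists_finset_forall_notMem w
  let ε : Fin F.card → I := fun k => F.equivFin.symm k
  let M : Matrix (Fin F.card) (Fin F.card) S := Matrix.of fun k l => w (ε k, ε l)
  have hM : M + Mᴴ ∈ OperatorSystem.matCone F.card := by
    rw [← hρ.matPos_iff]
    convert hw _ ε using 1
    ext k l
    simp [M, finsuppAdjoint_apply, hρ.map_star]
  have hfw : kernelFunctional Φ w = ∑ k, ∑ l, Φ (ε k) (ε l) (M k l) := by
    conv_lhs => rw [eq_sum_single_of_forall_notMem hF]
    simp only [map_sum, kernelFunctional_single]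
    rfl
  have h1 := hΦ _ ε _ hM
  have h2 : ∑ k, ∑ l, Φ (ε k) (ε l) ((M + Mᴴ) k l) =
      kernelFunctional Φ w + conj (kernelFunctional Φ w) := by
    simp only [Matrix.add_apply, map_add, Finset.sum_add_distrib, Matrix.conjTranspose_apply,
      hΦ.map_star]
    rw [hfw, map_sum]
    congr 1
    rw [Finset.sum_comm]
    simp only [map_sum]
  rw [h2, Complex.add_conj] at h1
  have := (Complex.nonneg_iff.1 h1).1
  rw [Complex.ofReal_re] at this
  linarith

theorem IsCStarCover.exists_add_mem_finsuppCone {ρ : S →ₗ[ℂ] C} (hρ : IsCStarCover ρ)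
    (v : I × I →₀ C) : ∃ w : I × I →₀ S, Finsupp.mapRange.linearMap ρ w +
      finsuppAdjoint (Finsupp.mapRange.linearMap ρ w) + (v + finsuppAdjoint v) ∈
      finsuppCone I C := by
  obtain ⟨m, i, r, h⟩ := exists_sum_single_add_mem_finsuppCone v
  -- Half of r, because adding the adjoint doubles the diagonal.
  refine ⟨∑ k, Finsupp.single (i k, i k) (((r / 2 : ℝ) : ℂ) • (1 : S)), ?_⟩
  convert h using 2
  simp only [map_sum, ← Finset.sum_add_distrib]
  refine Finset.sum_congr rfl fun k _ => ?_
  rw [Finsupp.mapRange.linearMap_apply, Finsupp.mapRange_single, finsuppAdjoint_single,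
    ← Finsupp.single_add, map_smul, hρ.map_one, star_smul, star_one, Complex.star_def,
    Complex.conj_ofReal, ← add_smul, ← Complex.ofReal_add, add_halves]

theorem finsuppAdjoint_sum_single {n : ℕ} (i : Fin n → I) {N : Matrix (Fin n) (Fin n) C}
    (hN : N.IsHermitian) : finsuppAdjoint (∑ k, ∑ l, Finsupp.single (i k, i l) (N k l)) =
      ∑ k, ∑ l, Finsupp.single (i k, i l) (N k l) := by
  simp only [map_sum, finsuppAdjoint_single]
  rw [Finset.sum_comm]
  refine Finset.sum_congr rfl fun k _ => Finset.sum_congr rfl fun l _ => ?_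
  have hN' : star (N l k) = N k l := congrFun (congrFun hN k) l
  rw [hN']

/-- Completely positive kernels extend from an operator system to a C*-cover. -/
theorem IsCPKernel.exists_extension {Φ : I → I → S →ₗ[ℂ] ℂ} (hΦ : IsCPKernel Φ)
    {ρ : S →ₗ[ℂ] C} (hρ : IsCStarCover ρ) :
    ∃ Ψ : I → I → C →ₗ[ℂ] ℂ, IsCPKernel Ψ ∧ ∀ i j s, Ψ i j (ρ s) = Φ i j s := by
  have hinj : Function.Injective (Finsupp.mapRange.linearMap ρ : (I × I →₀ S) →ₗ[ℂ] (I × I →₀ C)) :=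
    Finsupp.mapRange_injective _ (map_zero ρ) hρ.injective
  -- A kernel indexed by I is a single functional on finitely supported I × I matrices. Positivity
  -- on the cone gives complete positivity of the extended kernel, so extending one functional
  -- suffices.
  have hcone := exists_positive_extension (W := I × I →₀ S) finsuppAdjoint (finsuppCone I C)
    zero_mem_finsuppCone add_mem_finsuppCone smul_mem_finsuppCone
  obtain ⟨g, hgT, hg⟩ := hcone _ hinj (kernelFunctional Φ)
    (fun w hw => hΦ.re_kernelFunctional_nonneg hρ hw) hρ.exists_add_mem_finsuppCone
  refine ⟨fun i j => g.comp (Finsupp.lsingle (i, j)), fun n i N hN => ?_, fun i j s => ?_⟩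
  · have h := hg _ (sum_single_mem_finsuppCone i hN)
      (finsuppAdjoint_sum_single i (MatPos.isHermitian hN))
    simp only [map_sum] at h
    exact h
  · rw [← kernelFunctional_single, ← hgT]
    simp

end KernelExtension

/-! ### Stinespring dilation to a C*-cover -/

section Stinespring

variable {S : Type u} [AddCommGroup S] [Module ℂ S] [StarAddMonoid S]
  [StarModule ℂ S] [One S] [OperatorSystem S] {C : Type u} [CStarAlgebra C]
  {H : Type u} [NormedAddCommGroup H] [InnerProductSpace ℂ H]

/-- If N = P*P, the new matrix is (P diag a)*(P diag a). This is what makes Stinespring's kernel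
completely positive. -/
theorem MatPos.conj_diagonal {n : ℕ} {N : Matrix (Fin n) (Fin n) C} (hN : MatPos N)
    (a : Fin n → C) : MatPos (Matrix.of fun k l => star (a k) * N k l * a l) := by
  obtain ⟨P, rfl⟩ := hN
  refine ⟨P * Matrix.diagonal a, ?_⟩
  ext k l
  rw [Matrix.conjTranspose_mul, Matrix.diagonal_conjTranspose, Matrix.mul_assoc,
    Matrix.diagonal_mul, ← Matrix.mul_assoc, Matrix.mul_diagonal, Matrix.of_apply, mul_assoc]
  rfl

/-- A map preserving inner products is a linear isometry. -/
noncomputable def LinearIsometry.ofInner {K : Type*} [NormedAddCommGroup K] [InnerProductSpace ℂ K]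
    (W : H → K) (hW : ∀ x y, inner ℂ (W x) (W y) = inner ℂ x y) : H →ₗᵢ[ℂ] K where
  toFun := W
  map_add' x y := by
    rw [← sub_eq_zero, ← inner_self_eq_zero (𝕜 := ℂ)]
    simp only [inner_sub_left, inner_sub_right, inner_add_left, inner_add_right, hW]
    ring
  map_smul' c x := by
    rw [← sub_eq_zero, ← inner_self_eq_zero (𝕜 := ℂ)]
    simp only [inner_sub_left, inner_sub_right, inner_smul_left, inner_smul_right, hW,
      RingHom.id_apply]
    ring
  norm_map' x := by
    have := congrArg Complex.re (hW x x)
    change RCLike.re (inner ℂ (W x) (W x)) = RCLike.re (inner ℂ x x) at this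
    rw [← norm_sq_eq_re_inner, ← norm_sq_eq_re_inner] at this
    exact (sq_eq_sq₀ (norm_nonneg _) (norm_nonneg _)).1 this

/-- Every unital completely positive map on an operator system dilates to a representation of
any given C*-cover. -/
theorem IsUCP.exists_starAlgHom_dilation {ρ : S →ₗ[ℂ] C} (hρ : IsCStarCover ρ)
    {φ : S →ₗ[ℂ] (H →L[ℂ] H)} (hφ : IsUCP φ) :
    ∃ (K : Type u) (_ : NormedAddCommGroup K) (_ : InnerProductSpace ℂ K) (_ : CompleteSpace K)
      (θ : C →⋆ₐ[ℂ] (K →L[ℂ] K)) (W : H →ₗᵢ[ℂ] K),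
      ∀ s x y, inner ℂ (W x) (θ (ρ s) (W y)) = inner ℂ x (φ s y) := by
  obtain ⟨Ψ, hΨ, hΨρ⟩ := (hφ.isCPKernel (id : H → H)).exists_extension hρ
  -- Stinespring's form ⟨b ⊗ x, c (d ⊗ y)⟩ = Ψ_{x,y}(b* c d), with pairs in place of elementary
  -- tensors.
  let Γ : C × H → C × H → C →ₗ[ℂ] ℂ := fun p q =>
    (Ψ p.2 q.2).comp ((LinearMap.mulLeft ℂ (star p.1)).comp (LinearMap.mulRight ℂ q.1))
  have hΓ : ∀ p q c, Γ p q c = Ψ p.2 q.2 (star p.1 * (c * q.1)) := fun p q c => rfl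
  have hΓcp : IsCPKernel Γ := fun n j M hM => by
    have := hΨ n (fun k => (j k).2) _ (MatPos.conj_diagonal hM fun k => (j k).1)
    simpa only [hΓ, Matrix.of_apply, mul_assoc] using this
  obtain ⟨K, _, _, _, e, θ, he, hθ, hin⟩ := hΓcp.exists_isUCP
  have hee : ∀ p q, inner ℂ (e p) (e q) = Ψ p.2 q.2 (star p.1 * q.1) := fun p q => by
    have := hin p q 1
    rwa [hθ.map_one, hΓ, one_mul] at this
  have hext : ∀ v w : K, (∀ p, inner ℂ (e p) v = inner ℂ (e p) w) → v = w := fun v w h => by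
    have : innerSL ℂ v = innerSL ℂ w := by
      refine ContinuousLinearMap.ext_on he ?_
      rintro _ ⟨p, rfl⟩
      rw [innerSL_apply_apply, innerSL_apply_apply, ← inner_conj_symm, h, inner_conj_symm]
    exact ext_inner_right ℂ fun z => congrArg (fun f => f z) this
  -- The operators act by left multiplication on the first factor, hence multiplicatively.
  have hθe : ∀ c b k, θ c (e (b, k)) = e (c * b, k) := fun c b k => hext _ _ fun p => by
    rw [hin, hee, hΓ]
  have hmul : ∀ c d, θ (c * d) = θ c * θ d := fun c d => by
    refine ContinuousLinearMap.ext_on he ?_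
    rintro _ ⟨⟨b, k⟩, rfl⟩
    change θ (c * d) (e (b, k)) = θ c (θ d (e (b, k)))
    rw [hθe, hθe, hθe, mul_assoc]
  let θ' : C →⋆ₐ[ℂ] (K →L[ℂ] K) :=
    { AlgHom.ofLinearMap θ hθ.map_one hmul with map_star' := hθ.map_star }
  have hW1 : ∀ s x y, Ψ x y (star 1 * (ρ s * 1)) = inner ℂ x (φ s y) := fun s x y => by
    rw [star_one, one_mul, mul_one, hΨρ]
    rfl
  -- The embedding x ↦ 1 ⊗ x preserves inner products since Ψ extends the kernel of the unital map
  -- φ.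
  let W : H →ₗᵢ[ℂ] K := LinearIsometry.ofInner (fun x => e (1, x)) fun x y => by
    have := hW1 1 x y
    rw [hφ.map_one, hρ.map_one, one_mul] at this
    rw [hee]
    exact this
  refine ⟨K, inferInstance, inferInstance, inferInstance, θ', W, fun s x y => ?_⟩
  change inner ℂ (e (1, x)) (θ (ρ s) (e (1, y))) = _
  rw [hin, hΓ, hW1]

end Stinespring

/-! ### Positivity of operator matrices, and its reflection by injective homomorphisms -/

section MatPosOperators

variable {H : Type u} [NormedAddCommGroup H] [InnerProductSpace ℂ H] [CompleteSpace H]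

theorem sum_inner_conjTranspose_mul_self {n : ℕ} (N : Matrix (Fin n) (Fin n) (H →L[ℂ] H))
    (ξ : Fin n → H) : ∑ k, ∑ l, inner ℂ (ξ k) ((Nᴴ * N) k l (ξ l)) =
      ∑ m, inner ℂ (∑ k, N m k (ξ k)) (∑ l, N m l (ξ l)) := by
  have key : ∀ k l, inner ℂ (ξ k) ((Nᴴ * N) k l (ξ l)) =
      ∑ m, inner ℂ (N m k (ξ k)) (N m l (ξ l)) := fun k l => by
    rw [Matrix.mul_apply, _root_.sum_apply, inner_sum]
    refine Finset.sum_congr rfl fun m _ => ?_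
    rw [Matrix.conjTranspose_apply, ContinuousLinearMap.star_eq_adjoint]
    change inner ℂ (ξ k) (ContinuousLinearMap.adjoint (N m k) (N m l (ξ l))) = _
    rw [ContinuousLinearMap.adjoint_inner_right]
  simp only [key, inner_sum, sum_inner]
  rw [Finset.sum_congr rfl fun k _ => Finset.sum_comm, Finset.sum_comm]
  exact Finset.sum_congr rfl fun m _ => Finset.sum_comm

end MatPosOperators

section NegativePart

/-- Take n = b⁻ = c*c and q = c b⁻; then nbn = -(b⁻)³ = -q*q, and q = 0 forces b⁻ = 0. This turns
positivity into an algebraic criterion that homomorphisms and quadratic forms can test. -/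
theorem IsSelfAdjoint.exists_negPart_mul {B : Type u} [CStarAlgebra B] {b : B}
    (hb : IsSelfAdjoint b) :
    ∃ n q : B, star n = n ∧ n * b * n = -(star q * q) ∧ (q = 0 → ∃ c, b = star c * c) := by
  let _ := CStarAlgebra.spectralOrder B
  let _ := CStarAlgebra.spectralOrderedRing B
  have hn : (0 : B) ≤ b⁻ := CFC.negPart_nonneg b
  obtain ⟨c, hc⟩ := (nonneg_iff_exists_star_mul_self b⁻).1 hn
  have hstar : star b⁻ = b⁻ := (IsSelfAdjoint.of_nonneg hn).star_eq
  refine ⟨b⁻, c * b⁻, hstar, ?_, fun hq => ?_⟩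
  · have h1 : b⁻ * b = -(b⁻ * b⁻) := by
      nth_rewrite 2 [← CFC.posPart_sub_negPart b hb]
      rw [mul_sub, CFC.negPart_mul_posPart, zero_sub]
    rw [h1, star_mul, hstar, mul_assoc, ← mul_assoc (star c), ← hc, neg_mul, mul_assoc]
  · have h3 : b⁻ * b⁻ = 0 := by
      nth_rewrite 1 [hc]
      rw [mul_assoc, hq, mul_zero]
    have h0 : b⁻ = 0 := by
      rw [← CStarRing.star_mul_self_eq_zero_iff, hstar, h3]
    rw [← nonneg_iff_exists_star_mul_self, ← CFC.negPart_eq_zero_iff b hb, h0]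

variable {A : Type u} [CStarAlgebra A] {n : ℕ}

theorem Matrix.IsHermitian.exists_negPart_mul {M : Matrix (Fin n) (Fin n) A}
    (hM : M.IsHermitian) : ∃ N Q : Matrix (Fin n) (Fin n) A,
      Nᴴ = N ∧ N * M * N = -(Qᴴ * Q) ∧ (Q = 0 → MatPos M) := by
  let _ := CStarAlgebra.spectralOrder A
  let _ := CStarAlgebra.spectralOrderedRing A
  exact IsSelfAdjoint.exists_negPart_mul (B := CStarMatrix (Fin n) (Fin n) A)
    (b := CStarMatrix.ofMatrix M) hM

theorem Matrix.eq_zero_of_conjTranspose_mul_self_eq_zero {Q : Matrix (Fin n) (Fin n) A}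
    (h : Qᴴ * Q = 0) : Q = 0 := by
  let _ := CStarAlgebra.spectralOrder A
  let _ := CStarAlgebra.spectralOrderedRing A
  exact (CStarRing.star_mul_self_eq_zero_iff (CStarMatrix.ofMatrix Q)).1 h

/-- An injective `*`-homomorphism reflects positivity of matrices. -/
theorem MatPos.of_map {B : Type u} [CStarAlgebra B] (f : A →⋆ₐ[ℂ] B) (hf : Function.Injective f)
    {M : Matrix (Fin n) (Fin n) A} (hM : MatPos (M.map f)) : MatPos M := by
  have hstar : ∀ N : Matrix (Fin n) (Fin n) A, (Nᴴ).map f = (N.map f)ᴴ := fun N => by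
    ext; simp [map_star]
  have hmul : ∀ N P : Matrix (Fin n) (Fin n) A, (N * P).map f = N.map f * P.map f := fun N P => by
    ext; simp [Matrix.mul_apply]
  have hinj : ∀ {N P : Matrix (Fin n) (Fin n) A}, N.map f = P.map f → N = P := fun h => by
    ext i j
    exact hf (congrFun (congrFun h i) j)
  have hherm : M.IsHermitian := hinj (by rw [hstar]; exact hM.isHermitian)
  obtain ⟨N, Q, hN, hQ, h⟩ := hherm.exists_negPart_mul
  apply h
  -- This matrix is the image of N M N, which is positive since the image of M is and N is
  -- selfadjoint. Being positive with both signs, (Q.map f)ᴴ * Q.map f vanishes.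
  have h1 : MatPos (-((Q.map f)ᴴ * Q.map f)) := by
    obtain ⟨P, hP⟩ := hM
    refine ⟨P * N.map f, ?_⟩
    rw [Matrix.conjTranspose_mul, ← hstar N, hN, Matrix.mul_assoc, ← Matrix.mul_assoc Pᴴ, ← hP,
      ← Matrix.mul_assoc, ← hmul, ← hmul, hQ, ← hstar, ← hmul (Qᴴ)]
    ext
    rw [Matrix.neg_apply, Matrix.map_apply, Matrix.map_apply, Matrix.neg_apply, map_neg]
  have h2 := MatPos.proper ⟨Q.map f, rfl⟩ h1
  apply hinj
  rw [Matrix.eq_zero_of_conjTranspose_mul_self_eq_zero h2]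
  ext; simp

theorem MatPos.map {B : Type u} [CStarAlgebra B] (f : A →⋆ₐ[ℂ] B)
    {M : Matrix (Fin n) (Fin n) A} (hM : MatPos M) : MatPos (M.map f) := by
  obtain ⟨N, rfl⟩ := hM
  refine ⟨N.map f, ?_⟩
  ext
  simp [Matrix.mul_apply, map_star]

end NegativePart

section MatPosOperators

variable {H : Type u} [NormedAddCommGroup H] [InnerProductSpace ℂ H] [CompleteSpace H]

theorem MatPos.sum_inner_nonneg {n : ℕ} {M : Matrix (Fin n) (Fin n) (H →L[ℂ] H)} (hM : MatPos M)
    (ξ : Fin n → H) : 0 ≤ ∑ k, ∑ l, inner ℂ (ξ k) (M k l (ξ l)) := by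
  obtain ⟨N, rfl⟩ := hM
  rw [sum_inner_conjTranspose_mul_self]
  refine Finset.sum_nonneg fun m _ => ?_
  rw [inner_self_eq_norm_sq_to_K]
  positivity

theorem sum_inner_mul_mul {n : ℕ} {N : Matrix (Fin n) (Fin n) (H →L[ℂ] H)} (hN : Nᴴ = N)
    (M : Matrix (Fin n) (Fin n) (H →L[ℂ] H)) (ξ : Fin n → H) :
    ∑ k, ∑ l, inner ℂ (ξ k) ((N * M * N) k l (ξ l)) =
      ∑ k, ∑ l, inner ℂ (∑ i, N k i (ξ i)) (M k l (∑ j, N l j (ξ j))) := by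
  have hadj : ∀ k i (x y : H), inner ℂ x (N i k y) = inner ℂ (N k i x) y := fun k i x y => by
    conv_lhs => rw [← hN]
    rw [Matrix.conjTranspose_apply, ContinuousLinearMap.star_eq_adjoint,
      ContinuousLinearMap.adjoint_inner_right]
  have key : ∀ i j, inner ℂ (ξ i) ((N * M * N) i j (ξ j)) =
      ∑ l, ∑ k, inner ℂ (N k i (ξ i)) (M k l (N l j (ξ j))) := fun i j => by
    rw [Matrix.mul_apply, _root_.sum_apply, inner_sum]
    refine Finset.sum_congr rfl fun l _ => ?_
    rw [Matrix.mul_apply, Finset.sum_mul, _root_.sum_apply, inner_sum]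
    exact Finset.sum_congr rfl fun k _ => hadj k i _ _
  simp only [key, inner_sum, sum_inner, map_sum]
  calc _ = ∑ i, ∑ l, ∑ j, ∑ k, inner ℂ (N k i (ξ i)) (M k l (N l j (ξ j))) :=
        Finset.sum_congr rfl fun i _ => Finset.sum_comm
    _ = ∑ l, ∑ i, ∑ j, ∑ k, inner ℂ (N k i (ξ i)) (M k l (N l j (ξ j))) := Finset.sum_comm
    _ = ∑ l, ∑ i, ∑ k, ∑ j, inner ℂ (N k i (ξ i)) (M k l (N l j (ξ j))) :=
        Finset.sum_congr rfl fun l _ => Finset.sum_congr rfl fun i _ => Finset.sum_comm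
    _ = ∑ l, ∑ k, ∑ i, ∑ j, inner ℂ (N k i (ξ i)) (M k l (N l j (ξ j))) :=
        Finset.sum_congr rfl fun l _ => Finset.sum_comm
    _ = ∑ k, ∑ l, ∑ i, ∑ j, inner ℂ (N k i (ξ i)) (M k l (N l j (ξ j))) := Finset.sum_comm
    _ = _ := Finset.sum_congr rfl fun k _ => Finset.sum_congr rfl fun l _ => Finset.sum_comm

/-- A hermitian operator matrix with positive quadratic form is positive. -/
theorem matPos_of_sum_inner_nonneg {n : ℕ} {M : Matrix (Fin n) (Fin n) (H →L[ℂ] H)}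
    (hM : M.IsHermitian) (h : ∀ ξ : Fin n → H, 0 ≤ ∑ k, ∑ l, inner ℂ (ξ k) (M k l (ξ l))) :
    MatPos M := by
  obtain ⟨N, Q, hN, hQ, hpos⟩ := hM.exists_negPart_mul
  apply hpos
  -- At the vector Nξ the form of M equals -‖Qξ‖², so the hypothesis leaves only Qξ = 0.
  have h1 : ∀ (ξ : Fin n → H) m, ∑ l, Q m l (ξ l) = 0 := by
    intro ξ
    have h2 := h fun k => ∑ i, N k i (ξ i)
    rw [← sum_inner_mul_mul hN, hQ] at h2
    have h3 := sum_inner_conjTranspose_mul_self Q ξ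
    have h4 : ∑ m, inner ℂ (∑ k, Q m k (ξ k)) (∑ l, Q m l (ξ l)) ≤ 0 := by
      rw [← h3, ← neg_nonneg]
      simpa only [Matrix.neg_apply, _root_.neg_apply, inner_neg_right,
        Finset.sum_neg_distrib] using h2
    have hnn : ∀ m ∈ Finset.univ, 0 ≤ inner ℂ (∑ k, Q m k (ξ k)) (∑ l, Q m l (ξ l)) :=
      fun m _ => by
        rw [inner_self_eq_norm_sq_to_K]
        positivity
    have h5 := (Finset.sum_eq_zero_iff_of_nonneg hnn).1
      (le_antisymm h4 (Finset.sum_nonneg hnn))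
    exact fun m => inner_self_eq_zero.1 (h5 m (Finset.mem_univ m))
  ext m l x
  have := h1 (Pi.single l x) m
  rw [Finset.sum_eq_single l] at this
  · simpa using this
  · intro b _ hb
    simp [Pi.single_eq_of_ne hb]
  · simp

end MatPosOperators

/-! ### Ranges of *-homomorphisms are closed -/

section ClosedRange

variable {A B : Type u} [CStarAlgebra A] [CStarAlgebra B]

theorem StarAlgHom.continuous_of_cstar (f : A →⋆ₐ[ℂ] B) : Continuous f :=
  AddMonoidHomClass.continuous_of_bound f 1 fun a => by
    rw [one_mul]; exact NonUnitalStarAlgHom.norm_apply_le f a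

/-- Truncate a at height ‖f a‖ by functional calculus. The truncation is the identity on the
spectrum of f a, so the image is unchanged. -/
theorem StarAlgHom.exists_lift_norm_le_of_isSelfAdjoint (f : A →⋆ₐ[ℂ] B) {a : A}
    (ha : IsSelfAdjoint a) : ∃ a' : A, f a' = f a ∧ ‖a'‖ ≤ ‖f a‖ := by
  let t : ℝ → ℝ := fun x => max (-‖f a‖) (min x ‖f a‖)
  have ht : Continuous t := by fun_prop
  have hb : ∀ x, ‖t x‖ ≤ ‖f a‖ := fun x => by
    have := norm_nonneg (f a)
    rw [Real.norm_eq_abs, abs_le]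
    exact ⟨le_max_left _ _, max_le (by linarith) (min_le_right _ _)⟩
  refine ⟨cfc t a, ?_, norm_cfc_le (norm_nonneg _) fun x _ => hb x⟩
  rw [StarAlgHom.map_cfc f t a ht.continuousOn f.continuous_of_cstar ha (ha.map f)]
  conv_rhs => rw [← cfc_id ℝ (f a) (ha.map f)]
  refine cfc_congr fun x hx => ?_
  have hx' : |x| ≤ ‖f a‖ := by
    rcases subsingleton_or_nontrivial B with _ | _
    · simp [spectrum.of_subsingleton] at hx
    · exact spectrum.norm_le_norm_of_mem hx
  rw [abs_le] at hx'
  simp only [t, id]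
  rw [min_eq_left hx'.2, max_eq_right hx'.1]

/-- Real and imaginary parts are lifted separately, whence the factor 2. Any constant would do for
closedness of the range. -/
theorem StarAlgHom.exists_lift_norm_le (f : A →⋆ₐ[ℂ] B) (a : A) :
    ∃ a' : A, f a' = f a ∧ ‖a'‖ ≤ 2 * ‖f a‖ := by
  obtain ⟨x, hx, hx'⟩ := f.exists_lift_norm_le_of_isSelfAdjoint (realPart a).2
  obtain ⟨y, hy, hy'⟩ := f.exists_lift_norm_le_of_isSelfAdjoint (imaginaryPart a).2
  have h1 : ‖f (realPart a)‖ ≤ ‖f a‖ := by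
    have : f (realPart a) = realPart (f a) := by
      rw [realPart_apply_coe, realPart_apply_coe, ← map_star, ← map_add]
      exact (f : A →ₗ[ℂ] B).map_smul_of_tower (2⁻¹ : ℝ) _
    rw [this]
    exact realPart.norm_le (f a)
  have h2 : ‖f (imaginaryPart a)‖ ≤ ‖f a‖ := by
    have : f (imaginaryPart a) = imaginaryPart (f a) := by
      rw [imaginaryPart_apply_coe, imaginaryPart_apply_coe, ← map_star, ← map_sub, map_smul]
      congr 1
      exact (f : A →ₗ[ℂ] B).map_smul_of_tower (2⁻¹ : ℝ) _
    rw [this]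
    exact imaginaryPart.norm_le (f a)
  refine ⟨x + Complex.I • y, ?_, ?_⟩
  · conv_rhs => rw [← realPart_add_I_smul_imaginaryPart a]
    simp only [map_add, map_smul, hx, hy]
  · calc _ ≤ ‖x‖ + ‖Complex.I • y‖ := norm_add_le _ _
      _ ≤ _ := by
        rw [norm_smul, Complex.norm_I, one_mul]
        linarith

/-- The range of a `*`-homomorphism of C*-algebras is closed. -/
theorem StarAlgHom.isClosed_range (f : A →⋆ₐ[ℂ] B) : IsClosed (f.range : Set B) := by
  let g : NormedAddGroupHom A B :=
    { toFun := f
      map_add' := map_add f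
      bound' := ⟨1, fun a => by
        rw [one_mul]; exact NonUnitalStarAlgHom.norm_apply_le f a⟩ }
  let K : AddSubgroup B := g.range
  have h : g.SurjectiveOnWith K 2 := by
    rintro _ ⟨a, rfl⟩
    obtain ⟨a', h1, h2⟩ := f.exists_lift_norm_le a
    exact ⟨a', h1, h2⟩
  have h2 := controlled_closure_of_complete two_pos one_pos h
  have h3 : (f.range : Set B) = K.topologicalClosure := by
    refine Set.Subset.antisymm ?_ ?_
    · rintro _ ⟨a, rfl⟩
      exact K.le_topologicalClosure ⟨a, rfl⟩
    · intro b hb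
      obtain ⟨a, ha, -⟩ := h2 b hb
      exact ⟨a, ha⟩
  rw [h3]
  exact K.isClosed_topologicalClosure

end ClosedRange

/-! ### C*-covers, maximal maps and the criterion for the C*-envelope -/

section Covers

variable {S : Type u} [AddCommGroup S] [Module ℂ S] [StarAddMonoid S]
  [StarModule ℂ S] [One S] [OperatorSystem S] {C : Type u} [CStarAlgebra C]

/-- The induction principle for covers: a property that cuts out a closed *-subalgebra need only be
checked on S. -/
theorem IsCStarCover.mem_of_isClosed {ρ : S →ₗ[ℂ] C} (hρ : IsCStarCover ρ)
    (A : StarSubalgebra ℂ C) (hA : IsClosed (A : Set C)) (h : ∀ s, ρ s ∈ A) (c : C) : c ∈ A := by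
  have h1 : (StarAlgebra.adjoin ℂ (Set.range ρ)).topologicalClosure ≤ A :=
    StarSubalgebra.topologicalClosure_minimal
      (StarAlgebra.adjoin_le (by rintro _ ⟨s, rfl⟩; exact h s)) hA
  rw [hρ.generates] at h1
  exact h1 (by trivial)

theorem IsCStarCover.starAlgHom_ext {B : Type u} [CStarAlgebra B] {ρ : S →ₗ[ℂ] C}
    (hρ : IsCStarCover ρ) {f g : C →⋆ₐ[ℂ] B} (h : ∀ s, f (ρ s) = g (ρ s)) : f = g := by
  refine StarAlgHom.ext fun c => ?_
  exact hρ.mem_of_isClosed (StarAlgHom.equalizer f g)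
    (isClosed_eq f.continuous_of_cstar g.continuous_of_cstar) h c

theorem IsCStarCover.surjective {B : Type u} [CStarAlgebra B] {ρ : S →ₗ[ℂ] C}
    (hρ : IsCStarCover ρ) {f : B →⋆ₐ[ℂ] C} (h : ∀ s, ∃ b, f b = ρ s) : Function.Surjective f :=
  fun c => hρ.mem_of_isClosed f.range f.isClosed_range h c

end Covers

section Maximal

variable {S : Type u} [AddCommGroup S] [Module ℂ S] [StarAddMonoid S]
  [StarModule ℂ S] [One S] [OperatorSystem S]
  {H : Type u} [NormedAddCommGroup H] [InnerProductSpace ℂ H]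

/-- A unital completely positive map is maximal if all its dilations are trivial. -/
structure IsMaximalUCP (φ : S →ₗ[ℂ] (H →L[ℂ] H)) : Prop where
  isUCP : IsUCP φ
  trivial_dilation : ∀ (K : Type u) [NormedAddCommGroup K] [InnerProductSpace ℂ K]
    [CompleteSpace K] (η : S →ₗ[ℂ] (K →L[ℂ] K)) (W : H →ₗᵢ[ℂ] K), IsUCP η →
    (∀ s x y, inner ℂ (W x) (η s (W y)) = inner ℂ x (φ s y)) → ∀ s y, η s (W y) = W (φ s y)

variable {C : Type u} [CStarAlgebra C]

theorem IsCStarCover.isUCP_comp {ρ : S →ₗ[ℂ] C} (hρ : IsCStarCover ρ) [CompleteSpace H]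
    (θ : C →⋆ₐ[ℂ] (H →L[ℂ] H)) : IsUCP ((θ : C →ₗ[ℂ] (H →L[ℂ] H)).comp ρ) where
  map_one := by
    change θ (ρ 1) = 1
    rw [hρ.map_one, _root_.map_one]
  nonneg n M hM ξ := by
    have := (((hρ.matPos_iff n M).2 hM).map θ).sum_inner_nonneg ξ
    exact this

/-- A subspace which reduces a generating operator system reduces the whole representation. -/
theorem IsCStarCover.exists_starAlgHom_of_intertwining [CompleteSpace H] {K : Type u}
    [NormedAddCommGroup K] [InnerProductSpace ℂ K] [CompleteSpace K]
    {ρ : S →ₗ[ℂ] C} (hρ : IsCStarCover ρ) (θ : C →⋆ₐ[ℂ] (K →L[ℂ] K)) (W : H →ₗᵢ[ℂ] K)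
    {φ : S → (H →L[ℂ] H)} (hφ : ∀ s, φ (star s) = star (φ s))
    (h : ∀ s y, θ (ρ s) (W y) = W (φ s y)) :
    ∃ τ : C →⋆ₐ[ℂ] (H →L[ℂ] H), (∀ c y, θ c (W y) = W (τ c y)) ∧ ∀ s, τ (ρ s) = φ s := by
  let V : H →L[ℂ] K := W.toContinuousLinearMap
  let V' : K →L[ℂ] H := ContinuousLinearMap.adjoint V
  have hV' : ∀ x y, inner ℂ x (V' y) = inner ℂ (V x) y := fun x y =>
    ContinuousLinearMap.adjoint_inner_right _ _ _
  have hVV : ∀ x, V' (V x) = x := fun x => ext_inner_left ℂ fun z => by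
    rw [hV']
    exact W.inner_map_map z x
  -- Adjoint of the hypothesis at s*. Together they say that the projection V V' commutes with
  -- θ(ρ(S)).
  have hadj : ∀ s y, V' (θ (ρ s) y) = φ s (V' y) := fun s y => ext_inner_left ℂ fun z => by
    have h1 : θ (ρ s) = ContinuousLinearMap.adjoint (θ (ρ (star s))) := by
      rw [hρ.map_star, StarHomClass.map_star, ContinuousLinearMap.star_eq_adjoint,
        ContinuousLinearMap.adjoint_adjoint]
    have h2 : φ s = ContinuousLinearMap.adjoint (φ (star s)) := by
      rw [hφ, ContinuousLinearMap.star_eq_adjoint, ContinuousLinearMap.adjoint_adjoint]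
    rw [hV', h1, h2, ContinuousLinearMap.adjoint_inner_right,
      ContinuousLinearMap.adjoint_inner_right, hV']
    exact congrArg (fun v => inner ℂ v y) (h (star s) z)
  let P : K →L[ℂ] K := V ∘L V'
  have hP : star P = P := by
    rw [ContinuousLinearMap.star_eq_adjoint, ContinuousLinearMap.adjoint_comp,
      ContinuousLinearMap.adjoint_adjoint]
  -- The commutant of the selfadjoint P pulls back to a closed *-subalgebra of C, so the relation
  -- passes from ρ(S) to C.
  have hcomm : ∀ c, P * θ c = θ c * P := by
    intro c
    have := hρ.mem_of_isClosed ((StarSubalgebra.centralizer ℂ {P}).comap θ) ?_ ?_ c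
    · exact ((StarSubalgebra.mem_centralizer_iff ℂ).1 this P rfl).1
    · have hset : (((StarSubalgebra.centralizer ℂ {P}).comap θ : StarSubalgebra ℂ C) : Set C) =
          {c | P * θ c = θ c * P} := by
        ext c
        change θ c ∈ StarSubalgebra.centralizer ℂ {P} ↔ _
        rw [StarSubalgebra.mem_centralizer_iff]
        simp [hP]
      rw [hset]
      have := θ.continuous_of_cstar
      exact isClosed_eq (by fun_prop) (by fun_prop)
    · intro s
      change θ (ρ s) ∈ StarSubalgebra.centralizer ℂ {P}
      rw [StarSubalgebra.mem_centralizer_iff]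
      rintro _ rfl
      rw [hP, and_self]
      ext y
      change V (V' (θ (ρ s) y)) = θ (ρ s) (V (V' y))
      rw [hadj]
      exact (h s (V' y)).symm
  have hcomm' : ∀ c y, θ c (V y) = V (V' (θ c (V y))) := fun c y => by
    have := congrArg (fun T : K →L[ℂ] K => T (V y)) (hcomm c)
    change V (V' (θ c (V y))) = θ c (V (V' (V y))) at this
    rw [this, hVV]
  -- Compression to an invariant subspace is multiplicative.
  let τ : C →⋆ₐ[ℂ] (H →L[ℂ] H) :=
    { toFun := fun c => V' ∘L θ c ∘L V
      map_one' := by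
        ext y
        change V' (θ 1 (V y)) = y
        rw [_root_.map_one]
        exact hVV y
      map_mul' := fun c d => by
        ext y
        change V' (θ (c * d) (V y)) = V' (θ c (V (V' (θ d (V y)))))
        rw [← hcomm' d, map_mul]
        rfl
      map_zero' := by ext; simp
      map_add' := fun c d => by ext; simp
      commutes' := fun r => by
        ext y
        change V' (θ (algebraMap ℂ C r) (V y)) = r • y
        rw [AlgHomClass.commutes]
        change V' (r • V y) = r • y
        rw [map_smul, hVV]
      map_star' := fun c => by
        rw [ContinuousLinearMap.star_eq_adjoint, ContinuousLinearMap.adjoint_comp,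
          ContinuousLinearMap.adjoint_comp, ContinuousLinearMap.adjoint_adjoint, StarHomClass.map_star,
          ContinuousLinearMap.star_eq_adjoint]
        rfl }
  refine ⟨τ, hcomm', fun s => ContinuousLinearMap.ext fun y => ?_⟩
  change V' (θ (ρ s) (V y)) = φ s y
  rw [hadj, hVV]

/-- A C*-cover with a faithful representation whose restriction is maximal is the
C*-envelope. -/
theorem IsMaximalUCP.isCStarEnvelope [CompleteSpace H] {E : Type u} [CStarAlgebra E]
    {ι : S →ₗ[ℂ] E} (hι : IsCStarCover ι) (σ : E →⋆ₐ[ℂ] (H →L[ℂ] H))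
    (hσ : Function.Injective σ) (hmax : IsMaximalUCP ((σ : E →ₗ[ℂ] (H →L[ℂ] H)).comp ι)) :
    IsCStarEnvelope ι where
  isCStarCover := hι
  universal C _ ρ hρ := by
    obtain ⟨K, _, _, _, θ, W, hW⟩ := hmax.isUCP.exists_starAlgHom_dilation hρ
    have htriv := hmax.trivial_dilation K _ W (hρ.isUCP_comp θ) hW
    obtain ⟨τ, -, hτ⟩ := hρ.exists_starAlgHom_of_intertwining θ W hmax.isUCP.map_star htriv
    -- The range of σ is closed and contains τ(ρ(S)). Hence σ⁻¹ ∘ τ is defined on C, and it is the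
    -- required epimorphism.
    have hrange : ∀ c, τ c ∈ σ.range := fun c =>
      hρ.mem_of_isClosed (σ.range.comap τ)
        (σ.isClosed_range.preimage τ.continuous_of_cstar)
        (fun s => ⟨ι s, (hτ s).symm⟩) c
    let e := StarAlgEquiv.ofInjective σ hσ
    let π : C →⋆ₐ[ℂ] E := (e.symm : σ.range →⋆ₐ[ℂ] E).comp (τ.codRestrict σ.range hrange)
    have hπ : ∀ s, π (ρ s) = ι s := fun s => by
      change e.symm _ = _
      rw [StarAlgEquiv.symm_apply_eq]
      exact Subtype.ext (hτ s)
    refine ⟨π, ⟨hι.surjective fun s => ⟨ρ s, hπ s⟩, hπ⟩, fun π' h' => ?_⟩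
    exact hρ.starAlgHom_ext fun s => by rw [h'.2, hπ]

/-- Two C*-envelopes are canonically isomorphic. -/
theorem IsCStarEnvelope.existsUnique_starAlgEquiv {E F : Type u} [CStarAlgebra E]
    [CStarAlgebra F] {ι : S →ₗ[ℂ] E} {j : S →ₗ[ℂ] F} (hι : IsCStarEnvelope ι)
    (hj : IsCStarEnvelope j) : ∃! Φ : F ≃⋆ₐ[ℂ] E, ∀ s, Φ (j s) = ι s := by
  obtain ⟨f, ⟨-, hf⟩, -⟩ := hι.universal F j hj.isCStarCover
  obtain ⟨g, ⟨-, hg⟩, -⟩ := hj.universal E ι hι.isCStarCover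
  have hgf : g.comp f = StarAlgHom.id ℂ F :=
    hj.isCStarCover.starAlgHom_ext fun s => by simp [hf, hg]
  have hfg : f.comp g = StarAlgHom.id ℂ E :=
    hι.isCStarCover.starAlgHom_ext fun s => by simp [hf, hg]
  refine ⟨StarAlgEquiv.ofStarAlgHom f g hgf hfg, hf, fun Ψ hΨ => ?_⟩
  have : (Ψ : F →⋆ₐ[ℂ] E) = f := hj.isCStarCover.starAlgHom_ext fun s => by
    rw [hf]; exact hΨ s
  exact StarAlgEquiv.ext fun x => congrArg (fun h : F →⋆ₐ[ℂ] E => h x) this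

end Maximal

/-- A nonempty compact set contains a point which is maximal for the order defined by a family of
continuous functions. -/
theorem IsCompact.exists_maximal_of_family {X : Type*} [TopologicalSpace X] {K : Set X}
    (hK : IsCompact K) (hne : K.Nonempty) {ι : Type*} (f : ι → X → ℝ)
    (hf : ∀ i, Continuous (f i)) :
    ∃ x ∈ K, ∀ y ∈ K, (∀ i, f i x ≤ f i y) → ∀ i, f i y ≤ f i x := by
  have hcomp : CompactSpace K := isCompact_iff_compactSpace.1 hK
  have : Nonempty K := hne.to_subtype
  obtain ⟨m, hm⟩ := exists_maximal_of_chains_bounded (α := K)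
    (r := fun x y => ∀ i, f i x ≤ f i y) (fun c hc => by
      rcases c.eq_empty_or_nonempty with rfl | hcne
      · exact ⟨Classical.arbitrary K, by simp⟩
      have : Nonempty c := hcne.to_subtype
      -- An upper bound of the chain is a common point of the closed sets of points above its
      -- members. These are nested because c is a chain, so compactness gives one.
      let t : c → Set K := fun a => {y | ∀ i, f i (a : K) ≤ f i y}
      have hclosed : ∀ a, IsClosed (t a) := fun a => by
        simp only [t, Set.ofPred_forall]
        exact isClosed_iInter fun i =>
          isClosed_le continuous_const ((hf i).comp continuous_subtype_val)
      obtain ⟨y, hy⟩ := IsCompact.nonempty_iInter_of_directed_nonempty_isCompact_isClosed t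
        (fun a b => by
          have hab : (∀ i, f i (a : K) ≤ f i (b : K)) ∨ ∀ i, f i (b : K) ≤ f i (a : K) := by
            rcases eq_or_ne (a : K) b with h | h
            · exact Or.inl fun i => by rw [h]
            · exact hc a.2 b.2 h
          rcases hab with h | h
          · exact ⟨b, fun y hy i => (h i).trans (hy i), subset_rfl⟩
          · exact ⟨a, subset_rfl, fun y hy i => (h i).trans (hy i)⟩)
        (fun a => ⟨a, fun i => le_rfl⟩) (fun a => (hclosed a).isCompact) hclosed
      exact ⟨y, fun a ha => Set.mem_iInter.1 hy ⟨a, ha⟩⟩)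
    (fun hab hbc i => (hab i).trans (hbc i))
  exact ⟨m, m.2, fun y hy h => hm ⟨y, hy⟩ h⟩

/-! ### Moments of completely positive maps -/

section Words

variable {S : Type*} [AddCommGroup S] [Module ℂ S] {I : Type*}
  {H : Type*} [NormedAddCommGroup H] [InnerProductSpace ℂ H]

/-- Prepend a letter to a word. -/
def wordCons (s : S) (w : List S × I) : List S × I := (s :: w.1, w.2)

/-- The vector `φ s₁ (φ s₂ (⋯ (e i)))` defined by a word. -/
def wordVec (φ : S →ₗ[ℂ] (H →L[ℂ] H)) (e : I → H) (w : List S × I) : H :=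
  w.1.foldr (fun s v => φ s v) (e w.2)

theorem wordVec_cons (φ : S →ₗ[ℂ] (H →L[ℂ] H)) (e : I → H) (s : S) (w : List S × I) :
    wordVec φ e (wordCons s w) = φ s (wordVec φ e w) := rfl

end Words

section WordKernels

variable {S : Type u} [AddCommGroup S] [Module ℂ S] [StarAddMonoid S]
  [StarModule ℂ S] [One S] [OperatorSystem S] {I : Type u}
  {H : Type u} [NormedAddCommGroup H] [InnerProductSpace ℂ H]

/-- The moments of a unital completely positive map, relative to a family of vectors. -/
structure IsWordKernel (p : List S × I → List S × I → ℂ) : Prop where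
  map_add : ∀ w v s t, p w (wordCons (s + t) v) = p w (wordCons s v) + p w (wordCons t v)
  map_smul : ∀ w v (c : ℂ) s, p w (wordCons (c • s) v) = c * p w (wordCons s v)
  adjoint : ∀ w v s, p (wordCons s w) v = p w (wordCons (star s) v)
  map_one : ∀ w v, p w (wordCons 1 v) = p w v
  nonneg : ∀ (n : ℕ) (j : Fin n → List S × I) (M : Matrix (Fin n) (Fin n) S),
    M ∈ OperatorSystem.matCone n → 0 ≤ ∑ k, ∑ l, p (j k) (wordCons (M k l) (j l))

theorem IsUCP.isWordKernel {φ : S →ₗ[ℂ] (H →L[ℂ] H)} (hφ : IsUCP φ) (e : I → H) :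
    IsWordKernel fun w v => inner ℂ (wordVec φ e w) (wordVec φ e v) where
  map_add w v s t := by simp [wordVec_cons]
  map_smul w v c s := by simp [wordVec_cons]
  adjoint w v s := by rw [wordVec_cons, wordVec_cons, hφ.inner_map_star]
  map_one w v := by rw [wordVec_cons, hφ.map_one]; rfl
  nonneg n j M hM := hφ.nonneg n M hM fun k => wordVec φ e (j k)

/-- GNS for the kernel s ↦ p w (s v) indexed by words. The operator φ s prepends the letter s, so
the one-vector words ([], i) generate everything. -/
theorem IsWordKernel.exists_isUCP {p : List S × I → List S × I → ℂ} (hp : IsWordKernel p) :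
    ∃ (H : Type u) (_ : NormedAddCommGroup H) (_ : InnerProductSpace ℂ H) (_ : CompleteSpace H)
      (e : I → H) (φ : S →ₗ[ℂ] (H →L[ℂ] H)),
      Dense (Submodule.span ℂ (Set.range (wordVec φ e)) : Set H) ∧
      IsUCP φ ∧ ∀ w v, inner ℂ (wordVec φ e w) (wordVec φ e v) = p w v := by
  let Φ : List S × I → List S × I → S →ₗ[ℂ] ℂ := fun w v =>
    { toFun := fun s => p w (wordCons s v)
      map_add' := hp.map_add w v
      map_smul' := hp.map_smul w v }
  obtain ⟨H, _, _, _, e, φ, he, hφ, hin⟩ := IsCPKernel.exists_isUCP (Φ := Φ) hp.nonneg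
  have hee : ∀ w v, inner ℂ (e w) (e v) = p w v := fun w v => by
    have := hin w v 1
    rw [hφ.map_one] at this
    exact this.trans (hp.map_one w v)
  have hext : ∀ v w : H, (∀ p, inner ℂ (e p) v = inner ℂ (e p) w) → v = w := fun v w h => by
    have : innerSL ℂ v = innerSL ℂ w := by
      refine ContinuousLinearMap.ext_on he ?_
      rintro _ ⟨p, rfl⟩
      rw [innerSL_apply_apply, innerSL_apply_apply, ← inner_conj_symm, h, inner_conj_symm]
    exact ext_inner_right ℂ fun z => congrArg (fun f => f z) this
  have hφe : ∀ s w, φ s (e w) = e (wordCons s w) := fun s w => hext _ _ fun v => by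
    rw [hin, hee]
    rfl
  have hword : ∀ w, wordVec φ (fun i => e ([], i)) w = e w := by
    rintro ⟨l, i⟩
    induction l with
    | nil => rfl
    | cons s l ih =>
      change φ s (wordVec φ (fun i => e ([], i)) (l, i)) = _
      rw [ih, hφe]
      rfl
  refine ⟨H, inferInstance, inferInstance, inferInstance, fun i => e ([], i), φ, ?_, hφ,
    fun w v => by rw [hword, hword, hee]⟩
  rwa [show wordVec φ (fun i => e ([], i)) = e from funext hword]

/-- The bound for the norm of a word, relative to its last vector. -/
noncomputable def wordBound (l : List S) : ℝ := (l.map OperatorSystem.bound).prod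

theorem wordBound_nonneg (l : List S) : 0 ≤ wordBound l :=
  List.prod_nonneg (by
    intro a ha
    obtain ⟨s, -, rfl⟩ := List.mem_map.1 ha
    exact (OperatorSystem.bound_pos s).le)

theorem IsUCP.norm_wordVec_le {φ : S →ₗ[ℂ] (H →L[ℂ] H)} (hφ : IsUCP φ) (e : I → H)
    (w : List S × I) : ‖wordVec φ e w‖ ≤ wordBound w.1 * ‖e w.2‖ := by
  obtain ⟨l, i⟩ := w
  induction l with
  | nil => simp [wordVec, wordBound]
  | cons s l ih =>
    refine (hφ.norm_apply_le s _).trans ?_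
    have hb := (OperatorSystem.bound_pos s).le
    refine (mul_le_mul_of_nonneg_left ih hb).trans (le_of_eq ?_)
    simp [wordBound, mul_assoc]

/-- Only moments of order zero enter the bound. Kernels with the same moments of order zero
therefore lie in one product of discs. -/
theorem IsWordKernel.norm_le {p : List S × I → List S × I → ℂ} (hp : IsWordKernel p)
    (w v : List S × I) : ‖p w v‖ ≤ wordBound w.1 * √(p ([], w.2) ([], w.2)).re *
      (wordBound v.1 * √(p ([], v.2) ([], v.2)).re) := by
  obtain ⟨H, _, _, _, e, φ, -, hφ, hin⟩ := hp.exists_isUCP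
  have hnorm : ∀ i, √(p ([], i) ([], i)).re = ‖e i‖ := fun i => by
    rw [← hin]
    exact (norm_eq_sqrt_re_inner (𝕜 := ℂ) (e i)).symm
  rw [← hin w v, hnorm, hnorm]
  refine (norm_inner_le_norm _ _).trans ?_
  exact mul_le_mul (hφ.norm_wordVec_le e w) (hφ.norm_wordVec_le e v) (norm_nonneg _)
    (mul_nonneg (wordBound_nonneg _) (norm_nonneg _))

/-- Each defining condition is a closed relation between finitely many coordinates. -/
theorem isClosed_setOf_isWordKernel :
    IsClosed {p : List S × I → List S × I → ℂ | IsWordKernel p} := by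
  have : {p : List S × I → List S × I → ℂ | IsWordKernel p} =
      {p | (∀ w v s t, p w (wordCons (s + t) v) = p w (wordCons s v) + p w (wordCons t v)) ∧
        (∀ w v (c : ℂ) s, p w (wordCons (c • s) v) = c * p w (wordCons s v)) ∧
        (∀ w v s, p (wordCons s w) v = p w (wordCons (star s) v)) ∧
        (∀ w v, p w (wordCons 1 v) = p w v) ∧
        ∀ (n : ℕ) (j : Fin n → List S × I) (M : Matrix (Fin n) (Fin n) S),
          M ∈ OperatorSystem.matCone n →
          0 ≤ ∑ k, ∑ l, p (j k) (wordCons (M k l) (j l))} := by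
    ext p
    exact ⟨fun h => ⟨h.1, h.2, h.3, h.4, h.5⟩, fun h => ⟨h.1, h.2.1, h.2.2.1, h.2.2.2.1, h.2.2.2.2⟩⟩
  rw [this]
  have hc : ∀ w v, Continuous fun p : List S × I → List S × I → ℂ => p w v := fun w v =>
    (continuous_apply v).comp (continuous_apply w)
  simp only [Set.ofPred_and, Set.ofPred_forall]
  refine IsClosed.inter ?_ (IsClosed.inter ?_ (IsClosed.inter ?_ (IsClosed.inter ?_ ?_)))
  · exact isClosed_iInter fun w => isClosed_iInter fun v => isClosed_iInter fun s =>
      isClosed_iInter fun t => isClosed_eq (hc _ _) ((hc _ _).add (hc _ _))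
  · exact isClosed_iInter fun w => isClosed_iInter fun v => isClosed_iInter fun c =>
      isClosed_iInter fun s => isClosed_eq (hc _ _) (continuous_const.mul (hc _ _))
  · exact isClosed_iInter fun w => isClosed_iInter fun v => isClosed_iInter fun s =>
      isClosed_eq (hc _ _) (hc _ _)
  · exact isClosed_iInter fun w => isClosed_iInter fun v => isClosed_eq (hc _ _) (hc _ _)
  · exact isClosed_iInter fun n => isClosed_iInter fun j => isClosed_iInter fun M =>
      isClosed_iInter fun _ => isClosed_le continuous_const
        (continuous_finsetSum _ fun k _ => continuous_finsetSum _ fun l _ => hc _ _)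

/-- Two kernels agree on pairs of words of total length at most `n`. -/
def AgreeUpTo (n : ℕ) (p q : List S × I → List S × I → ℂ) : Prop :=
  ∀ w v, w.1.length + v.1.length ≤ n → p w v = q w v

/-- The kernel `q` is maximal on words of length `n + 1` among all word kernels with the same
moments of order at most `2 * n + 1`. -/
def IsMaximalAt (n : ℕ) (q : List S × I → List S × I → ℂ) : Prop :=
  ∀ q', IsWordKernel q' → AgreeUpTo (2 * n + 1) q q' →
    (∀ w, w.1.length = n + 1 → (q w w).re ≤ (q' w w).re) →
    ∀ w, w.1.length = n + 1 → (q' w w).re ≤ (q w w).re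

/-- By Tychonoff the competitors form a compact set. The quantities made maximal have order 2n + 2,
the first order that is not prescribed. -/
theorem IsWordKernel.exists_isMaximalAt {p : List S × I → List S × I → ℂ} (hp : IsWordKernel p)
    (n : ℕ) : ∃ q, IsWordKernel q ∧ AgreeUpTo (2 * n + 1) p q ∧ IsMaximalAt n q := by
  let K : Set (List S × I → List S × I → ℂ) := {q | IsWordKernel q ∧ AgreeUpTo (2 * n + 1) p q}
  have hc : ∀ w v, Continuous fun p : List S × I → List S × I → ℂ => p w v := fun w v =>
    (continuous_apply v).comp (continuous_apply w)
  have hclosed : IsClosed K := by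
    have h : IsClosed {q | AgreeUpTo (2 * n + 1) p q} := by
      simp only [AgreeUpTo, Set.ofPred_forall]
      exact isClosed_iInter fun w => isClosed_iInter fun v => isClosed_iInter fun _ =>
        isClosed_eq continuous_const (hc w v)
    exact isClosed_setOf_isWordKernel.inter h
  have hK : IsCompact K := by
    refine IsCompact.of_isClosed_subset (isCompact_univ_pi fun w => isCompact_univ_pi fun v =>
      isCompact_closedBall (0 : ℂ) (wordBound w.1 * √(p ([], w.2) ([], w.2)).re *
      (wordBound v.1 * √(p ([], v.2) ([], v.2)).re))) hclosed ?_
    rintro q ⟨hq, hpq⟩ w - v -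
    have h0 : ∀ i, p ([], i) ([], i) = q ([], i) ([], i) := fun i => hpq _ _ (by simp)
    rw [mem_closedBall_zero_iff, h0, h0]
    exact hq.norm_le w v
  obtain ⟨q, ⟨hq, hpq⟩, hmax⟩ := hK.exists_maximal_of_family ⟨p, hp, fun _ _ _ => rfl⟩
    (ι := {w : List S × I // w.1.length = n + 1}) (fun w q => (q w w).re)
    (fun w => Complex.continuous_re.comp (hc _ _))
  refine ⟨q, hq, hpq, fun q' hq' hqq' hle w hw => ?_⟩
  exact hmax q' ⟨hq', fun w v h => (hpq w v h).trans (hqq' w v h)⟩ (fun w => hle w w.2) ⟨w, hw⟩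

/-- Every word kernel can be changed in orders at least two so that it becomes maximal in all
orders. -/
theorem IsWordKernel.exists_forall_isMaximalAt {p : List S × I → List S × I → ℂ}
    (hp : IsWordKernel p) : ∃ q, IsWordKernel q ∧ AgreeUpTo 1 p q ∧ ∀ n, IsMaximalAt n q := by
  choose next hnext hagree hmax using
    fun (r : {r : List S × I → List S × I → ℂ // IsWordKernel r}) => r.2.exists_isMaximalAt
  obtain ⟨a, ha0, ha⟩ : ∃ a : ℕ → {r : List S × I → List S × I → ℂ // IsWordKernel r},
      a 0 = ⟨p, hp⟩ ∧ ∀ n, a (n + 1) = ⟨next (a n) n, hnext (a n) n⟩ :=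
    ⟨fun n => Nat.rec ⟨p, hp⟩ (fun n r => ⟨next r n, hnext r n⟩) n, rfl, fun _ => rfl⟩
  have hstep : ∀ n, AgreeUpTo (2 * n + 1) (a n).1 (a (n + 1)).1 := fun n => by
    rw [ha]; exact hagree (a n) n
  have hmax' : ∀ n, IsMaximalAt n (a (n + 1)).1 := fun n => by
    rw [ha]; exact hmax (a n) n
  have hmono : ∀ n m, n ≤ m → AgreeUpTo (2 * n + 1) (a n).1 (a m).1 := by
    intro n m hnm
    induction m, hnm using Nat.le_induction with
    | base => exact fun _ _ _ => rfl
    | succ m hm ih => exact fun w v h => (ih w v h).trans (hstep m w v (by omega))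
  -- A moment of order m is constant from stage m on, as m ≤ 2m + 1; reading it off there gives the
  -- limit kernel.
  let q : List S × I → List S × I → ℂ := fun w v => (a (w.1.length + v.1.length)).1 w v
  have hq : ∀ n, AgreeUpTo (2 * n + 1) (a n).1 q := by
    intro n w v h
    rcases le_total n (w.1.length + v.1.length) with h' | h'
    · exact hmono _ _ h' w v h
    · exact (hmono _ _ h' w v (by omega)).symm
  have hq' : ∀ n w v, w.1.length + v.1.length ≤ n → q w v = (a n).1 w v := fun n w v h =>
    (hq n w v (by omega)).symm
  refine ⟨q, ⟨fun w v s t => ?_, fun w v c s => ?_, fun w v s => ?_, fun w v => ?_,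
    fun n j M hM => ?_⟩, ?_, fun n r hr hqr hle w hw => ?_⟩
  · exact (a (w.1.length + (v.1.length + 1))).2.map_add w v s t
  · exact (a (w.1.length + (v.1.length + 1))).2.map_smul w v c s
  · rw [hq' (w.1.length + v.1.length + 1) _ _ (by simp [wordCons]; omega),
      hq' (w.1.length + v.1.length + 1) _ _ (by simp [wordCons]; omega)]
    exact (a _).2.adjoint w v s
  · rw [hq' (w.1.length + v.1.length + 1) _ _ (by simp [wordCons]; omega),
      hq' (w.1.length + v.1.length + 1) _ _ (by omega)]
    exact (a _).2.map_one w v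
  -- Only finitely many words occur, so one late stage computes the whole sum; the extra 1 accounts
  -- for the prepended letter.
  · let N := ∑ k, (j k).1.length
    have hN : ∀ k, (j k).1.length ≤ N := fun k =>
      Finset.single_le_sum (f := fun k => (j k).1.length) (fun _ _ => Nat.zero_le _)
        (Finset.mem_univ k)
    have := (a (N + N + 1)).2.nonneg n j M hM
    convert this using 4 with k _ l _
    refine hq' _ _ _ ?_
    have h1 := hN k
    have h2 := hN l
    simp only [wordCons, List.length_cons]
    omega
  · have := hq 0
    rwa [ha0] at this
  -- The norms made maximal at step n have order 2n + 2 ≤ 2(n + 1) + 1, so later stages leave them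
  -- unchanged.
  · have hself : ∀ w : List S × I, w.1.length = n + 1 → q w w = (a (n + 1)).1 w w := fun w hw =>
      (hq (n + 1) w w (by omega)).symm
    rw [hself w hw]
    refine hmax' n r hr (fun w v h => ?_) (fun w hw => ?_) w hw
    · exact (hq (n + 1) w v (by omega)).trans (hqr w v h)
    · have := hle w hw
      rwa [hself w hw] at this

end WordKernels

/-! ### Existence of maximal dilations -/

section MaximalDilation

/-- By hypothesis W a is the component of z along W, so ‖z - W a‖² = ‖z‖² - ‖a‖² ≤ 0. -/
theorem LinearIsometry.eq_of_inner_eq_of_norm_le {H K : Type*} [NormedAddCommGroup H]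
    [InnerProductSpace ℂ H] [NormedAddCommGroup K] [InnerProductSpace ℂ K] (W : H →ₗᵢ[ℂ] K)
    {z : K} {a : H} (h : ∀ x, inner ℂ (W x) z = inner ℂ x a) (hn : ‖z‖ ≤ ‖a‖) : z = W a := by
  rw [← sub_eq_zero, ← norm_eq_zero, ← sq_eq_zero_iff]
  refine le_antisymm ?_ (by positivity)
  have h1 : RCLike.re (inner ℂ z (W a)) = ‖a‖ ^ 2 := by
    rw [← inner_conj_symm, h, RCLike.conj_re, ← norm_sq_eq_re_inner]
  rw [@norm_sub_sq ℂ, h1, W.norm_map]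
  nlinarith [norm_nonneg z]

theorem LinearIsometry.norm_le_of_inner_eq {H K : Type*} [NormedAddCommGroup H]
    [InnerProductSpace ℂ H] [NormedAddCommGroup K] [InnerProductSpace ℂ K] (W : H →ₗᵢ[ℂ] K)
    {z : K} {a : H} (h : ∀ x, inner ℂ (W x) z = inner ℂ x a) : ‖a‖ ≤ ‖z‖ := by
  have h1 : ‖a‖ * ‖a‖ ≤ ‖a‖ * ‖z‖ := by
    have := norm_inner_le_norm (𝕜 := ℂ) (W a) z
    rwa [h, inner_self_eq_norm_sq_to_K, W.norm_map, norm_pow, RCLike.norm_ofReal,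
      abs_norm, sq] at this
  rcases (norm_nonneg a).eq_or_lt with h0 | h0
  · rw [← h0]; exact norm_nonneg z
  · exact le_of_mul_le_mul_left h1 h0

variable {S : Type u} [AddCommGroup S] [Module ℂ S] [StarAddMonoid S]
  [StarModule ℂ S] [One S] [OperatorSystem S] {I : Type u}

/-- Letters can be moved from one word to the other with an adjoint, so lengths of total at most 2n
+ 1 can be rebalanced to at most n and n + 1. -/
theorem IsWordKernel.agreeUpTo_of_forall {p q : List S × I → List S × I → ℂ}
    (hp : IsWordKernel p) (hq : IsWordKernel q) {n : ℕ}
    (h : ∀ w v, w.1.length ≤ n → v.1.length ≤ n + 1 → p w v = q w v) :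
    AgreeUpTo (2 * n + 1) p q := by
  have h1 : ∀ (l : List S) (i : I) (w : List S × I), w.1.length + l.length ≤ 2 * n + 1 →
      w.1.length ≤ n → p w (l, i) = q w (l, i) := by
    intro l i
    induction l with
    | nil => exact fun w _ hw => h w _ hw (Nat.zero_le _)
    | cons s l ih =>
      intro w hwl hw
      rw [List.length_cons] at hwl
      rcases le_or_gt (l.length + 1) (n + 1) with hl | hl
      · exact h w _ hw (by simpa using hl)
      · have := ih (wordCons (star s) w) (by simp [wordCons]; omega) (by simp [wordCons]; omega)
        rwa [hp.adjoint, hq.adjoint, star_star] at this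
  have h2 : ∀ (l : List S) (i : I) (v : List S × I), l.length + v.1.length ≤ 2 * n + 1 →
      p (l, i) v = q (l, i) v := by
    intro l i
    induction l with
    | nil => exact fun v hv => h1 v.1 v.2 _ hv (Nat.zero_le _)
    | cons s l ih =>
      intro v hv
      rw [List.length_cons] at hv
      have := ih (wordCons (star s) v) (by simp [wordCons]; omega)
      rwa [← hp.adjoint, ← hq.adjoint] at this
  exact fun w v hwv => h2 w.1 w.2 v hwv

/-- The representation defined by a word kernel which is maximal in all orders is maximal. -/
theorem IsUCP.isMaximalUCP_of_isMaximalAt {H : Type u} [NormedAddCommGroup H]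
    [InnerProductSpace ℂ H] {φ : S →ₗ[ℂ] (H →L[ℂ] H)} (hφ : IsUCP φ) {e : I → H}
    (he : Dense (Submodule.span ℂ (Set.range (wordVec φ e)) : Set H))
    (hmax : ∀ n, IsMaximalAt n fun w v => inner ℂ (wordVec φ e w) (wordVec φ e v)) :
    IsMaximalUCP φ where
  isUCP := hφ
  trivial_dilation K _ _ _ η W hη hW := by
    -- The dilation produces no new vectors: its words on the vectors W(eᵢ) stay in the range of W.
    -- Triviality then follows by density of the words.
    have key : ∀ n (w : List S × I), w.1.length ≤ n →
        wordVec η (fun i => W (e i)) w = W (wordVec φ e w) := by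
      intro n
      induction n with
      | zero =>
        rintro ⟨l, i⟩ hl
        obtain rfl : l = [] := List.length_eq_zero_iff.1 (Nat.le_zero.1 hl)
        rfl
      | succ n ih =>
        have hcons : ∀ s (w : List S × I), w.1.length ≤ n →
            wordVec η (fun i => W (e i)) (wordCons s w) = η s (W (wordVec φ e w)) :=
          fun s w hw => by rw [wordVec_cons, ih w hw]
        -- By induction words of length at most n are images under W. One further letter is paired
        -- with such an image, and there the dilation agrees with φ.
        have hagree := (hφ.isWordKernel e).agreeUpTo_of_forall
          (hη.isWordKernel fun i => W (e i)) (n := n) (by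
            rintro w ⟨l, i⟩ hw hv
            rw [ih w hw]
            cases l with
            | nil => exact (W.inner_map_map _ _).symm
            | cons s l =>
              have hl : ((l, i) : List S × I).1.length ≤ n := by simpa using hv
              have h1 := hcons s (l, i) hl
              have h2 := wordVec_cons φ e s (l, i)
              rw [wordCons] at h1 h2
              rw [h1, h2, hW])
        have hself : ∀ {L : Type u} [NormedAddCommGroup L] [InnerProductSpace ℂ L] (x : L),
            (inner ℂ x x).re = ‖x‖ ^ 2 := fun x => (norm_sq_eq_re_inner (𝕜 := ℂ) x).symm
        -- The dilation is an admissible competitor, and its words of length n + 1 are at least as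
        -- long in norm as those of φ. Maximality gives the reverse inequality.
        have hle := hmax n _ (hη.isWordKernel fun i => W (e i)) hagree (by
          rintro ⟨_ | ⟨s, l⟩, i⟩ hw
          · simp at hw
          · have hl : ((l, i) : List S × I).1.length ≤ n := by simpa using hw.le
            have h1 := hcons s (l, i) hl
            have h2 := wordVec_cons φ e s (l, i)
            rw [wordCons] at h1 h2
            simp only
            rw [h1, h2, hself, hself]
            have := W.norm_le_of_inner_eq fun x => hW s x (wordVec φ e (l, i))
            gcongr)
        rintro ⟨_ | ⟨s, l⟩, i⟩ hw
        · rfl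
        · have hl : ((l, i) : List S × I).1.length ≤ n := by simpa using hw
          rcases hw.lt_or_eq with hlt | heq
          · exact ih _ (Nat.lt_succ_iff.1 hlt)
          · have h0 := hle _ heq
            have h1 := hcons s (l, i) hl
            have h2 := wordVec_cons φ e s (l, i)
            rw [wordCons] at h1 h2
            simp only at h0
            rw [h1, h2, hself, hself] at h0
            rw [h1, h2]
            exact W.eq_of_inner_eq_of_norm_le (fun x => hW s x (wordVec φ e (l, i)))
              (le_of_sq_le_sq h0 (norm_nonneg _))
    intro s y
    have : (η s) ∘L W.toContinuousLinearMap = W.toContinuousLinearMap ∘L (φ s) := by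
      refine ContinuousLinearMap.ext_on he ?_
      rintro _ ⟨w, rfl⟩
      change η s (W (wordVec φ e w)) = W (φ s (wordVec φ e w))
      rw [← wordVec_cons, ← key _ w le_rfl, ← key _ (wordCons s w) le_rfl, wordVec_cons]
    exact congrArg (fun T : H →L[ℂ] K => T y) this

/-- Every completely positive kernel is given by a maximal unital completely positive map. -/
theorem IsCPKernel.exists_isMaximalUCP {Φ : I → I → S →ₗ[ℂ] ℂ} (hΦ : IsCPKernel Φ) :
    ∃ (H : Type u) (_ : NormedAddCommGroup H) (_ : InnerProductSpace ℂ H) (_ : CompleteSpace H)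
      (e : I → H) (φ : S →ₗ[ℂ] (H →L[ℂ] H)), IsMaximalUCP φ ∧
      ∀ i j s, inner ℂ (e i) (φ s (e j)) = Φ i j s := by
  obtain ⟨H₀, _, _, _, e₀, φ₀, -, hφ₀, hin₀⟩ := hΦ.exists_isUCP
  obtain ⟨q, hq, hagree, hmax⟩ := (hφ₀.isWordKernel e₀).exists_forall_isMaximalAt
  obtain ⟨H, _, _, _, e, φ, he, hφ, hin⟩ := hq.exists_isUCP
  refine ⟨H, inferInstance, inferInstance, inferInstance, e, φ,
    hφ.isMaximalUCP_of_isMaximalAt he ?_, fun i j s => ?_⟩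
  · simpa only [hin] using hmax
  · have h1 := hin ([], i) ([s], j)
    -- The values Φ i j s are moments of order one, which the maximization preserves.
    have h2 := hagree ([], i) ([s], j) (by simp)
    rw [← h2] at h1
    exact h1.trans (hin₀ i j s)

end MaximalDilation

/-! ### Separation from the cones and a faithful maximal map -/

section Separation

variable {S : Type u} [AddCommGroup S] [Module ℂ S] [StarAddMonoid S]
  [StarModule ℂ S] [One S] [OperatorSystem S]

/-- If the order unit is zero, all hermitian matrices are positive, and properness kills them. This
excludes the degenerate case when a functional is normalized at the unit. -/
theorem OperatorSystem.eq_zero_of_unitMat_eq_zero {n : ℕ} (h : unitMat S n = 0)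
    {M : Matrix (Fin n) (Fin n) S} (hM : M.IsHermitian) : M = 0 := by
  have key : ∀ N : Matrix (Fin n) (Fin n) S, N.IsHermitian → N ∈ OperatorSystem.matCone n := by
    intro N hN
    obtain ⟨r, -, hr⟩ := OperatorSystem.order_unit hN
    rwa [h, smul_zero, zero_add] at hr
  exact OperatorSystem.proper (key M hM) (key _ hM.neg)

/-- A hermitian matrix which is not positive is separated from the cone by a completely positive
kernel. -/
theorem OperatorSystem.exists_isCPKernel_of_notMem {n : ℕ} {M : Matrix (Fin n) (Fin n) S}
    (hM : M.IsHermitian) (hM' : M ∉ OperatorSystem.matCone n) :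
    ∃ Φ : Fin n → Fin n → S →ₗ[ℂ] ℂ, IsCPKernel Φ ∧ ¬ 0 ≤ ∑ k, ∑ l, Φ k l (M k l) := by
  -- The Archimedean property leaves room: a normalized functional that is not positive at r·1 + M
  -- is at most -r at M, hence strictly negative there.
  obtain ⟨r, hr, hrM⟩ : ∃ r : ℝ, 0 < r ∧ (r : ℂ) • unitMat S n + M ∉ OperatorSystem.matCone n := by
    by_contra! hcon
    exact hM' (OperatorSystem.archimedean hcon)
  set X : Matrix (Fin n) (Fin n) S := (r : ℂ) • unitMat S n + M with hX
  have hunit : (unitMat S n).IsHermitian :=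
    OperatorSystem.isHermitian_of_mem (OperatorSystem.unitMat_mem n)
  have hsmul : ∀ (t : ℝ) {N : Matrix (Fin n) (Fin n) S}, N.IsHermitian →
      ((t : ℂ) • N).IsHermitian := fun t N hN => by
    rw [Matrix.IsHermitian, Matrix.conjTranspose_smul, hN, Complex.star_def, Complex.conj_ofReal]
  have hXh : X.IsHermitian := (hsmul r hunit).add hM
  have hne : unitMat S n ≠ 0 := fun h => hM' (by
    rw [OperatorSystem.eq_zero_of_unitMat_eq_zero h hM]
    exact OperatorSystem.zero_mem n)
  let σ : Matrix (Fin n) (Fin n) S →ₗ⋆[ℂ] Matrix (Fin n) (Fin n) S :=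
    { toFun := Matrix.conjTranspose
      map_add' := Matrix.conjTranspose_add
      map_smul' := fun c N => Matrix.conjTranspose_smul c N }
  have hσ : ∀ N, σ N = Nᴴ := fun N => rfl
  -- The cone generated by the positive matrices and -X. The functional with value 1 at the unit is
  -- extended positively from the scalars.
  let P : Set (Matrix (Fin n) (Fin n) S) :=
    {N | ∃ Q ∈ OperatorSystem.matCone n, ∃ t : ℝ, 0 ≤ t ∧ N = Q - (t : ℂ) • X}
  have hconeP : ∀ Q ∈ OperatorSystem.matCone n, Q ∈ P := fun Q hQ => ⟨Q, hQ, 0, le_rfl, by simp⟩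
  have hTσ : ∀ c : ℂ, c • unitMat S n + σ (c • unitMat S n) =
      ((2 * c.re : ℝ) : ℂ) • unitMat S n := fun c => by
    rw [hσ, Matrix.conjTranspose_smul, hunit, ← add_smul, Complex.star_def, Complex.add_conj]
  obtain ⟨g, hg1, hgP⟩ := exists_positive_extension (W := ℂ) σ P
    (hconeP _ (OperatorSystem.zero_mem n))
    (by
      rintro _ _ ⟨Q, hQ, t, ht, rfl⟩ ⟨Q', hQ', t', ht', rfl⟩
      exact ⟨Q + Q', OperatorSystem.add_mem hQ hQ', t + t', add_nonneg ht ht', by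
        rw [Complex.ofReal_add, add_smul]; abel⟩)
    (by
      rintro _ a ha ⟨Q, hQ, t, ht, rfl⟩
      exact ⟨(a : ℂ) • Q, OperatorSystem.smul_mem hQ ha, a * t, mul_nonneg ha ht, by
        rw [smul_sub, smul_smul, Complex.ofReal_mul]⟩)
    (LinearMap.toSpanSingleton ℂ _ (unitMat S n))
    (by
      intro a b hab
      exact smul_left_injective ℂ hne hab)
    LinearMap.id
    (by
      intro c hc
      rw [LinearMap.toSpanSingleton_apply, hTσ] at hc
      obtain ⟨Q, hQ, t, ht, hQt⟩ := hc
      rw [LinearMap.id_apply]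
      by_contra! hneg
      have hpos : ((-(2 * c.re) : ℝ) : ℂ) • unitMat S n ∈ OperatorSystem.matCone n :=
        OperatorSystem.smul_mem (OperatorSystem.unitMat_mem n) (by linarith)
      -- A negative multiple of the unit in P contradicts properness if t = 0; if t > 0, it would
      -- make X positive.
      rcases ht.eq_or_lt with rfl | ht
      · rw [Complex.ofReal_zero, zero_smul, sub_zero] at hQt
        have h0 := OperatorSystem.proper hpos (by
          rw [← neg_smul, ← Complex.ofReal_neg, neg_neg, hQt]; exact hQ)
        rcases smul_eq_zero.1 h0 with h | h
        · rw [Complex.ofReal_eq_zero] at h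
          linarith
        · exact hne h
      · apply hrM
        have h1 : (t : ℂ) • X = Q + ((-(2 * c.re) : ℝ) : ℂ) • unitMat S n := by
          rw [Complex.ofReal_neg, neg_smul, hQt]
          abel
        have h2 := OperatorSystem.smul_mem (OperatorSystem.add_mem hQ hpos) (inv_nonneg.2 ht.le)
        rwa [← h1, smul_smul, ← Complex.ofReal_mul, inv_mul_cancel₀ ht.ne', Complex.ofReal_one,
          one_smul] at h2)
    (by
      intro N
      obtain ⟨a, -, ha⟩ := OperatorSystem.order_unit (M := N + σ N) (by
        rw [hσ, add_comm]
        exact Matrix.isHermitian_transpose_add_self N)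
      refine ⟨((a / 2 : ℝ) : ℂ), hconeP _ ?_⟩
      rw [LinearMap.toSpanSingleton_apply, hTσ, Complex.ofReal_re]
      convert ha using 4
      ring)
  have hpos : ∀ Q ∈ OperatorSystem.matCone n, 0 ≤ g Q := fun Q hQ =>
    hgP Q (hconeP Q hQ) (OperatorSystem.isHermitian_of_mem hQ)
  refine ⟨fun k l => g.comp (Matrix.singleLinearMap ℂ k l), fun m j N hN => ?_, ?_⟩
  -- The kernel consists of the entries of g. Spreading N over the indices j is compression by a 0-1
  -- matrix, so positivity of g suffices.
  · have h := hpos _ (OperatorSystem.compress_mem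
      (Matrix.of fun k i => if j k = i then (1 : ℂ) else 0) hN)
    convert h using 1
    have : matCompress (Matrix.of fun k i => if j k = i then (1 : ℂ) else 0) N =
        ∑ k, ∑ l, Matrix.single (j k) (j l) (N k l) := by
      ext a b
      simp only [matCompress, Matrix.of_apply, Matrix.sum_apply]
      refine Finset.sum_congr rfl fun k _ => Finset.sum_congr rfl fun l _ => ?_
      rw [Matrix.single_apply]
      by_cases h1 : j k = a <;> by_cases h2 : j l = b <;> simp [h1, h2]
    rw [this]
    simp only [map_sum]
    rfl
  · have h1 : ∑ k, ∑ l, (g.comp (Matrix.singleLinearMap ℂ k l)) (M k l) = g M := by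
      conv_rhs => rw [Matrix.matrix_eq_sum_single M]
      simp only [map_sum]
      rfl
    have h2 : 0 ≤ g (-X) := hgP _ ⟨0, OperatorSystem.zero_mem n, 1, zero_le_one, by simp⟩ hXh.neg
    have h3 : g (unitMat S n) = 1 := by simpa using hg1 1
    rw [h1]
    intro h4
    rw [hX, map_neg, map_add, map_smul, h3] at h2
    have h5 := (Complex.nonneg_iff.1 h2).1
    have h6 := (Complex.nonneg_iff.1 h4).1
    simp at h5
    linarith

end Separation

section BlockKernel

variable {S : Type u} [AddCommGroup S] [Module ℂ S] {B : Type*} [DecidableEq B] {J : B → Type*}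

/-- The block diagonal kernel with blocks `Φ b`. -/
noncomputable def blockKernel (Φ : ∀ b, J b → J b → S →ₗ[ℂ] ℂ) (x y : Σ b, J b) : S →ₗ[ℂ] ℂ where
  -- `Pi.single` vanishes between different blocks, which avoids transporting the dependent index.
  toFun s := kernelForm (Φ x.1) s (Finsupp.single x.2 1)
    ((Pi.single y.1 (Finsupp.single y.2 1) : ∀ b, J b →₀ ℂ) x.1)
  map_add' _ _ := kernelForm_add _ _ _ _ _
  map_smul' _ _ := kernelForm_smul _ _ _ _ _

theorem blockKernel_apply (Φ : ∀ b, J b → J b → S →ₗ[ℂ] ℂ) (x y : Σ b, J b) (s : S) :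
    blockKernel Φ x y s = kernelForm (Φ x.1) s (Finsupp.single x.2 1)
      ((Pi.single y.1 (Finsupp.single y.2 1) : ∀ b, J b →₀ ℂ) x.1) := rfl

theorem blockKernel_same (Φ : ∀ b, J b → J b → S →ₗ[ℂ] ℂ) (b : B) (i j : J b) (s : S) :
    blockKernel Φ ⟨b, i⟩ ⟨b, j⟩ s = Φ b i j s := by
  rw [blockKernel_apply, Pi.single_eq_same, kernelForm_single]

variable [StarAddMonoid S] [StarModule ℂ S] [One S] [OperatorSystem S]

/-- The form splits into the forms of the finitely many blocks that occur; each is nonnegative and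
the mixed terms vanish. -/
theorem isCPKernel_blockKernel {Φ : ∀ b, J b → J b → S →ₗ[ℂ] ℂ} (hΦ : ∀ b, IsCPKernel (Φ b)) :
    IsCPKernel (blockKernel Φ) := by
  intro n j M hM
  let x : Fin n → ∀ b, J b →₀ ℂ := fun k => Pi.single (j k).1 (Finsupp.single (j k).2 1)
  have h : 0 ≤ ∑ b ∈ Finset.univ.image (fun k => (j k).1),
      ∑ k, ∑ l, kernelForm (Φ b) (M k l) (x k b) (x l b) :=
    Finset.sum_nonneg fun b _ => (hΦ b).kernelForm_nonneg (fun k => x k b) hM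
  rw [Finset.sum_comm] at h
  convert h using 2 with k
  rw [Finset.sum_comm]
  refine Finset.sum_congr rfl fun l _ => ?_
  refine Eq.trans ?_ (Finset.sum_eq_single_of_mem (j k).1
    (Finset.mem_image_of_mem (fun k => (j k).1) (Finset.mem_univ k)) ?_).symm
  · simp only [x]
    rw [Pi.single_eq_same]
    rfl
  · intro b _ hb
    simp only [x]
    rw [Pi.single_eq_of_ne hb, map_zero, LinearMap.zero_apply]

variable (S) in
/-- Every operator system has a maximal unital completely positive map which determines its
matrix order. -/
theorem OperatorSystem.exists_isMaximalUCP :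
    ∃ (H : Type u) (_ : NormedAddCommGroup H) (_ : InnerProductSpace ℂ H) (_ : CompleteSpace H)
      (φ : S →ₗ[ℂ] (H →L[ℂ] H)), IsMaximalUCP φ ∧
      ∀ (n : ℕ) (M : Matrix (Fin n) (Fin n) S), M.IsHermitian →
        (∀ ξ : Fin n → H, 0 ≤ ∑ k, ∑ l, inner ℂ (ξ k) (φ (M k l) (ξ l))) →
        M ∈ OperatorSystem.matCone n := by
  classical
  -- One block for every hermitian matrix that is not positive. If such a matrix were positive under
  -- φ, the vectors of its own block would contradict the separation.
  let B : Type u := {x : Σ n : ℕ, Matrix (Fin n) (Fin n) S //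
    x.2.IsHermitian ∧ x.2 ∉ OperatorSystem.matCone x.1}
  choose Φ hΦ hsep using fun b : B =>
    OperatorSystem.exists_isCPKernel_of_notMem b.2.1 b.2.2
  obtain ⟨H, _, _, _, e, φ, hφ, hin⟩ := (isCPKernel_blockKernel hΦ).exists_isMaximalUCP
  refine ⟨H, inferInstance, inferInstance, inferInstance, φ, hφ, fun n M hM hpos => ?_⟩
  by_contra hcon
  let b : B := ⟨⟨n, M⟩, hM, hcon⟩
  refine hsep b ?_
  have := hpos fun k => e ⟨b, k⟩
  simp only [hin, blockKernel_same] at this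
  exact this

end BlockKernel

/-! ### Existence of the C*-envelope -/

section EnvelopeExistence

/-- The embedding of a closed subalgebra is a closed map, so the algebra generated inside it has
closed image in B. It then suffices to reach the generators R. -/
theorem StarSubalgebra.topologicalClosure_adjoin_eq_top_of_subset {B : Type*} [CStarAlgebra B]
    {R : Set B} {T : Set (StarAlgebra.adjoin ℂ R).topologicalClosure}
    (h : ∀ r ∈ R, ∃ t ∈ (StarAlgebra.adjoin ℂ T).topologicalClosure, (t : B) = r) :
    (StarAlgebra.adjoin ℂ T).topologicalClosure = ⊤ := by
  let A := (StarAlgebra.adjoin ℂ R).topologicalClosure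
  let P := (StarAlgebra.adjoin ℂ T).topologicalClosure
  have hA : IsClosed (A : Set B) := StarSubalgebra.isClosed_topologicalClosure _
  have hP : IsClosed (P : Set A) := StarSubalgebra.isClosed_topologicalClosure _
  have hcl : IsClosed ((P.map A.subtype : StarSubalgebra ℂ B) : Set B) :=
    hA.isClosedEmbedding_subtypeVal.isClosedMap _ hP
  have hle : A ≤ P.map A.subtype :=
    StarSubalgebra.topologicalClosure_minimal (StarAlgebra.adjoin_le fun r hr => by
      obtain ⟨t, ht, rfl⟩ := h r hr
      exact ⟨t, ht, rfl⟩) hcl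
  refine StarSubalgebra.eq_top_iff.2 fun a => ?_
  obtain ⟨t, ht, hta⟩ := hle a.2
  obtain rfl : t = a := Subtype.ext hta
  exact ht

variable {S : Type u} [AddCommGroup S] [Module ℂ S] [StarAddMonoid S]
  [StarModule ℂ S] [One S] [OperatorSystem S]

theorem IsUCP.isHermitian_of_map {H : Type u} [NormedAddCommGroup H] [InnerProductSpace ℂ H]
    [CompleteSpace H] {φ : S →ₗ[ℂ] (H →L[ℂ] H)} (hφ : IsUCP φ) (hinj : Function.Injective φ)
    {n : ℕ} {M : Matrix (Fin n) (Fin n) S} (h : (M.map φ).IsHermitian) : M.IsHermitian := by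
  ext i j
  apply hinj
  rw [Matrix.conjTranspose_apply, hφ.map_star]
  exact congrFun (congrFun h i) j

/-- A unital completely positive map which determines the order on hermitian matrices is
injective. -/
theorem IsUCP.injective_of_reflects {H : Type u} [NormedAddCommGroup H] [InnerProductSpace ℂ H]
    [CompleteSpace H] {φ : S →ₗ[ℂ] (H →L[ℂ] H)} (hφ : IsUCP φ)
    (h : ∀ (n : ℕ) (M : Matrix (Fin n) (Fin n) S), M.IsHermitian →
      (∀ ξ : Fin n → H, 0 ≤ ∑ k, ∑ l, inner ℂ (ξ k) (φ (M k l) (ξ l))) →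
      M ∈ OperatorSystem.matCone n) : Function.Injective φ := by
  have key : ∀ s, star s = s → φ s = 0 → s = 0 := by
    intro s hs h0
    have hm : ∀ t : S, star t = t → φ t = 0 →
        (Matrix.of fun _ _ => t : Matrix (Fin 1) (Fin 1) S) ∈ OperatorSystem.matCone 1 := by
      intro t ht h0
      exact h 1 _ (by ext i j; exact ht) fun ξ => by simp [h0]
    have := OperatorSystem.proper (hm s hs h0) (hm (-s) (by rw [star_neg, hs]) (by simp [h0]))
    exact congrFun (congrFun this 0) 0
  rw [injective_iff_map_eq_zero]
  intro s hs
  have hs' : φ (star s) = 0 := by rw [hφ.map_star, hs, star_zero]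
  have h1 := key (s + star s) (by simp [add_comm]) (by simp [hs, hs'])
  have h2 := key (Complex.I • (s - star s)) (by simp [sub_eq_add_neg, add_comm])
    (by simp [hs, hs'])
  have h3 : s - star s = 0 := (smul_eq_zero.1 h2).resolve_left Complex.I_ne_zero
  have h4 : (2 : ℂ) • s = 0 := by
    rw [two_smul]
    calc s + s = (s + star s) + (s - star s) := by abel
      _ = 0 := by rw [h1, h3, add_zero]
  exact (smul_eq_zero.1 h4).resolve_left two_ne_zero

variable (S) in
/-- Every operator system has a C*-envelope, with a faithful representation whose restriction to
the operator system is maximal. -/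
theorem OperatorSystem.exists_isCStarEnvelope :
    ∃ (E : Type u) (_ : CStarAlgebra E) (ι : S →ₗ[ℂ] E)
      (H : Type u) (_ : NormedAddCommGroup H) (_ : InnerProductSpace ℂ H) (_ : CompleteSpace H)
      (π : E →⋆ₐ[ℂ] (H →L[ℂ] H)), IsCStarEnvelope ι ∧ Function.Injective π ∧
        IsMaximalUCP ((π : E →ₗ[ℂ] (H →L[ℂ] H)).comp ι) := by
  obtain ⟨H, _, _, _, φ, hφ, hrefl⟩ := OperatorSystem.exists_isMaximalUCP S
  have hinj := hφ.isUCP.injective_of_reflects hrefl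
  let A := (StarAlgebra.adjoin ℂ (Set.range φ)).topologicalClosure
  have hA : IsClosed (A : Set (H →L[ℂ] H)) := StarSubalgebra.isClosed_topologicalClosure _
  have hmem : ∀ s, φ s ∈ A := fun s =>
    StarSubalgebra.le_topologicalClosure _ (StarAlgebra.subset_adjoin ℂ _ ⟨s, rfl⟩)
  let ι : S →ₗ[ℂ] A :=
    { toFun := fun s => ⟨φ s, hmem s⟩
      map_add' := fun s t => Subtype.ext (map_add φ s t)
      map_smul' := fun c s => Subtype.ext (map_smul φ c s) }
  have hsub : Function.Injective A.subtype := Subtype.val_injective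
  have hcover : IsCStarCover ι :=
    { map_one := Subtype.ext hφ.isUCP.map_one
      matPos_iff := fun n M => by
        have hmap : (M.map ι).map A.subtype = M.map φ := rfl
        constructor
        · intro hM
          have h1 := hM.map A.subtype
          rw [hmap] at h1
          exact hrefl n M (hφ.isUCP.isHermitian_of_map hinj h1.isHermitian) h1.sum_inner_nonneg
        · intro hM
          refine MatPos.of_map A.subtype hsub ?_
          rw [hmap]
          refine matPos_of_sum_inner_nonneg ?_ (hφ.isUCP.nonneg n M hM)
          ext1 i j
          have := congrFun (congrFun (OperatorSystem.isHermitian_of_mem hM) i) j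
          rw [Matrix.conjTranspose_apply] at this ⊢
          rw [Matrix.map_apply, Matrix.map_apply, ← hφ.isUCP.map_star, this]
      generates := StarSubalgebra.topologicalClosure_adjoin_eq_top_of_subset (by
        rintro _ ⟨s, rfl⟩
        exact ⟨ι s, StarSubalgebra.le_topologicalClosure _
          (StarAlgebra.subset_adjoin ℂ _ ⟨s, rfl⟩), rfl⟩) }
  exact ⟨A, inferInstance, ι, H, inferInstance, inferInstance, inferInstance, A.subtype,
    IsMaximalUCP.isCStarEnvelope hcover A.subtype hsub hφ, hsub, hφ⟩

end EnvelopeExistence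

/-! ### Extension of the action to the C*-envelope -/

section Automorphisms

variable {S : Type u} [AddCommGroup S] [Module ℂ S] [StarAddMonoid S]
  [StarModule ℂ S] [One S] [OperatorSystem S]

theorem IsCStarCover.comp_opSysAut {C : Type u} [CStarAlgebra C] {ρ : S →ₗ[ℂ] C}
    (hρ : IsCStarCover ρ) (a : opSysAut S) :
    IsCStarCover (ρ.comp ((a : S ≃ₗ[ℂ] S) : S →ₗ[ℂ] S)) where
  map_one := by
    change ρ ((a : S ≃ₗ[ℂ] S) 1) = 1
    rw [a.2.1, hρ.map_one]
  matPos_iff n M := by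
    rw [← a.2.2 n M, ← hρ.matPos_iff]
    rfl
  generates := by
    rw [← hρ.generates]
    congr 2
    exact (a : S ≃ₗ[ℂ] S).surjective.range_comp ρ

/-- A dilation of φ ∘ a, composed with a⁻¹, is a dilation of φ and hence trivial. -/
theorem IsMaximalUCP.comp_opSysAut {H : Type u} [NormedAddCommGroup H] [InnerProductSpace ℂ H]
    {φ : S →ₗ[ℂ] (H →L[ℂ] H)} (hφ : IsMaximalUCP φ) (a : opSysAut S) :
    IsMaximalUCP (φ.comp ((a : S ≃ₗ[ℂ] S) : S →ₗ[ℂ] S)) := by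
  have key : ∀ {K : Type u} [NormedAddCommGroup K] [InnerProductSpace ℂ K]
      {η : S →ₗ[ℂ] (K →L[ℂ] K)} (b : opSysAut S), IsUCP η →
      IsUCP (η.comp ((b : S ≃ₗ[ℂ] S) : S →ₗ[ℂ] S)) := fun {K} _ _ {η} b hη =>
    { map_one := by
        change η ((b : S ≃ₗ[ℂ] S) 1) = 1
        rw [b.2.1, hη.map_one]
      nonneg := fun n M hM ξ => hη.nonneg n (M.map (b : S ≃ₗ[ℂ] S)) ((b.2.2 n M).2 hM) ξ }
  refine ⟨key a hφ.isUCP, fun K _ _ _ η W hη hW s y => ?_⟩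
  have h := hφ.trivial_dilation K _ W (key a⁻¹ hη) (fun s x y => by
    change inner ℂ (W x) (η ((a : S ≃ₗ[ℂ] S).symm s) (W y)) = _
    rw [hW]
    change inner ℂ x (φ ((a : S ≃ₗ[ℂ] S) ((a : S ≃ₗ[ℂ] S).symm s)) y) = _
    rw [LinearEquiv.apply_symm_apply]) ((a : S ≃ₗ[ℂ] S) s) y
  change η ((a : S ≃ₗ[ℂ] S).symm ((a : S ≃ₗ[ℂ] S) s)) (W y) = _ at h
  rwa [LinearEquiv.symm_apply_apply] at h

variable {G : Type u} [Group G] {E : Type u} [CStarAlgebra E]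

/-- An action on an operator system extends uniquely to its C*-envelope. -/
theorem IsCStarEnvelope.existsUnique_isAdmissible {ι : S →ₗ[ℂ] E} (hι : IsCStarEnvelope ι)
    (D : OpSysDynSystem S G) : ∃! β : G →* (E ≃⋆ₐ[ℂ] E), IsAdmissible D ι β := by
  have hex : ∀ g, ∃ f : E →⋆ₐ[ℂ] E, ∀ s, f (ι s) = ι ((D.act g : S ≃ₗ[ℂ] S) s) := by
    intro g
    -- The twisted embedding ι ∘ α_{g⁻¹} is again a cover. Its universal map sends ι(α_{g⁻¹} s) to ι
    -- s, hence ι s to ι(α_g s).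
    obtain ⟨f, ⟨-, hf⟩, -⟩ := hι.universal E _ (hι.isCStarCover.comp_opSysAut (D.act g⁻¹))
    refine ⟨f, fun s => ?_⟩
    rw [← hf ((D.act g : S ≃ₗ[ℂ] S) s)]
    change f (ι s) = f (ι ((D.act g⁻¹ : S ≃ₗ[ℂ] S) ((D.act g : S ≃ₗ[ℂ] S) s)))
    rw [map_inv]
    exact congrArg (fun t => f (ι t)) ((D.act g : S ≃ₗ[ℂ] S).symm_apply_apply s).symm
  choose f hf using hex
  have hone : f 1 = StarAlgHom.id ℂ E := hι.isCStarCover.starAlgHom_ext fun s => by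
    rw [hf, map_one]
    rfl
  have hmul : ∀ g h, f (g * h) = (f g).comp (f h) := fun g h =>
    hι.isCStarCover.starAlgHom_ext fun s => by
      rw [hf, map_mul, StarAlgHom.comp_apply, hf, hf]
      rfl
  let β : G →* (E ≃⋆ₐ[ℂ] E) :=
    { toFun := fun g => StarAlgEquiv.ofStarAlgHom (f g) (f g⁻¹)
        (by rw [← hmul, inv_mul_cancel, hone]) (by rw [← hmul, mul_inv_cancel, hone])
      map_one' := StarAlgEquiv.ext fun x => congrArg (fun k : E →⋆ₐ[ℂ] E => k x) hone
      map_mul' := fun g h =>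
        StarAlgEquiv.ext fun x => congrArg (fun k : E →⋆ₐ[ℂ] E => k x) (hmul g h) }
  refine ⟨β, ⟨hι.isCStarCover, hf⟩, fun β' hβ' => ?_⟩
  ext g x
  have : (β' g : E →⋆ₐ[ℂ] E) = f g := hι.isCStarCover.starAlgHom_ext fun s => by
    rw [hf, ← hβ'.equivariant]
    rfl
  exact congrArg (fun k : E →⋆ₐ[ℂ] E => k x) this

/-- Every C*-envelope has a faithful representation whose restriction is maximal. -/
theorem IsCStarEnvelope.exists_isMaximalUCP {ι : S →ₗ[ℂ] E} (hι : IsCStarEnvelope ι) :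
    ∃ (H : Type u) (_ : NormedAddCommGroup H) (_ : InnerProductSpace ℂ H) (_ : CompleteSpace H)
      (π : E →⋆ₐ[ℂ] (H →L[ℂ] H)), Function.Injective π ∧
        IsMaximalUCP ((π : E →ₗ[ℂ] (H →L[ℂ] H)).comp ι) := by
  obtain ⟨E₀, _, ι₀, H, _, _, _, π, hι₀, hπ, hmax⟩ := OperatorSystem.exists_isCStarEnvelope S
  obtain ⟨Ψ, hΨ, -⟩ := hι₀.existsUnique_starAlgEquiv hι
  refine ⟨H, inferInstance, inferInstance, inferInstance, π.comp (Ψ : E →⋆ₐ[ℂ] E₀),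
    hπ.comp Ψ.injective, ?_⟩
  convert hmax using 1
  ext1 s
  exact congrArg π (hΨ s)

end Automorphisms

/-! ### Algebra of the reduced crossed product -/

section RegShift

variable {G : Type u} [Group G] {H : Type u} [NormedAddCommGroup H] [InnerProductSpace ℂ H]

theorem regShift_one : regShift H (1 : G) = 1 :=
  ContinuousLinearMap.ext fun ξ => lp.ext <| funext fun h => by
    rw [regShift_apply, inv_one, one_mul]
    rfl

theorem regShift_mul (g h : G) : regShift H (g * h) = regShift H g * regShift H h :=
  ContinuousLinearMap.ext fun ξ => lp.ext <| funext fun k => by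
    change ξ ((g * h)⁻¹ * k) = ξ (h⁻¹ * (g⁻¹ * k))
    rw [mul_inv_rev, mul_assoc]

theorem norm_regShift_le (g : G) : ‖regShift H g‖ ≤ 1 :=
  LinearMap.mkContinuous_norm_le _ zero_le_one _

/-- The shift is a contraction with contractive inverse. -/
theorem norm_regShift_apply (g : G) (ξ : L2 G H) : ‖regShift H g ξ‖ = ‖ξ‖ := by
  have key : ∀ (g : G) (ξ : L2 G H), ‖regShift H g ξ‖ ≤ ‖ξ‖ := fun g ξ => by
    simpa using (regShift H g).le_of_opNorm_le (norm_regShift_le g) ξ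
  refine le_antisymm (key g ξ) ?_
  have h := key g⁻¹ (regShift H g ξ)
  have e : regShift H g⁻¹ (regShift H g ξ) = ξ := by
    change (regShift H g⁻¹ * regShift H g) ξ = ξ
    rw [← regShift_mul, inv_mul_cancel, regShift_one]
    rfl
  rwa [e] at h

end RegShift

section CrossedProductAlgebra

variable {E : Type u} [CStarAlgebra E] {G : Type u} [Group G]
  {H : Type u} [NormedAddCommGroup H] [InnerProductSpace ℂ H] [CompleteSpace H]

theorem regRep_add (β : G →* (E ≃⋆ₐ[ℂ] E)) (π : E →⋆ₐ[ℂ] (H →L[ℂ] H)) (a b : E) :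
    regRep β π (a + b) = regRep β π a + regRep β π b :=
  ContinuousLinearMap.ext fun ξ => lp.ext <| funext fun h => by
    change π (β h⁻¹ (a + b)) (ξ h) = π (β h⁻¹ a) (ξ h) + π (β h⁻¹ b) (ξ h)
    rw [map_add, map_add]
    rfl

theorem regRep_smul (β : G →* (E ≃⋆ₐ[ℂ] E)) (π : E →⋆ₐ[ℂ] (H →L[ℂ] H)) (c : ℂ) (a : E) :
    regRep β π (c • a) = c • regRep β π a :=
  ContinuousLinearMap.ext fun ξ => lp.ext <| funext fun h => by
    change π (β h⁻¹ (c • a)) (ξ h) = c • π (β h⁻¹ a) (ξ h)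
    rw [map_smul, map_smul]
    rfl

theorem regRep_mul (β : G →* (E ≃⋆ₐ[ℂ] E)) (π : E →⋆ₐ[ℂ] (H →L[ℂ] H)) (a b : E) :
    regRep β π (a * b) = regRep β π a * regRep β π b :=
  ContinuousLinearMap.ext fun ξ => lp.ext <| funext fun h => by
    change π (β h⁻¹ (a * b)) (ξ h) = π (β h⁻¹ a) (π (β h⁻¹ b) (ξ h))
    rw [map_mul, map_mul]
    rfl

theorem regRep_one (β : G →* (E ≃⋆ₐ[ℂ] E)) (π : E →⋆ₐ[ℂ] (H →L[ℂ] H)) :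
    regRep β π 1 = 1 := by
  have := regRep_one_mul_regShift_one β π
  rwa [regShift_one, mul_one] at this

variable (β : G →* (E ≃⋆ₐ[ℂ] E)) (π : E →⋆ₐ[ℂ] (H →L[ℂ] H))

theorem crossedMonomial_mul (a b : E) (g h : G) :
    crossedMonomial β π a g * crossedMonomial β π b h =
      crossedMonomial β π (a * β g b) (g * h) := by
  refine Subtype.ext ?_
  change regRep β π a * regShift H g * (regRep β π b * regShift H h) =
    regRep β π (a * β g b) * regShift H (g * h)
  rw [regRep_mul, regShift_mul, mul_assoc, ← mul_assoc (regShift H g), regShift_mul_regRep]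
  simp only [mul_assoc]

/-- The canonical embedding of `E` into the reduced crossed product. -/
noncomputable def crossedHom : E →⋆ₐ[ℂ] reducedCrossedProduct β π where
  toFun a := crossedMonomial β π a 1
  map_one' := crossedMonomial_one β π
  map_mul' a b := by
    rw [crossedMonomial_mul, mul_one, map_one]
    rfl
  map_zero' := Subtype.ext (by
    change regRep β π 0 * regShift H 1 = 0
    rw [← zero_smul ℂ (0 : E), regRep_smul, zero_smul, zero_mul])
  map_add' a b := Subtype.ext (by
    change regRep β π (a + b) * regShift H 1 = regRep β π a * regShift H 1 +
      regRep β π b * regShift H 1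
    rw [regRep_add, add_mul])
  commutes' r := Subtype.ext (by
    change regRep β π (algebraMap ℂ E r) * regShift H 1 = algebraMap ℂ _ r
    rw [Algebra.algebraMap_eq_smul_one, regRep_smul, regRep_one, regShift_one, mul_one,
      Algebra.algebraMap_eq_smul_one])
  map_star' a := by
    rw [star_crossedMonomial, inv_one, map_one]
    rfl

theorem crossedHom_apply (a : E) : crossedHom β π a = crossedMonomial β π a 1 := rfl

theorem crossedMonomial_eq_mul (a : E) (g : G) :
    crossedMonomial β π a g = crossedHom β π a * crossedMonomial β π 1 g := by
  rw [crossedHom_apply, crossedMonomial_mul, one_mul, map_one, mul_one]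

theorem norm_crossedMonomial_one_le (g : G) : ‖crossedMonomial β π 1 g‖ ≤ 1 := by
  change ‖regRep β π 1 * regShift H g‖ ≤ 1
  rw [regRep_one, one_mul]
  exact norm_regShift_le g

end CrossedProductAlgebra

/-! ### The crossed product as a C*-cover -/

section CrossedProductCover

variable {S : Type u} [AddCommGroup S] [Module ℂ S] [StarAddMonoid S]
  [StarModule ℂ S] [One S] [OperatorSystem S] {G : Type u} [Group G]
  {E : Type u} [CStarAlgebra E]
  {H : Type u} [NormedAddCommGroup H] [InnerProductSpace ℂ H] [CompleteSpace H]

theorem crossedMonomial_mem_opSysReducedCrossedProduct (D : OpSysDynSystem S G) {ι : S →ₗ[ℂ] E}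
    {β : G →* (E ≃⋆ₐ[ℂ] E)} (hβ : IsAdmissible D ι β) (π : E →⋆ₐ[ℂ] (H →L[ℂ] H)) (s : S)
    {g : G} (hg : g ∈ D.gens) :
    crossedMonomial β π (ι s) g ∈ opSysReducedCrossedProduct D hβ π :=
  Submodule.subset_span ⟨s, g, hg, rfl⟩

/-- The reduced crossed product of an admissible C*-cover is a C*-cover of the reduced crossed
product of the operator system. -/
theorem isCStarCover_opSysReducedCrossedProduct_incl (D : OpSysDynSystem S G) {ι : S →ₗ[ℂ] E}
    {β : G →* (E ≃⋆ₐ[ℂ] E)} (hβ : IsAdmissible D ι β) (π : E →⋆ₐ[ℂ] (H →L[ℂ] H)) :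
    IsCStarCover (opSysReducedCrossedProduct D hβ π).incl where
  map_one := rfl
  matPos_iff _ _ := Iff.rfl
  generates := by
    let P := (StarAlgebra.adjoin ℂ
      (Set.range (opSysReducedCrossedProduct D hβ π).incl)).topologicalClosure
    have hPc : IsClosed (P : Set (reducedCrossedProduct β π)) :=
      StarSubalgebra.isClosed_topologicalClosure _
    have hmem : ∀ (s : S) (g : G), g ∈ D.gens → crossedMonomial β π (ι s) g ∈ P :=
      fun s g hg => StarSubalgebra.le_topologicalClosure _ (StarAlgebra.subset_adjoin ℂ _
        ⟨⟨_, crossedMonomial_mem_opSysReducedCrossedProduct D hβ π s hg⟩, rfl⟩)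
    -- Since e ∈ 𝔤, the elements ι(s)λ_e are available, and they generate the copy of E.
    have hE : ∀ a, crossedHom β π a ∈ P := fun a =>
      hβ.isCStarCover.mem_of_isClosed (P.comap (crossedHom β π))
        (hPc.preimage (crossedHom β π).continuous_of_cstar)
        (fun s => hmem s 1 D.one_mem_gens) a
    -- Since 1 ∈ S, the elements λ_g with g ∈ 𝔤 are available, and they generate all λ_g.
    have hG : ∀ g, crossedMonomial β π 1 g ∈ P := by
      intro g
      have hg : g ∈ Subgroup.closure D.gens := by rw [D.closure_gens]; trivial
      induction hg using Subgroup.closure_induction with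
      | mem g hg => rw [← hβ.isCStarCover.map_one]; exact hmem 1 g hg
      | one => rw [crossedMonomial_one]; exact one_mem P
      | mul g h _ _ hg hh =>
        have := mul_mem hg hh
        rwa [crossedMonomial_mul, map_one, mul_one] at this
      | inv g _ hg =>
        have := star_mem hg
        rwa [star_crossedMonomial, star_one, map_one] at this
    refine StarSubalgebra.topologicalClosure_adjoin_eq_top_of_subset ?_
    rintro _ ⟨a, g, rfl⟩
    refine ⟨crossedMonomial β π a g, ?_, rfl⟩
    rw [crossedMonomial_eq_mul]
    exact mul_mem (hE a) (hG g)

end CrossedProductCover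

/-! ### Independence of the faithful representation -/

section MatrixNorm

variable {E : Type u} [CStarAlgebra E]
  {H : Type u} [NormedAddCommGroup H] [InnerProductSpace ℂ H] [CompleteSpace H]

/-- It translates the norm bound ‖π(N)‖ ≤ c into positivity of c² - N*N under π, which faithful
representations reflect. -/
theorem sum_inner_smul_unitMat_sub {n : ℕ} (c : ℝ) (N : Matrix (Fin n) (Fin n) E)
    (π : E →⋆ₐ[ℂ] (H →L[ℂ] H)) (ξ : Fin n → H) :
    ∑ k, ∑ l, inner ℂ (ξ k) ((((c ^ 2 : ℝ) : ℂ) • unitMat E n - Nᴴ * N).map π k l (ξ l)) =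
      ((c ^ 2 * ∑ k, ‖ξ k‖ ^ 2 - ∑ k, ‖∑ l, π (N k l) (ξ l)‖ ^ 2 : ℝ) : ℂ) := by
  have hmap : ∀ k l, (((c ^ 2 : ℝ) : ℂ) • unitMat E n - Nᴴ * N).map π k l =
      (if k = l then ((c ^ 2 : ℝ) : ℂ) • 1 else 0) - ((N.map π)ᴴ * N.map π) k l := fun k l => by
    rw [Matrix.map_apply, Matrix.sub_apply, map_sub, Matrix.smul_apply, map_smul, unitMat,
      Matrix.diagonal_apply]
    congr 1
    · split_ifs <;> simp
    · simp only [Matrix.mul_apply, map_sum, map_mul, Matrix.conjTranspose_apply, Matrix.map_apply,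
        map_star]
  have h1 : ∀ x : H, inner ℂ x x = ((‖x‖ ^ 2 : ℝ) : ℂ) := fun x => by
    rw [inner_self_eq_norm_sq_to_K]
    simp
  simp only [hmap, sub_apply, inner_sub_right, Finset.sum_sub_distrib,
    sum_inner_conjTranspose_mul_self, h1]
  push_cast
  congr 1
  rw [Finset.mul_sum]
  refine Finset.sum_congr rfl fun k _ => ?_
  rw [Finset.sum_eq_single k (fun l _ hl => by simp [hl.symm]) (by simp)]
  simp [inner_smul_right]

/-- The norm of a matrix over a C*-algebra can be computed in any faithful representation. -/
theorem sum_norm_sq_le_of_injective {K : Type u} [NormedAddCommGroup K] [InnerProductSpace ℂ K]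
    [CompleteSpace K] {π : E →⋆ₐ[ℂ] (H →L[ℂ] H)} (hπ : Function.Injective π)
    (κ : E →⋆ₐ[ℂ] (K →L[ℂ] K)) {n : ℕ} (N : Matrix (Fin n) (Fin n) E) {c : ℝ}
    (h : ∀ ξ : Fin n → H, ∑ k, ‖∑ l, π (N k l) (ξ l)‖ ^ 2 ≤ c ^ 2 * ∑ k, ‖ξ k‖ ^ 2)
    (ξ : Fin n → K) : ∑ k, ‖∑ l, κ (N k l) (ξ l)‖ ^ 2 ≤ c ^ 2 * ∑ k, ‖ξ k‖ ^ 2 := by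
  set M := ((c ^ 2 : ℝ) : ℂ) • unitMat E n - Nᴴ * N with hMdef
  have hM : M.IsHermitian := by
    refine Matrix.IsHermitian.sub ?_ (Matrix.isHermitian_conjTranspose_mul_self N)
    rw [Matrix.IsHermitian, Matrix.conjTranspose_smul, Complex.star_def, Complex.conj_ofReal,
      unitMat, Matrix.diagonal_conjTranspose]
    congr
    ext
    simp
  have hπM : MatPos (M.map π) := by
    refine matPos_of_sum_inner_nonneg ?_ fun ξ => ?_
    · ext1 i j
      rw [Matrix.conjTranspose_apply, Matrix.map_apply, Matrix.map_apply, ← map_star]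
      exact congrArg π (congrFun (congrFun hM i) j)
    · rw [hMdef, sum_inner_smul_unitMat_sub]
      exact_mod_cast sub_nonneg.2 (h ξ)
  have h2 := ((hπM.of_map π hπ).map κ).sum_inner_nonneg ξ
  rw [hMdef, sum_inner_smul_unitMat_sub] at h2
  exact sub_nonneg.1 (by exact_mod_cast h2)

end MatrixNorm

section L2

theorem Finset.sum_eq_sum_equivFin {α M : Type*} [AddCommMonoid M] (F : Finset α) (r : α → M) :
    ∑ h ∈ F, r h = ∑ i, r (F.equivFin.symm i) := by
  rw [← Finset.sum_coe_sort F r]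
  exact (F.equivFin.symm.sum_comp fun h : F => r h).symm

variable {G : Type u} {H : Type u} [NormedAddCommGroup H]

theorem L2.sum_norm_sq_le (ξ : L2 G H) (F : Finset G) : ∑ h ∈ F, ‖ξ h‖ ^ 2 ≤ ‖ξ‖ ^ 2 := by
  have := lp.sum_rpow_le_norm_rpow (p := 2) (by simp) ξ F
  simpa using this

theorem L2.norm_sq_le_of_forall_sum_le {ξ : L2 G H} {c : ℝ}
    (h : ∀ F : Finset G, ∑ h ∈ F, ‖ξ h‖ ^ 2 ≤ c) : ‖ξ‖ ^ 2 ≤ c := by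
  rw [L2.norm_sq]
  exact Real.tsum_le_of_sum_le (fun _ => by positivity) h

theorem L2.norm_sum_single_sq [DecidableEq G] (f : G → H) (F : Finset G) :
    ‖∑ h ∈ F, (lp.single 2 h (f h) : L2 G H)‖ ^ 2 = ∑ h ∈ F, ‖f h‖ ^ 2 := by
  have := lp.norm_sum_single (E := fun _ : G => H) (p := 2) (by simp) f F
  simpa using this

end L2

section CoefficientOperator

variable {E : Type u} [CStarAlgebra E] {G : Type u} [Group G]
  {H : Type u} [NormedAddCommGroup H] [InnerProductSpace ℂ H] [CompleteSpace H]

/-- The operator `∑ f(g) λ_g` on `ℓ²(G, H)`. -/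
noncomputable def coeffOp (β : G →* (E ≃⋆ₐ[ℂ] E)) (π : E →⋆ₐ[ℂ] (H →L[ℂ] H)) :
    (G →₀ E) →ₗ[ℂ] (L2 G H →L[ℂ] L2 G H) :=
  Finsupp.lsum ℂ fun g =>
    { toFun := fun a => regRep β π a * regShift H g
      map_add' := fun a b => by rw [regRep_add, add_mul]
      map_smul' := fun c a => by rw [regRep_smul, smul_mul_assoc, RingHom.id_apply] }

theorem coeffOp_single (β : G →* (E ≃⋆ₐ[ℂ] E)) (π : E →⋆ₐ[ℂ] (H →L[ℂ] H)) (g : G) (a : E) :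
    coeffOp β π (Finsupp.single g a) = regRep β π a * regShift H g := by
  rw [coeffOp, Finsupp.lsum_single]
  rfl

/-- The matrix of the operator is the image under π of a G × G matrix over E that does not involve
π. This allows comparing two representations corner by corner. -/
theorem coeffOp_apply_single [DecidableEq G] (β : G →* (E ≃⋆ₐ[ℂ] E)) (π : E →⋆ₐ[ℂ] (H →L[ℂ] H))
    (f : G →₀ E) (h k : G) (x : H) :
    coeffOp β π f (lp.single 2 h x) k = π (β k⁻¹ (f (k * h⁻¹))) x := by
  induction f using Finsupp.induction_linear with
  | zero => simp
  | add f f' hf hf' =>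
    rw [map_add, Finsupp.add_apply, map_add, map_add]
    exact congrArg₂ (· + ·) hf hf'
  | single g a =>
    rw [coeffOp_single]
    change π (β k⁻¹ a) ((lp.single 2 h x : L2 G H) (g⁻¹ * k)) = _
    by_cases hg : g = k * h⁻¹
    · subst hg
      have : (k * h⁻¹)⁻¹ * k = h := by group
      rw [this, lp.single_apply_self, Finsupp.single_eq_same]
    · have : g⁻¹ * k ≠ h := fun e => hg (by rw [← e]; group)
      rw [lp.single_apply_ne _ _ _ this, Finsupp.single_eq_of_ne' hg]
      simp

theorem coeffOp_apply_sum_single [DecidableEq G] (β : G →* (E ≃⋆ₐ[ℂ] E))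
    (π : E →⋆ₐ[ℂ] (H →L[ℂ] H)) (f : G →₀ E) (F : Finset G) (ξ : G → H) (k : G) :
    coeffOp β π f (∑ h ∈ F, lp.single 2 h (ξ h)) k =
      ∑ h ∈ F, π (β k⁻¹ (f (k * h⁻¹))) (ξ h) := by
  rw [map_sum, lp.coeFn_sum, Finset.sum_apply]
  exact Finset.sum_congr rfl fun h _ => coeffOp_apply_single β π f h k (ξ h)

/-- Finite corners determine the norm, and each is the image of a finite matrix over E. A norm bound
valid in a faithful representation is valid in every representation. -/
theorem norm_coeffOp_le_of_injective {K : Type u} [NormedAddCommGroup K] [InnerProductSpace ℂ K]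
    [CompleteSpace K] (β : G →* (E ≃⋆ₐ[ℂ] E)) {π : E →⋆ₐ[ℂ] (H →L[ℂ] H)}
    (hπ : Function.Injective π) (κ : E →⋆ₐ[ℂ] (K →L[ℂ] K)) (f : G →₀ E) :
    ‖coeffOp β κ f‖ ≤ ‖coeffOp β π f‖ := by
  classical
  set c := ‖coeffOp β π f‖
  have key : ∀ (F : Finset G) (ξ : G → K), ∑ k ∈ F, ‖∑ h ∈ F, κ (β k⁻¹ (f (k * h⁻¹))) (ξ h)‖ ^ 2 ≤
      c ^ 2 * ∑ h ∈ F, ‖ξ h‖ ^ 2 := by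
    intro F ξ
    let ε := F.equivFin.symm
    let N : Matrix (Fin F.card) (Fin F.card) E :=
      Matrix.of fun k l => β (ε k : G)⁻¹ (f (ε k * (ε l : G)⁻¹))
    have h := sum_norm_sq_le_of_injective hπ κ N (c := c) (fun ζ => ?_) fun i => ξ (ε i)
    · simp only [F.sum_eq_sum_equivFin]
      exact h
    -- Extension by zero identifies vectors indexed by the corner with finitely supported vectors in
    -- ℓ²(G, H).
    · let η : G → H := fun g => if hg : g ∈ F then ζ (F.equivFin ⟨g, hg⟩) else 0
      have hη : ∀ i, η (ε i) = ζ i := fun i => by simp [η, ε]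
      have h1 := L2.sum_norm_sq_le (coeffOp β π f (∑ h ∈ F, lp.single 2 h (η h))) F
      have h2 : ‖coeffOp β π f (∑ h ∈ F, lp.single 2 h (η h))‖ ^ 2 ≤
          c ^ 2 * ∑ h ∈ F, ‖η h‖ ^ 2 := by
        rw [← L2.norm_sum_single_sq, ← mul_pow]
        gcongr
        exact (coeffOp β π f).le_opNorm _
      have h3 := h1.trans h2
      simp only [coeffOp_apply_sum_single] at h3
      simp only [F.sum_eq_sum_equivFin] at h3
      change ∑ k, ‖∑ l, π (N k l) (η (ε l))‖ ^ 2 ≤ c ^ 2 * ∑ k, ‖η (ε k)‖ ^ 2 at h3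
      simpa only [hη] using h3
  refine ContinuousLinearMap.opNorm_le_bound _ (norm_nonneg _) fun ξ => ?_
  refine le_of_sq_le_sq ?_ (by positivity)
  refine L2.norm_sq_le_of_forall_sum_le fun F₀ => ?_
  -- Fix finitely many output coordinates and let the input be truncated to finite sets F ⊇ F₀
  -- increasing to G; the corner bound passes to the limit.
  have hcont : Continuous fun ζ : L2 G K => ∑ k ∈ F₀, ‖coeffOp β κ f ζ k‖ ^ 2 := by
    have h1 : ∀ k, Continuous fun ζ : L2 G K => ζ k := fun k =>
      (continuous_apply k).comp (lp.uniformContinuous_coe (E := fun _ : G => K) (p := 2)).continuous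
    exact continuous_finsetSum _ fun k _ =>
      (((h1 k).comp (coeffOp β κ f).continuous).norm.pow 2)
  have hlim := (hcont.tendsto ξ).comp (lp.hasSum_single (p := 2) (by simp) ξ)
  refine le_of_tendsto hlim ?_
  filter_upwards [Filter.eventually_ge_atTop F₀] with F hF
  calc ∑ k ∈ F₀, ‖coeffOp β κ f (∑ h ∈ F, lp.single 2 h (ξ h)) k‖ ^ 2
      ≤ ∑ k ∈ F, ‖coeffOp β κ f (∑ h ∈ F, lp.single 2 h (ξ h)) k‖ ^ 2 :=
        Finset.sum_le_sum_of_subset_of_nonneg hF fun _ _ _ => by positivity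
    _ = ∑ k ∈ F, ‖∑ h ∈ F, κ (β k⁻¹ (f (k * h⁻¹))) (ξ h)‖ ^ 2 := by
        simp only [coeffOp_apply_sum_single]
    _ ≤ c ^ 2 * ∑ h ∈ F, ‖ξ h‖ ^ 2 := key F ξ
    _ ≤ c ^ 2 * ‖ξ‖ ^ 2 := by
        gcongr
        exact L2.sum_norm_sq_le ξ F
    _ = (c * ‖ξ‖) ^ 2 := (mul_pow _ _ _).symm

end CoefficientOperator

section NormPreserving

/-- A norm preserving correspondence of generators extends to the generated C*-algebra. -/
theorem exists_starAlgHom_of_norm_eq {A B : Type u} [CStarAlgebra A] [CStarAlgebra B]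
    {R : Set A} {Q : Set (A × B)} (hR : ∀ r ∈ R, ∃ b, (r, b) ∈ Q)
    (h : ∀ z ∈ StarAlgebra.adjoin ℂ Q, ‖z.1‖ = ‖z.2‖) :
    ∃ σ : (StarAlgebra.adjoin ℂ R).topologicalClosure →⋆ₐ[ℂ] B, Function.Injective σ ∧
      ∀ x : (StarAlgebra.adjoin ℂ R).topologicalClosure, ∀ b, ((x : A), b) ∈ Q → σ x = b := by
  -- Z is the graph of the desired homomorphism. Equality of norms passes to the closure and makes
  -- both coordinate projections injective, so σ is q ∘ p⁻¹.
  let Z := (StarAlgebra.adjoin ℂ Q).topologicalClosure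
  let C := (StarAlgebra.adjoin ℂ R).topologicalClosure
  have hZc : IsClosed (Z : Set (A × B)) := StarSubalgebra.isClosed_topologicalClosure _
  have hCc : IsClosed (C : Set A) := StarSubalgebra.isClosed_topologicalClosure _
  have hnorm : ∀ z ∈ Z, ‖z.1‖ = ‖z.2‖ := fun z hz =>
    closure_minimal (s := (StarAlgebra.adjoin ℂ Q : Set (A × B))) (t := {z | ‖z.1‖ = ‖z.2‖}) h
      (isClosed_eq (by fun_prop) (by fun_prop)) hz
  let p : Z →⋆ₐ[ℂ] A := (StarAlgHom.fst ℂ A B).comp Z.subtype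
  let q : Z →⋆ₐ[ℂ] B := (StarAlgHom.snd ℂ A B).comp Z.subtype
  have hp : Function.Injective p := by
    rw [injective_iff_map_eq_zero]
    intro z hz
    have h1 : (z : A × B).1 = 0 := hz
    have h2 := hnorm z z.2
    rw [h1, norm_zero] at h2
    exact Subtype.ext (Prod.ext h1 (norm_eq_zero.1 h2.symm))
  have hq : Function.Injective q := by
    rw [injective_iff_map_eq_zero]
    intro z hz
    have h1 : (z : A × B).2 = 0 := hz
    have h2 := hnorm z z.2
    rw [h1, norm_zero] at h2
    exact Subtype.ext (Prod.ext (norm_eq_zero.1 h2) h1)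
  have hQZ : ∀ z ∈ Q, z ∈ Z := fun z hz =>
    StarSubalgebra.le_topologicalClosure _ (StarAlgebra.subset_adjoin ℂ _ hz)
  have hCp : C ≤ p.range := StarSubalgebra.topologicalClosure_minimal
    (StarAlgebra.adjoin_le fun r hr => by
      obtain ⟨b, hb⟩ := hR r hr
      exact ⟨⟨(r, b), hQZ _ hb⟩, rfl⟩) p.isClosed_range
  let e := StarAlgEquiv.ofInjective p hp
  let σ : C →⋆ₐ[ℂ] B := (q.comp (e.symm : p.range →⋆ₐ[ℂ] Z)).comp (StarSubalgebra.inclusion hCp)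
  refine ⟨σ, ?_, fun x b hb => ?_⟩
  · exact (hq.comp e.symm.injective).comp (Set.inclusion_injective hCp)
  · have h1 : e.symm (StarSubalgebra.inclusion hCp x) = ⟨((x : A), b), hQZ _ hb⟩ := by
      rw [StarAlgEquiv.symm_apply_eq]
      exact Subtype.ext rfl
    change q (e.symm (StarSubalgebra.inclusion hCp x)) = b
    rw [h1]
    rfl

end NormPreserving

section FaithfulTransfer

variable {E : Type u} [CStarAlgebra E] {G : Type u} [Group G]
  {H : Type u} [NormedAddCommGroup H] [InnerProductSpace ℂ H] [CompleteSpace H]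
  {K : Type u} [NormedAddCommGroup K] [InnerProductSpace ℂ K] [CompleteSpace K]

/-- The function f'' is chosen before the representation: pairs of operators with the same
coefficients in two representations are closed under products. -/
theorem coeffOp_mul_coeffOp (β : G →* (E ≃⋆ₐ[ℂ] E)) (f f' : G →₀ E) :
    ∃ f'' : G →₀ E, ∀ {H : Type u} [NormedAddCommGroup H] [InnerProductSpace ℂ H]
      [CompleteSpace H] (π : E →⋆ₐ[ℂ] (H →L[ℂ] H)),
      coeffOp β π f * coeffOp β π f' = coeffOp β π f'' := by
  induction f using Finsupp.induction_linear with
  | zero => exact ⟨0, fun π => by simp⟩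
  | add f₁ f₂ h₁ h₂ =>
    obtain ⟨g₁, h₁⟩ := h₁
    obtain ⟨g₂, h₂⟩ := h₂
    exact ⟨g₁ + g₂, fun π => by rw [map_add, map_add, add_mul, h₁, h₂]⟩
  | single g a =>
    induction f' using Finsupp.induction_linear with
    | zero => exact ⟨0, fun π => by simp⟩
    | add f₁ f₂ h₁ h₂ =>
      obtain ⟨g₁, h₁⟩ := h₁
      obtain ⟨g₂, h₂⟩ := h₂
      exact ⟨g₁ + g₂, fun π => by rw [map_add, map_add, mul_add, h₁, h₂]⟩
    | single h b =>
      refine ⟨Finsupp.single (g * h) (a * β g b), fun π => ?_⟩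
      simp only [coeffOp_single]
      exact congrArg Subtype.val (crossedMonomial_mul β π a b g h)

theorem star_coeffOp (β : G →* (E ≃⋆ₐ[ℂ] E)) (f : G →₀ E) :
    ∃ f' : G →₀ E, ∀ {H : Type u} [NormedAddCommGroup H] [InnerProductSpace ℂ H]
      [CompleteSpace H] (π : E →⋆ₐ[ℂ] (H →L[ℂ] H)), star (coeffOp β π f) = coeffOp β π f' := by
  induction f using Finsupp.induction_linear with
  | zero => exact ⟨0, fun π => by simp⟩
  | add f₁ f₂ h₁ h₂ =>
    obtain ⟨g₁, h₁⟩ := h₁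
    obtain ⟨g₂, h₂⟩ := h₂
    exact ⟨g₁ + g₂, fun π => by rw [map_add, map_add, star_add, h₁, h₂]⟩
  | single g a =>
    refine ⟨Finsupp.single g⁻¹ (β g⁻¹ (star a)), fun π => ?_⟩
    simp only [coeffOp_single]
    exact congrArg Subtype.val (star_crossedMonomial β π a g)

/-- The reduced crossed product does not depend on the faithful representation. -/
theorem exists_starAlgHom_reducedCrossedProduct (β : G →* (E ≃⋆ₐ[ℂ] E))
    {π : E →⋆ₐ[ℂ] (H →L[ℂ] H)} (hπ : Function.Injective π) {κ : E →⋆ₐ[ℂ] (K →L[ℂ] K)}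
    (hκ : Function.Injective κ) :
    ∃ σ : reducedCrossedProduct β π →⋆ₐ[ℂ] (L2 G K →L[ℂ] L2 G K), Function.Injective σ ∧
      ∀ a g, σ (crossedMonomial β π a g) = regRep β κ a * regShift K g := by
  obtain ⟨σ, hσ, hσ'⟩ := exists_starAlgHom_of_norm_eq
    (R := {x | ∃ (a : E) (g : G), x = regRep β π a * regShift H g})
    (Q := {x | ∃ (a : E) (g : G),
      x = (regRep β π a * regShift H g, regRep β κ a * regShift K g)})
    (by rintro _ ⟨a, g, rfl⟩; exact ⟨_, a, g, rfl⟩)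
    (by
      intro z hz
      obtain ⟨f, rfl⟩ : ∃ f : G →₀ E, z = (coeffOp β π f, coeffOp β κ f) := by
        induction hz using StarAlgebra.adjoin_induction with
        | mem x hx =>
          obtain ⟨a, g, rfl⟩ := hx
          exact ⟨Finsupp.single g a, by rw [coeffOp_single, coeffOp_single]⟩
        | algebraMap r =>
          refine ⟨Finsupp.single 1 (r • 1), ?_⟩
          simp only [coeffOp_single, regRep_smul, regRep_one, regShift_one, mul_one,
            Algebra.algebraMap_eq_smul_one]
          rfl
        | add x y _ _ hx hy =>
          obtain ⟨f, rfl⟩ := hx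
          obtain ⟨f', rfl⟩ := hy
          exact ⟨f + f', by rw [map_add, map_add]; rfl⟩
        | mul x y _ _ hx hy =>
          obtain ⟨f, rfl⟩ := hx
          obtain ⟨f', rfl⟩ := hy
          obtain ⟨f'', h⟩ := coeffOp_mul_coeffOp β f f'
          exact ⟨f'', by rw [← h π, ← h κ]; rfl⟩
        | star x _ hx =>
          obtain ⟨f, rfl⟩ := hx
          obtain ⟨f', h⟩ := star_coeffOp β f
          exact ⟨f', by rw [← h π, ← h κ]; rfl⟩
      exact le_antisymm (norm_coeffOp_le_of_injective β hκ π f)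
        (norm_coeffOp_le_of_injective β hπ κ f))
  exact ⟨σ, hσ, fun a g => hσ' _ _ ⟨a, g, rfl⟩⟩

end FaithfulTransfer

/-! ### Maximality of the regular representation -/

section L2Single

variable {G : Type u} [DecidableEq G] {K : Type u} [NormedAddCommGroup K] [InnerProductSpace ℂ K]

theorem L2.continuousLinearMap_ext {L : Type*} [NormedAddCommGroup L] [NormedSpace ℂ L]
    {T T' : L2 G K →L[ℂ] L} (h : ∀ g x, T (lp.single 2 g x) = T' (lp.single 2 g x)) : T = T' := by
  refine ContinuousLinearMap.ext fun ξ => ?_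
  have hs := lp.hasSum_single (p := 2) (by simp) ξ
  have h1 := hs.mapL T
  have h2 := hs.mapL T'
  simp only [h] at h1
  exact h1.unique h2

variable (K) in
/-- The isometric embedding of `K` as the fibre of `ℓ²(G, K)` over `g`. -/
noncomputable def L2.singleLI (g : G) : K →ₗᵢ[ℂ] L2 G K where
  toFun x := lp.single 2 g x
  map_add' x y := lp.single_add (E := fun _ : G => K) 2 g x y
  map_smul' c x := by rw [lp.single_smul, RingHom.id_apply]
  norm_map' x := lp.norm_single (E := fun _ : G => K) (by simp) g x

end L2Single

section CrossedProductMaximal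

variable {S : Type u} [AddCommGroup S] [Module ℂ S] [StarAddMonoid S]
  [StarModule ℂ S] [One S] [OperatorSystem S] {G : Type u} [Group G]
  {E : Type u} [CStarAlgebra E]
  {H : Type u} [NormedAddCommGroup H] [InnerProductSpace ℂ H] [CompleteSpace H]
  {K : Type u} [NormedAddCommGroup K] [InnerProductSpace ℂ K] [CompleteSpace K]

theorem StarAlgHom.intertwines_of_mem_span {A : Type*} [CStarAlgebra A] (θ : A →⋆ₐ[ℂ] (H →L[ℂ] H))
    (σ : A →⋆ₐ[ℂ] (K →L[ℂ] K)) (U : K →ₗᵢ[ℂ] H) {R : Set A}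
    (h : ∀ x ∈ R, ∀ ξ, θ x (U ξ) = U (σ x ξ)) {x : A} (hx : x ∈ Submodule.span ℂ R) (ξ : K) :
    θ x (U ξ) = U (σ x ξ) := by
  induction hx using Submodule.span_induction with
  | mem x hx => exact h x hx ξ
  | zero => simp
  | add x y _ _ hx hy => simp [hx, hy]
  | smul c x _ hx => simp [hx]

theorem regRep_single [DecidableEq G] (β : G →* (E ≃⋆ₐ[ℂ] E)) (κ : E →⋆ₐ[ℂ] (K →L[ℂ] K)) (a : E)
    (h : G) (x : K) :
    regRep β κ a (lp.single 2 h x) = lp.single 2 h (κ (β h⁻¹ a) x) := by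
  refine lp.ext (funext fun k => ?_)
  rw [regRep_apply]
  by_cases hk : k = h
  · subst hk
    rw [lp.single_apply_self, lp.single_apply_self]
  · rw [lp.single_apply_ne _ _ _ hk, lp.single_apply_ne _ _ _ hk, map_zero]

/-- The diagonal representation induced from a maximal representation has no non-trivial
dilations to representations of `E`. -/
theorem IsMaximalUCP.intertwines_regRep {D : OpSysDynSystem S G} {ι : S →ₗ[ℂ] E}
    {β : G →* (E ≃⋆ₐ[ℂ] E)} (hβ : IsAdmissible D ι β)
    {κ : E →⋆ₐ[ℂ] (K →L[ℂ] K)} (hκ : IsMaximalUCP ((κ : E →ₗ[ℂ] (K →L[ℂ] K)).comp ι))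
    (θ : E →⋆ₐ[ℂ] (H →L[ℂ] H)) (U : L2 G K →ₗᵢ[ℂ] H)
    (h : ∀ s ξ ζ, inner ℂ (U ξ) (θ (ι s) (U ζ)) = inner ℂ ξ (regRep β κ (ι s) ζ))
    (s : S) (ξ : L2 G K) : θ (ι s) (U ξ) = U (regRep β κ (ι s) ξ) := by
  classical
  have hext : θ (ι s) ∘L U.toContinuousLinearMap =
      U.toContinuousLinearMap ∘L regRep β κ (ι s) := by
    refine L2.continuousLinearMap_ext fun g x => ?_
    -- On the fibre over g the diagonal representation of S is κ ∘ ι ∘ α_{g⁻¹}, which is maximal,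
    -- and U restricted to the fibre dilates it to θ ∘ ι.
    have h1 := (hκ.comp_opSysAut (D.act g⁻¹)).trivial_dilation H _
      (U.comp (L2.singleLI K g)) (hβ.isCStarCover.isUCP_comp θ)
      (fun t x y => by
        change inner ℂ (U (lp.single 2 g x)) (θ (ι t) (U (lp.single 2 g y))) =
          inner ℂ x (κ (ι ((D.act g⁻¹ : S ≃ₗ[ℂ] S) t)) y)
        rw [h, regRep_single, hβ.equivariant, lp.inner_single_left, lp.single_apply_self]) s x
    change θ (ι s) (U (lp.single 2 g x)) = U (regRep β κ (ι s) (lp.single 2 g x))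
    rw [regRep_single, hβ.equivariant]
    exact h1
  exact congrArg (fun T : L2 G K →L[ℂ] H => T ξ) hext

set_option maxHeartbeats 1600000 in
/-- The regular representation induced from a maximal representation is maximal on the operator
system crossed product. -/
theorem isMaximalUCP_opSysReducedCrossedProduct (D : OpSysDynSystem S G) {ι : S →ₗ[ℂ] E}
    {β : G →* (E ≃⋆ₐ[ℂ] E)} (hβ : IsAdmissible D ι β) {π : E →⋆ₐ[ℂ] (H →L[ℂ] H)}
    {κ : E →⋆ₐ[ℂ] (K →L[ℂ] K)} (hκ : IsMaximalUCP ((κ : E →ₗ[ℂ] (K →L[ℂ] K)).comp ι))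
    (σ : reducedCrossedProduct β π →⋆ₐ[ℂ] (L2 G K →L[ℂ] L2 G K))
    (hσ : ∀ a g, σ (crossedMonomial β π a g) = regRep β κ a * regShift K g) :
    IsMaximalUCP ((σ : reducedCrossedProduct β π →ₗ[ℂ] (L2 G K →L[ℂ] L2 G K)).comp
      (opSysReducedCrossedProduct D hβ π).incl) := by
  have hcov := isCStarCover_opSysReducedCrossedProduct_incl D hβ π
  refine ⟨hcov.isUCP_comp σ, fun L _ _ _ η W hη hW => ?_⟩
  -- The dilation η need not be multiplicative, so it is enlarged to a representation θ of the
  -- crossed product; the monomials can then be factored as ι(s) times λ_g.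
  obtain ⟨L', _, _, _, θ, V, hV⟩ := hη.exists_starAlgHom_dilation hcov
  obtain ⟨U, hUVW⟩ : ∃ U : L2 G K →ₗᵢ[ℂ] L', ∀ ξ, U ξ = V (W ξ) := ⟨V.comp W, fun _ => rfl⟩
  have hU : ∀ x ∈ opSysReducedCrossedProduct D hβ π, ∀ ξ ζ,
      inner ℂ (U ξ) (θ x (U ζ)) = inner ℂ ξ (σ x ζ) := fun x hx ξ ζ => by
    have h1 := hV ⟨x, hx⟩ (W ξ) (W ζ)
    rw [hW] at h1
    rw [hUVW, hUVW]
    exact h1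
  have hE : ∀ s ξ, θ (crossedHom β π (ι s)) (U ξ) = U (regRep β κ (ι s) ξ) := by
    refine hκ.intertwines_regRep hβ (θ.comp (crossedHom β π)) U fun s ξ ζ => ?_
    have h1 := hU _ (crossedMonomial_mem_opSysReducedCrossedProduct D hβ π s D.one_mem_gens) ξ ζ
    rwa [hσ, regShift_one, mul_one] at h1
  -- The contraction θ(λ_g) compresses to the isometric shift, so no component can leave the range
  -- of U.
  have hG : ∀ g ∈ D.gens, ∀ ξ, θ (crossedMonomial β π 1 g) (U ξ) = U (regShift K g ξ) := by
    intro g hg ξ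
    refine U.eq_of_inner_eq_of_norm_le (fun ζ => ?_) ?_
    · have hmem := crossedMonomial_mem_opSysReducedCrossedProduct D hβ π 1 hg
      rw [hβ.isCStarCover.map_one] at hmem
      rw [hU _ hmem, hσ, regRep_one, one_mul]
    · rw [norm_regShift_apply]
      have h1 := (θ (crossedMonomial β π 1 g)).le_of_opNorm_le
        ((NonUnitalStarAlgHom.norm_apply_le θ _).trans (norm_crossedMonomial_one_le β π g)) (U ξ)
      rwa [one_mul, U.norm_map] at h1
  have hX : ∀ x ∈ opSysReducedCrossedProduct D hβ π, ∀ ξ, θ x (U ξ) = U (σ x ξ) := by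
    intro x hx
    refine θ.intertwines_of_mem_span σ U ?_ hx
    rintro _ ⟨s, g, hg, rfl⟩ ξ
    rw [hσ, crossedMonomial_eq_mul, map_mul]
    exact (congrArg (θ (crossedHom β π (ι s))) (hG g hg ξ)).trans (hE s (regShift K g ξ))
  intro x ξ
  -- Compressing by V returns from θ to η.
  refine ext_inner_left ℂ fun z => ?_
  have h1 := hX _ x.2 ξ
  rw [hUVW, hUVW] at h1
  exact (hV x z (W ξ)).symm.trans
    ((congrArg (fun v => inner ℂ (V z) v) h1).trans (V.inner_map_map z _))

end CrossedProductMaximal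

end Development

theorem mainTheorem3 {S : Type u} [AddCommGroup S] [Module ℂ S] [StarAddMonoid S]
    [StarModule ℂ S] [One S] [OperatorSystem S] {G : Type u} [Group G]
    (D : OpSysDynSystem S G) :
    -- the C*-envelope of `S` exists (as an algebra with a faithful representation)
    (∃ (E : Type u) (_ : CStarAlgebra E) (ι : S →ₗ[ℂ] E)
      (H : Type u) (_ : NormedAddCommGroup H) (_ : InnerProductSpace ℂ H) (_ : CompleteSpace H)
      (π : E →⋆ₐ[ℂ] (H →L[ℂ] H)), IsCStarEnvelope ι ∧ Function.Injective π) ∧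
    ∀ (E : Type u) [CStarAlgebra E] (ι : S →ₗ[ℂ] E), IsCStarEnvelope ι →
      -- the action of `G` extends uniquely to the C*-envelope
      (∃! β : G →* (E ≃⋆ₐ[ℂ] E), IsAdmissible D ι β) ∧
      ∀ (β : G →* (E ≃⋆ₐ[ℂ] E)) (hβ : IsAdmissible D ι β)
        (H : Type u) [NormedAddCommGroup H] [InnerProductSpace ℂ H] [CompleteSpace H]
        (π : E →⋆ₐ[ℂ] (H →L[ℂ] H)), Function.Injective π →
        -- `E ⋊ G` with the inclusion of `S ⋊ 𝔤` is the C*-envelope of `S ⋊ 𝔤`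
        IsCStarEnvelope (opSysReducedCrossedProduct D hβ π).incl ∧
        -- every model of the C*-envelope of `S ⋊ 𝔤` is canonically isomorphic to `E ⋊ G`
        ∀ (F : Type u) [CStarAlgebra F] (j : opSysReducedCrossedProduct D hβ π →ₗ[ℂ] F),
          IsCStarEnvelope j →
          ∃! Φ : F ≃⋆ₐ[ℂ] reducedCrossedProduct β π,
            ∀ x : opSysReducedCrossedProduct D hβ π, Φ (j x) = x := by
  refine ⟨?_, fun E _ ι hι => ⟨hι.existsUnique_isAdmissible D, fun β hβ H _ _ _ π hπ => ?_⟩⟩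
  · obtain ⟨E, hE, ι, H, h1, h2, h3, π, hι, hπ, -⟩ := OperatorSystem.exists_isCStarEnvelope S
    exact ⟨E, hE, ι, H, h1, h2, h3, π, hι, hπ⟩
  -- The given π is faithful but its restriction to S need not be maximal. The crossed product is
  -- therefore represented faithfully over a κ with maximal restriction, where the criterion
  -- applies.
  · obtain ⟨K, _, _, _, κ, hκ, hmax⟩ := hι.exists_isMaximalUCP
    obtain ⟨σ, hσ, hσ'⟩ := exists_starAlgHom_reducedCrossedProduct β hπ hκ
    have henv := IsMaximalUCP.isCStarEnvelope
      (isCStarCover_opSysReducedCrossedProduct_incl D hβ π) σ hσ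
      (isMaximalUCP_opSysReducedCrossedProduct D hβ hmax σ hσ')
    exact ⟨henv, fun F _ j hj => henv.existsUnique_starAlgEquiv hj⟩
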